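/- Let $r,\rho\ge 1$ and consider an evolution equation $\mathcal E$: $u_t=H(t,x,u_{(r,x)})$, where $u_k=\partial^k u/\partial x^k$, $u_{(k,x)}=(u_0,u_1,\dots,u_k)$, and $H$ is a smooth ($C^\infty$) real function on an open set $D\subseteq\mathbb R^{r+3}$ with $H_{u_r}\ne 0$ on $D$. Solutions are understood to be smooth with $(t,x,u_{(r,x)})\in D$. *Conditional symmetries.* Put $E=u_t-H$. For a smooth function $\check\eta(t,x,u_{(\rho-1,x)})$ put $Q=\eta\,\partial_u$ with $\eta=u_\rho-\check\eta(t,x,u_{(\rho-1,x)})$. Let $\mathcal M$ be the set in the jet space given by all differential consequences $D_t^aD_x^bE=0$ of $\mathcal E$ and all differential consequences $D_x^k\eta=0$ with respect to $x$ of $\eta=0$. Then $Q$ is a canonical $\rho$th-order generalized conditional symmetry operator of $\mathcal E$ near a point $z_0=(t_0,x_0,p_0)\in\mathbb R^{2+\rho}$ of the space of $(t,x,u_{(\rho-1,x)})$ if $\check\eta$ is smooth near $z_0$, $\mathcal M$ contains a jet over $z_0$ at which $H$ is defined, and $Q_{(r)}E|_{\mathcal M}=0$ over a neighbourhood of $z_0$,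 where $Q_{(r)}=\sum_{a+b\le r}(D_t^aD_x^b\eta)\,\partial_{u_{a,b}}$ and $u_{a,b}=\partial^{a+b}u/\partial t^a\partial x^b$. A function $u$ is $Q$-invariant if it satisfies $u_\rho=\check\eta(t,x,u_{(\rho-1,x)})$. *Families.* A smooth family $u=f(t,x,\bar\varkappa)$, $\bar\varkappa=(\varkappa_1,\dots,\varkappa_\rho)$, of solutions of $\mathcal E$ has essential parameters on an open set if it cannot be written there as $g(t,x,\zeta^1(\bar\varkappa),\dots,\zeta^m(\bar\varkappa))$ with $m<\rho$ and smooth $g,\zeta$. Write $f_k=\partial^kf/\partial x^k$; a point $(t,x,\bar\varkappa)$ is regular if $\det\partial(f_0,\dots,f_{\rho-1})/\partial(\varkappa_1,\dots,\varkappa_\rho)\ne 0$ there. A $\rho$-parametric family of solutions at $z_0$ is a smooth family of solutions $f$ defined near a regular point $(t_0,x_0,\bar\varkappa^0)$ with $(f_0,\dots,f_{\rho-1})(t_0,x_0,\bar\varkappa^0)=p_0$. Two such families $(f,\bar\varkappa^0)$, $(\tilde f,\bar\varkappa'^0)$ are re-parametrization equivalent if $\tilde f(t,x,\bar\zeta(\bar\varkappa))=f(t,x,\bar\varkappa)$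 near $(t_0,x_0,\bar\varkappa^0)$ for a local diffeomorphism $\bar\zeta$ with $\bar\zeta(\bar\varkappa^0)=\bar\varkappa'^0$. **Claim.** 1. Let $f$ be a smooth $\rho$-parameter family of solutions of $\mathcal E$ on an open set $W$ of points $(t,x,\bar\varkappa)$. Its parameters are essential on every nonempty open subset of $W$ if and only if the regular points are dense in $W$. 2. For every $z_0\in\mathbb R^{2+\rho}$ there is a bijection $\Phi$ from the set of re-parametrization equivalence classes of $\rho$-parametric families of solutions of $\mathcal E$ at $z_0$ onto the set of germs at $z_0$ of canonical $\rho$th-order generalized conditional symmetry operators $(u_\rho-\check\eta(t,x,u_{(\rho-1,x)}))\partial_u$ of $\mathcal E$. It is characterized, in both directions, by the following property: the class of $f$ corresponds to the germ of $Q=(u_\rho-\check\eta)\partial_u$ if and only if $f$ is, locally, the family of all $Q$-invariant solutions of $\mathcal E$. That is, all members of $f$ with $(t,x,\bar\varkappa)$ near $(t_0,x_0,\bar\varkappa^0)$ are $Q$-invariant, and for every sufficiently small neighbourhood $W$ of $\bar\varkappa^0$ and every $(t_1,x_1,p_1)$ sufficiently close to $z_0$, each $Q$-invariant solution $u$ of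 $\mathcal E$ defined near $(t_1,x_1)$ with $u_{(\rho-1,x)}(t_1,x_1)=p_1$ coincides near $(t_1,x_1)$ with $f(\cdot,\cdot,\bar\varkappa)$ for exactly one $\bar\varkappa\in W$. Thus describing all $\rho$-parametric families of solutions up to re-parametrization and describing all canonical $\rho$th-order generalized conditional symmetry operators are equivalent problems. -/

import Mathlib

open scoped ContDiff Topology

noncomputable section

namespace EvolEq

/-! ### Jets and differential functions -/

/-- Points `(t, x, (v₀, …, v_{m-1}))`. Used for the arguments `(t, x, u_{(m-1,x)})` of functions
of `t`, `x` and the `x`-derivatives of `u` of order less than `m`, and for the arguments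
`(t, x, ϰ₁, …, ϰ_m)` of `m`-parametric families of functions of `t` and `x`. -/
abbrev Pt (m : ℕ) : Type := ℝ × ℝ × (Fin m → ℝ)

/-- Points `(t, x, (u_α)_α)` of the infinite jet space, `α = (α₀, α₁)` with `α₀` differentiations
in `t` and `α₁` differentiations in `x`. -/
abbrev Jet : Type := ℝ × ℝ × (ℕ × ℕ → ℝ)

/-- The coordinates `(t, x, u₀, …, u_{m-1})` of a jet, where `u_k = u_{(0,k)}`. -/
def Jet.xPart (m : ℕ) (j : Jet) : Pt m := (j.1, j.2.1, fun k => j.2.2 (0, (k : ℕ)))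

/-- The total derivative `D_t = ∂_t + ∑ u_{(α₀+1, α₁)} ∂_{u_α}`, as the derivative of `F` in the
direction of the vector `(1, 0, (u_{(α₀+1, α₁)})_α)`. -/
def totalDt (F : Jet → ℝ) (j : Jet) : ℝ :=
  deriv (fun s : ℝ => F (j.1 + s, j.2.1, fun α => j.2.2 α + s * j.2.2 (α.1 + 1, α.2))) 0

/-- The total derivative `D_x = ∂_x + ∑ u_{(α₀, α₁+1)} ∂_{u_α}`, as the derivative of `F` in the
direction of the vector `(0, 1, (u_{(α₀, α₁+1)})_α)`. -/
def totalDx (F : Jet → ℝ) (j : Jet) : ℝ :=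
  deriv (fun s : ℝ => F (j.1, j.2.1 + s, fun α => j.2.2 α + s * j.2.2 (α.1, α.2 + 1))) 0

/-- The partial derivative `∂F/∂u_α`. -/
def partialU (α : ℕ × ℕ) (F : Jet → ℝ) (j : Jet) : ℝ :=
  deriv (fun s : ℝ => F (j.1, j.2.1, Function.update j.2.2 α s)) (j.2.2 α)

/-- The `r`th prolongation `Q_{(r)} = ∑_{|α| ≤ r} (D_t^{α₀} D_x^{α₁} η) ∂_{u_α}` of the generalized
vector field `Q = η ∂_u`, applied to `F`. -/
def prolong (r : ℕ) (η F : Jet → ℝ) (j : Jet) : ℝ :=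
  ∑ α ∈ (Finset.range (r + 1) ×ˢ Finset.range (r + 1)).filter (fun α => α.1 + α.2 ≤ r),
    (totalDt^[α.1] (totalDx^[α.2] η)) j * partialU α F j

/-- The set `ℳ` in the jet space given by all differential consequences of `E = 0` and all
differential consequences with respect to `x` of `η = 0`. -/
def consequences (E η : Jet → ℝ) : Set Jet :=
  {j | (∀ a b : ℕ, (totalDt^[a] (totalDx^[b] E)) j = 0) ∧ ∀ k : ℕ, (totalDx^[k] η) j = 0}

/-! ### Evolution equations and canonical generalized conditional symmetries -/

/-- The differential function `E = u_t - H(t, x, u_{(r,x)})`. -/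
def evolE {r : ℕ} (H : Pt (r + 1) → ℝ) (j : Jet) : ℝ := j.2.2 (1, 0) - H (j.xPart (r + 1))

/-- The differential function `u_ρ - η(t, x, u_{(ρ-1,x)})`, the characteristic of the canonical
operator `Q = (u_ρ - η) ∂_u`. -/
def canonicalChar {ρ : ℕ} (η : Pt ρ → ℝ) (j : Jet) : ℝ := j.2.2 (0, ρ) - η (j.xPart ρ)

/-- Near `z₀`, the operator `Q = (u_ρ - η(t, x, u_{(ρ-1,x)})) ∂_u` is a generalized conditional
symmetry of the equation `u_t = H(t, x, u_{(r,x)})` with `H` defined on `D`: `η` is smooth near `z₀`,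
the set `ℳ` of differential consequences meets the fibre over `z₀` (so that `H` is defined at the
values of the derivatives that `u_ρ = η` prescribes over `z₀`), and `Q_{(r)} E = 0` on `ℳ`
over a neighbourhood of `z₀`. -/
structure IsCondSymmetryAt {r ρ : ℕ} (H : Pt (r + 1) → ℝ) (D : Set (Pt (r + 1)))
    (η : Pt ρ → ℝ) (z₀ : Pt ρ) : Prop where
  smooth : ∀ᶠ z in 𝓝 z₀, ContDiffAt ℝ ∞ η z
  admissible : ∃ j ∈ consequences (evolE H) (canonicalChar η), j.xPart ρ = z₀ ∧ j.xPart (r + 1) ∈ D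
  invariant : ∀ᶠ z in 𝓝 z₀, ∀ j ∈ consequences (evolE H) (canonicalChar η),
    j.xPart ρ = z → j.xPart (r + 1) ∈ D → prolong r (canonicalChar η) (evolE H) j = 0

/-- Germs at `z₀` of canonical `ρ`th-order generalized conditional symmetry operators
`(u_ρ - η) ∂_u`, each given by the germ of its coefficient `η`. -/
abbrev CondSymmetryGerm {r ρ : ℕ} (H : Pt (r + 1) → ℝ) (D : Set (Pt (r + 1))) (z₀ : Pt ρ) : Type :=
  {g : Filter.Germ (𝓝 z₀) ℝ // ∃ η : Pt ρ → ℝ, (η : Filter.Germ (𝓝 z₀) ℝ) = g ∧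
    IsCondSymmetryAt H D η z₀}

/-! ### Solutions and families of solutions -/

/-- `∂^k u / ∂x^k` at the point `q = (t, x)`. -/
def xDeriv (k : ℕ) (u : ℝ × ℝ → ℝ) (q : ℝ × ℝ) : ℝ := iteratedDeriv k (fun y => u (q.1, y)) q.2

/-- `(t, x, u, u_x, …, ∂^{m-1}u/∂x^{m-1})` at the point `q = (t, x)`. -/
def xJet (m : ℕ) (u : ℝ × ℝ → ℝ) (q : ℝ × ℝ) : Pt m := (q.1, q.2, fun k => xDeriv k u q)

/-- At the point `q`, the function `u` satisfies `u_t = H(t, x, u_{(r,x)})`. -/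
def SolvesAt {r : ℕ} (H : Pt (r + 1) → ℝ) (D : Set (Pt (r + 1))) (u : ℝ × ℝ → ℝ) (q : ℝ × ℝ) :
    Prop :=
  xJet (r + 1) u q ∈ D ∧ deriv (fun s => u (s, q.2)) q.1 = H (xJet (r + 1) u q)

/-- At the point `q`, the function `u` satisfies `Q[u] = 0` for `Q = (u_ρ - η) ∂_u`, that is,
`u_ρ = η(t, x, u_{(ρ-1,x)})`. -/
def InvariantAt {ρ : ℕ} (η : Pt ρ → ℝ) (u : ℝ × ℝ → ℝ) (q : ℝ × ℝ) : Prop :=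
  xDeriv ρ u q = η (xJet ρ u q)

/-- The member of the family `{f(t, x, ϰ)}` with parameter value `ϰ`. -/
def member {ρ : ℕ} (f : Pt ρ → ℝ) (ϰ : Fin ρ → ℝ) (q : ℝ × ℝ) : ℝ := f (q.1, q.2, ϰ)

/-- The matrix `∂(f₀, …, f_{ρ-1}) / ∂(ϰ₁, …, ϰ_ρ)`, where `f_k = ∂^k f / ∂x^k`. -/
def paramJacobian {ρ : ℕ} (f : Pt ρ → ℝ) (z : Pt ρ) : Matrix (Fin ρ) (Fin ρ) ℝ :=
  Matrix.of fun a b =>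
    deriv (fun s => xDeriv a (member f (Function.update z.2.2 b s)) (z.1, z.2.1)) (z.2.2 b)

/-- `f` is, on the set `W` of points `(t, x, ϰ)`, a smooth parametric family of solutions. -/
def IsSolutionFamilyOn {r ρ : ℕ} (H : Pt (r + 1) → ℝ) (D : Set (Pt (r + 1))) (f : Pt ρ → ℝ)
    (W : Set (Pt ρ)) : Prop :=
  ∀ z ∈ W, ContDiffAt ℝ ∞ f z ∧ SolvesAt H D (member f z.2.2) (z.1, z.2.1)

/-- The parameters of the family `f` are essential on `W`: on `W` the family is not of the form
`f(t, x, ϰ) = g(t, x, ζ¹(ϰ), …, ζᵐ(ϰ))` with fewer parameters and smooth `g`, `ζ`. -/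
def EssentialOn {ρ : ℕ} (f : Pt ρ → ℝ) (W : Set (Pt ρ)) : Prop :=
  ¬ ∃ m < ρ, ∃ (ζ : (Fin ρ → ℝ) → (Fin m → ℝ)) (g : Pt m → ℝ), ∀ z ∈ W,
    ContDiffAt ℝ ∞ ζ z.2.2 ∧ ContDiffAt ℝ ∞ g (z.1, z.2.1, ζ z.2.2) ∧
      f z = g (z.1, z.2.1, ζ z.2.2)

/-- A `ρ`-parametric family of solutions near a regular point: a family `f` and a
parameter value `ϰ₀` such that, with `z₀ = (t₀, x₀, p₀)`, `f` is a smooth family of solutions near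
`(t₀, x₀, ϰ₀)`, the solution with parameter `ϰ₀` has `x`-derivatives `p₀` of orders
`0, …, ρ-1` at `(t₀, x₀)`, and `det ∂(f₀, …, f_{ρ-1}) / ∂(ϰ₁, …, ϰ_ρ) ≠ 0` at `(t₀, x₀, ϰ₀)`. -/
structure SolutionFamily {r ρ : ℕ} (H : Pt (r + 1) → ℝ) (D : Set (Pt (r + 1))) (z₀ : Pt ρ) where
  f : Pt ρ → ℝ
  ϰ₀ : Fin ρ → ℝ
  isFamily : ∃ W ∈ 𝓝 ((z₀.1, z₀.2.1, ϰ₀) : Pt ρ), IsSolutionFamilyOn H D f W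
  through : xJet ρ (member f ϰ₀) (z₀.1, z₀.2.1) = z₀
  regular : (paramJacobian f (z₀.1, z₀.2.1, ϰ₀)).det ≠ 0

/-- Re-parametrization equivalence: `f(t, x, ϰ) = f'(t, x, ζ(ϰ))` near the base point for a local
diffeomorphism `ζ` of the parameter spaces. -/
def Reparam {r ρ : ℕ} {H : Pt (r + 1) → ℝ} {D : Set (Pt (r + 1))} {z₀ : Pt ρ}
    (F F' : SolutionFamily H D z₀) : Prop :=
  ∃ ζ : OpenPartialHomeomorph (Fin ρ → ℝ) (Fin ρ → ℝ), F.ϰ₀ ∈ ζ.source ∧ ζ F.ϰ₀ = F'.ϰ₀ ∧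
    ContDiffOn ℝ ∞ ζ ζ.source ∧ ContDiffOn ℝ ∞ ζ.symm ζ.target ∧
    ∀ᶠ z : Pt ρ in 𝓝 (z₀.1, z₀.2.1, F.ϰ₀), F'.f (z.1, z.2.1, ζ z.2.2) = F.f z

theorem Reparam.equivalence {r ρ : ℕ} {H : Pt (r + 1) → ℝ} {D : Set (Pt (r + 1))} {z₀ : Pt ρ} :
    Equivalence (Reparam (H := H) (D := D) (z₀ := z₀)) where
  refl F := ⟨OpenPartialHomeomorph.refl _, by simp, by simp, by simpa using contDiffOn_id,
    by simpa using contDiffOn_id, by simp⟩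
  symm := by
    rintro F F' ⟨ζ, h0, h1, h2, h3, h4⟩
    have ht : F'.ϰ₀ ∈ ζ.target := h1 ▸ ζ.map_source h0
    have hs : ζ.symm F'.ϰ₀ = F.ϰ₀ := by rw [← h1, ζ.left_inv h0]
    refine ⟨ζ.symm, ht, hs, h3, by simpa using h2, ?_⟩
    have hc : Filter.Tendsto (fun z : Pt ρ => ((z.1, z.2.1, ζ.symm z.2.2) : Pt ρ))
        (𝓝 (z₀.1, z₀.2.1, F'.ϰ₀)) (𝓝 (z₀.1, z₀.2.1, F.ϰ₀)) := by
      have : ContinuousAt (fun z : Pt ρ => ζ.symm z.2.2) (z₀.1, z₀.2.1, F'.ϰ₀) :=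
        ContinuousAt.comp' (g := ζ.symm) (ζ.symm.continuousAt ht)
          (by fun_prop)
      have h := (continuous_fst.continuousAt (x := ((z₀.1, z₀.2.1, F'.ϰ₀) : Pt ρ))).prodMk
        ((continuous_snd.fst.continuousAt).prodMk this)
      simpa [ContinuousAt, hs] using h
    have hm : ∀ᶠ z : Pt ρ in 𝓝 (z₀.1, z₀.2.1, F'.ϰ₀), z.2.2 ∈ ζ.target :=
      (continuous_snd.snd.continuousAt (x := ((z₀.1, z₀.2.1, F'.ϰ₀) : Pt ρ))).eventually_mem
        (ζ.open_target.mem_nhds ht)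
    filter_upwards [hc.eventually h4, hm] with z hz hz'
    rw [← hz]
    simp [ζ.right_inv hz']
  trans := by
    rintro F F' F'' ⟨ζ, h0, h1, h2, h3, h4⟩ ⟨ξ, k0, k1, k2, k3, k4⟩
    have hk : ζ F.ϰ₀ ∈ ξ.source := h1 ▸ k0
    refine ⟨ζ.trans ξ, by simp [h0, hk], by simp [h1, k1], ?_, ?_, ?_⟩
    · exact k2.comp (h2.mono (by intro y hy; simp at hy; exact hy.1))
        (by intro y hy; simp at hy; exact hy.2)
    · exact h3.comp (k3.mono (by intro y hy; simp at hy; exact hy.1))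
        (by intro y hy; simp at hy; exact hy.2)
    · have hc : Filter.Tendsto (fun z : Pt ρ => ((z.1, z.2.1, ζ z.2.2) : Pt ρ))
          (𝓝 (z₀.1, z₀.2.1, F.ϰ₀)) (𝓝 (z₀.1, z₀.2.1, F'.ϰ₀)) := by
        have : ContinuousAt (fun z : Pt ρ => ζ z.2.2) (z₀.1, z₀.2.1, F.ϰ₀) :=
          ContinuousAt.comp' (g := ζ) (ζ.continuousAt h0) (by fun_prop)
        have h := (continuous_fst.continuousAt (x := ((z₀.1, z₀.2.1, F.ϰ₀) : Pt ρ))).prodMk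
          ((continuous_snd.fst.continuousAt).prodMk this)
        simpa [ContinuousAt, h1] using h
      filter_upwards [hc.eventually k4, h4] with z hz hz'
      simp only [OpenPartialHomeomorph.coe_trans, Function.comp]
      rw [← hz', ← hz]

/-- The re-parametrization equivalence of families of solutions. -/
def reparamSetoid {r ρ : ℕ} (H : Pt (r + 1) → ℝ) (D : Set (Pt (r + 1))) (z₀ : Pt ρ) :
    Setoid (SolutionFamily H D z₀) :=
  ⟨Reparam, Reparam.equivalence⟩

/-- Near the base point, `F` is the family of solutions which are invariant with respect to
`Q = (u_ρ - η) ∂_u`: all its members are `Q`-invariant, and each `Q`-invariant solution `u` defined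
near a point `(t, x)` close to `(t₀, x₀)`, with derivatives of orders `0, …, ρ-1` at `(t, x)` close
to `p₀`, coincides near `(t, x)` with the member of `F` for exactly one parameter value
close to `ϰ₀`. -/
structure IsFamilyOfInvariantSolutions {r ρ : ℕ} {H : Pt (r + 1) → ℝ} {D : Set (Pt (r + 1))}
    {z₀ : Pt ρ} (η : Pt ρ → ℝ) (F : SolutionFamily H D z₀) : Prop where
  invariant : ∀ᶠ z : Pt ρ in 𝓝 (z₀.1, z₀.2.1, F.ϰ₀),
    InvariantAt η (member F.f z.2.2) (z.1, z.2.1)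
  complete : ∃ W₀ ∈ 𝓝 F.ϰ₀, ∀ W ∈ 𝓝 F.ϰ₀, W ⊆ W₀ → ∀ᶠ z : Pt ρ in 𝓝 z₀, ∀ u : ℝ × ℝ → ℝ,
    xJet ρ u (z.1, z.2.1) = z →
    (∀ᶠ q in 𝓝 (z.1, z.2.1), ContDiffAt ℝ ∞ u q ∧ SolvesAt H D u q ∧ InvariantAt η u q) →
    ∃! ϰ : Fin ρ → ℝ, ϰ ∈ W ∧ u =ᶠ[𝓝 (z.1, z.2.1)] member F.f ϰ

end EvolEq

end

/-!
# Parametric families of solutions and generalized conditional symmetries of evolution equations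

The condition `u_ρ = η(t, x, u_{(ρ-1,x)})` expresses all `x`-derivatives of `u` by the coordinates
`(t, x, u₀, …, u_{ρ-1})`, and the equation `u_t = H` then expresses the mixed derivatives. The total
derivatives `D_x` and `D_t` thus restrict to two vector fields `xField η` and `tField H η` on the
space `Pt ρ` of these coordinates. Everything rests on two observations.

* On the set of differential consequences, `Q_{(r)} E` reduces to the single term `D_t (u_ρ - η)`,
  which is the difference of the two expressions for `∂_t ∂_x^ρ u` obtained from `u_t = H` and from
  `u_ρ = η`. So `Q` is a conditional symmetry if and only if these expressions agree
  (`isCondSymmetryAt_iff`), which says that the two restricted vector fields commute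
  (`fderiv_xField_tField`).
* A function `u` is an invariant solution if and only if its jet `(t, x, u₀, …, u_{ρ-1})` is an
  integral surface of the two vector fields.

Commuting fields have, by Frobenius' theorem, a smooth family of integral surfaces parametrized by
the initial point (`exists_integral_surfaces`, by composing the flows of the two fields). This
turns a conditional symmetry into a `ρ`-parametric family of solutions
(`exists_solutionFamily`). Smoothness of flows in the initial value (`exists_smooth_flow`) comes
from the inverse function theorem in the Banach space of continuous curves.

Conversely, near a regular point `(t, x, f₀, …, f_{ρ-1})` are local coordinates on the space of
`(t, x, ϰ)`, and `f_ρ` expressed in them is the unique germ `η` for which the members of the family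
are invariant (`SolutionFamily.eta`, `SolutionFamily.invariant_iff`). Cross-differentiation along
the members gives the compatibility condition (`SolutionFamily.isCondSymmetryAt_eta`). Integral
surfaces through a given point are unique by a Grönwall argument (`eventually_member_eq`). Hence the
family contains all invariant solutions near the base point, and `η` determines the family up to
re-parametrization (`SolutionFamily.reparam_iff`).

The same uniqueness statement governs essential parameters. If there are no regular points in an
open set, let `s < ρ` be the maximal number such that the parameter derivatives of
`f₀, …, f_{s-1}` are linearly independent at some point `z₁` of the set. Near `z₁`, the derivative
`f_s` is a smooth function of `t, x, f₀, …, f_{s-1}` (`exists_functional_dependence`), so that the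
members are invariant solutions for an operator of order `s`. They are determined by the `s` values
of `f₀, …, f_{s-1}` at one point `(t₁, x₁)`, and these values are parameters that can replace `ϰ`
(`exists_not_essentialOn_of_dependence`). In the other direction, a family that factors through
fewer parameters has a singular Jacobian everywhere (`essentialOn_of_regular`).
-/

noncomputable section

namespace EvolEq

/-! ### The inverse function theorem for `C^∞` maps -/

section LocalDiffeo

variable {E F : Type*} [NormedAddCommGroup E] [NormedSpace ℝ E] [CompleteSpace E]
  [NormedAddCommGroup F] [NormedSpace ℝ F]

/-- The inverse function theorem for maps smooth near a point, with an inverse which is smooth on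
an open set and not only at the image of the base point. The distinction matters since
`ContDiffAt ℝ ∞` at a point does not propagate to a neighbourhood. -/
theorem exists_smooth_localDiffeo {f : E → F} {a : E} (f' : E ≃L[ℝ] F)
    (hf : ∀ᶠ z in 𝓝 a, ContDiffAt ℝ ∞ f z) (hf' : HasFDerivAt f (f' : E →L[ℝ] F) a) :
    ∃ e : OpenPartialHomeomorph E F, a ∈ e.source ∧ ⇑e = f ∧
      (∀ z ∈ e.source, ContDiffAt ℝ ∞ f z) ∧ ∀ w ∈ e.target, ContDiffAt ℝ ∞ e.symm w := by
  have ha : ContDiffAt ℝ ∞ f a := hf.self_of_nhds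
  set e₀ := ha.toOpenPartialHomeomorph f hf' (by simp) with he₀
  have hinv : ∀ᶠ z in 𝓝 a, fderiv ℝ f z ∈ Set.range ((↑) : (E ≃L[ℝ] F) → E →L[ℝ] F) := by
    have hc : ContinuousAt (fderiv ℝ f) a := (ha.fderiv_right (m := 0) (by simp)).continuousAt
    apply hc.eventually_mem
    rw [hf'.fderiv]
    exact ContinuousLinearEquiv.nhds f'
  obtain ⟨s, hs, hso, has⟩ := eventually_nhds_iff.1 (hf.and hinv)
  refine ⟨e₀.restrOpen s hso, ?_, rfl, ?_, ?_⟩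
  · simp only [OpenPartialHomeomorph.restrOpen_source]
    exact ⟨ha.mem_toOpenPartialHomeomorph_source hf' (by simp), has⟩
  · intro z hz
    simp only [OpenPartialHomeomorph.restrOpen_source] at hz
    exact (hs z hz.2).1
  · intro w hw
    have hz := (e₀.restrOpen s hso).map_target hw
    simp only [OpenPartialHomeomorph.restrOpen_source] at hz
    obtain ⟨g, hg⟩ := (hs _ hz.2).2
    refine (e₀.restrOpen s hso).contDiffAt_symm (f₀' := g) hw ?_ (hs _ hz.2).1
    rw [hg]
    exact ((hs _ hz.2).1.differentiableAt (by simp)).hasFDerivAt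

end LocalDiffeo

/-! ### Smooth dependence of local flows on initial values -/

section Nemytskii

variable {K : Type} [TopologicalSpace K] [CompactSpace K]
variable {E : Type} [NormedAddCommGroup E] [NormedSpace ℝ E]

/-- Pointwise application `C(K, E →L F) × C(K, E) → C(K, F)` as a bounded bilinear map. -/
def pointwiseApply (K : Type) [TopologicalSpace K] [CompactSpace K]
    (E F : Type) [NormedAddCommGroup E] [NormedSpace ℝ E] [NormedAddCommGroup F]
    [NormedSpace ℝ F] : C(K, E →L[ℝ] F) →L[ℝ] C(K, E) →L[ℝ] C(K, F) :=
  LinearMap.mkContinuous₂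
    (LinearMap.mk₂ ℝ (fun (A : C(K, E →L[ℝ] F)) (h : C(K, E)) =>
        (⟨fun τ => A τ (h τ), by fun_prop⟩ : C(K, F)))
      (fun _ _ _ => by ext; simp) (fun _ _ _ => by ext; simp)
      (fun _ _ _ => by ext; simp) (fun _ _ _ => by ext; simp)) 1 (by
    intro A h
    rw [ContinuousMap.norm_le _ (by positivity)]
    intro τ
    simp only [LinearMap.mk₂_apply, ContinuousMap.coe_mk, one_mul]
    exact ((A τ).le_opNorm _).trans
      (mul_le_mul (A.norm_coe_le_norm τ) (h.norm_coe_le_norm τ) (norm_nonneg _)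
        ((norm_nonneg _).trans (A.norm_coe_le_norm τ))))

theorem pointwiseApply_apply {F : Type} [NormedAddCommGroup F] [NormedSpace ℝ F]
    (A : C(K, E →L[ℝ] F)) (h : C(K, E)) (τ : K) : pointwiseApply K E F A h τ = A τ (h τ) := rfl

/-- The derivative of the superposition operator `y ↦ V ∘ y` at `y` is `h ↦ (V' ∘ y) h`. -/
theorem hasFDerivAt_postcomp {F : Type} [NormedAddCommGroup F] [NormedSpace ℝ F]
    (V : C(E, F)) (V' : C(E, E →L[ℝ] F)) (hV : ∀ x, HasFDerivAt V (V' x) x) (y : C(K, E)) :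
    HasFDerivAt (fun y : C(K, E) => V.comp y) (pointwiseApply K E F (V'.comp y)) y := by
  rw [hasFDerivAt_iff_isLittleO_nhds_zero, Asymptotics.isLittleO_iff]
  intro ε hε
  -- `V' ∘ y` depends continuously on `y`, and the mean value theorem applies pointwise.
  have hc : ContinuousAt (fun y : C(K, E) => V'.comp y) y :=
    (ContinuousMap.continuous_postcomp V').continuousAt
  obtain ⟨δ, hδ, hball⟩ := (Metric.continuousAt_iff (α := C(K, E)) (β := C(K, E →L[ℝ] F))).1 hc ε hε
  filter_upwards [Metric.ball_mem_nhds (0 : C(K, E)) hδ] with h hh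
  rw [ContinuousMap.norm_le _ (by positivity)]
  intro τ
  have hseg : ∀ x ∈ segment ℝ (y τ) (y τ + h τ), ‖V' x - V' (y τ)‖ ≤ ε := by
    intro x hx
    rw [segment_eq_image'] at hx
    obtain ⟨σ, hσ, rfl⟩ := hx
    have hd : dist (y + σ • h) y < δ := by
      rw [dist_eq_norm, add_sub_cancel_left, norm_smul, Real.norm_of_nonneg hσ.1]
      have := mem_ball_zero_iff.1 hh
      nlinarith [hσ.2, norm_nonneg h]
    have h1 := hball hd
    have h2 := (ContinuousMap.dist_apply_le_dist τ).trans h1.le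
    rw [dist_eq_norm] at h2
    simpa using h2
  have := (convex_segment (𝕜 := ℝ) (y τ) (y τ + h τ)).norm_image_sub_le_of_norm_fderiv_le'
    (f := V) (φ := V' (y τ)) (C := ε) (x := y τ) (y := y τ + h τ)
    (fun x _ => (hV x).differentiableAt)
    (fun x hx => by rw [(hV x).fderiv]; exact hseg x hx)
    (left_mem_segment ℝ _ _) (right_mem_segment ℝ _ _)
  simp only [add_sub_cancel_left] at this
  calc ‖(V.comp (y + h) - V.comp y - pointwiseApply K E F (V'.comp y) h) τ‖
      = ‖V (y τ + h τ) - V (y τ) - V' (y τ) (h τ)‖ := by simp [pointwiseApply_apply]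
    _ ≤ ε * ‖h τ‖ := this
    _ ≤ ε * ‖h‖ := by gcongr; exact h.norm_coe_le_norm τ

/-- The superposition operator `y ↦ V ∘ y` on continuous functions is smooth if `V` is: its
derivative is again built from a superposition operator. -/
theorem contDiff_postcomp_nat (n : ℕ) : ∀ {F : Type} [NormedAddCommGroup F] [NormedSpace ℝ F]
    (V : C(E, F)), ContDiff ℝ ∞ V → ContDiff ℝ n (fun y : C(K, E) => V.comp y) := by
  induction n with
  | zero =>
    intro F _ _ V hV
    exact contDiff_zero.2 (ContinuousMap.continuous_postcomp V)
  | succ n ih =>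
    intro F _ _ V hV
    have hV' : ContDiff ℝ ∞ (fderiv ℝ V) := (contDiff_infty_iff_fderiv.1 hV).2
    let V' : C(E, E →L[ℝ] F) := ⟨fderiv ℝ V, hV'.continuous⟩
    have hd : ∀ y : C(K, E),
        HasFDerivAt (fun y : C(K, E) => V.comp y) (pointwiseApply K E F (V'.comp y)) y :=
      hasFDerivAt_postcomp V V' (fun x => (hV.differentiable (by simp) x).hasFDerivAt)
    have : fderiv ℝ (fun y : C(K, E) => V.comp y) =
        fun y => pointwiseApply K E F (V'.comp y) := funext fun y => (hd y).fderiv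
    rw [Nat.cast_add, Nat.cast_one, contDiff_succ_iff_fderiv, this]
    refine ⟨fun y => (hd y).differentiableAt, by simp, ?_⟩
    exact (pointwiseApply K E F).contDiff.comp (ih V' hV')

theorem contDiff_postcomp (V : C(E, E)) (hV : ContDiff ℝ ∞ V) :
    ContDiff ℝ ∞ (fun y : C(K, E) => V.comp y) :=
  contDiff_infty.2 fun n => contDiff_postcomp_nat n V hV

end Nemytskii

section Flow

variable {E : Type} [NormedAddCommGroup E] [NormedSpace ℝ E]

/-- The primitive `τ ↦ ∫ σ in 0..τ, y σ` of a continuous function on `[0, 1]`, as a bounded linear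
operator. -/
def primitive (E : Type) [NormedAddCommGroup E] [NormedSpace ℝ E] :
    C(unitInterval, E) →L[ℝ] C(unitInterval, E) :=
  LinearMap.mkContinuous
    { toFun := fun y => ⟨fun τ => ∫ σ in (0 : ℝ)..τ, y (Set.projIcc 0 1 zero_le_one σ), by
        have hc : Continuous fun σ : ℝ => y (Set.projIcc 0 1 zero_le_one σ) :=
          y.continuous.comp continuous_projIcc
        exact (intervalIntegral.continuous_primitive
          (fun a b => hc.intervalIntegrable a b) 0).comp continuous_subtype_val⟩
      map_add' := fun y z => by
        ext τ
        have hc (y : C(unitInterval, E)) :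
          Continuous fun σ : ℝ => y (Set.projIcc 0 1 zero_le_one σ) :=
          y.continuous.comp continuous_projIcc
        simpa using intervalIntegral.integral_add ((hc y).intervalIntegrable _ _)
          ((hc z).intervalIntegrable _ _)
      map_smul' := fun r y => by
        ext τ
        simp } 1 (by
    intro y
    rw [ContinuousMap.norm_le _ (by positivity)]
    intro τ
    simp only [LinearMap.coe_mk, AddHom.coe_mk, ContinuousMap.coe_mk, one_mul]
    refine (intervalIntegral.norm_integral_le_of_norm_le_const
      (C := ‖y‖) (fun σ _ => y.norm_coe_le_norm _)).trans ?_
    rw [sub_zero, abs_of_nonneg τ.2.1]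
    exact mul_le_of_le_one_right (norm_nonneg _) τ.2.2)

/-- Local flows of globally smooth vector fields are smooth. After rescaling time to `[0, 1]`, the
integral curve of `V` starting at `z` solves `y - z - s ∫ V(y) = 0` in the Banach space of
continuous curves. At `s = 0` the derivative of the left-hand side with respect to `y` is the
identity, so that the solution depends smoothly on `(s, z)`; by local uniqueness it is the curve
given by the Picard-Lindelöf theorem. -/
theorem exists_smooth_flow_of_contDiff [CompleteSpace E] {V : E → E} (hV : ContDiff ℝ ∞ V)
    (z₀ : E) : ∃ φ : ℝ × E → E, (∀ᶠ p in 𝓝 ((0, z₀) : ℝ × E), ContDiffAt ℝ ∞ φ p) ∧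
      (∀ᶠ z in 𝓝 z₀, φ (0, z) = z) ∧
      ∀ᶠ p in 𝓝 ((0, z₀) : ℝ × E), HasDerivAt (fun s => φ (s, p.2)) (V (φ p)) p.1 := by
  let I := unitInterval
  let V₁ : C(E, E) := ⟨V, hV.continuous⟩
  let const : E →L[ℝ] C(I, E) := ContinuousLinearMap.const ℝ I
  let eq : (ℝ × E) × C(I, E) → C(I, E) := fun p =>
    p.2 - const p.1.2 - p.1.1 • primitive E (V₁.comp p.2)
  have heq : ContDiff ℝ ∞ eq := by
    have h1 : ContDiff ℝ ∞ fun p : (ℝ × E) × C(I, E) => primitive E (V₁.comp p.2) :=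
      (primitive E).contDiff.comp ((contDiff_postcomp V₁ hV).comp contDiff_snd)
    have h2 : ContDiff ℝ ∞ fun p : (ℝ × E) × C(I, E) => const p.1.2 :=
      const.contDiff.comp (contDiff_snd.comp contDiff_fst)
    exact (contDiff_snd.sub h2).sub ((contDiff_fst.comp contDiff_fst).smul h1)
  let Ψ : (ℝ × E) × C(I, E) → (ℝ × E) × C(I, E) := fun p => (p.1, eq p)
  have hΨ : ContDiff ℝ ∞ Ψ := contDiff_fst.prodMk heq
  let p₀ : (ℝ × E) × C(I, E) := ((0, z₀), const z₀)
  let L : ℝ × E →L[ℝ] C(I, E) := const.comp (ContinuousLinearMap.snd ℝ ℝ E) +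
    (ContinuousLinearMap.fst ℝ ℝ E).smulRight (primitive E (V₁.comp (const z₀)))
  let Ψ' : ((ℝ × E) × C(I, E)) ≃L[ℝ] ((ℝ × E) × C(I, E)) :=
    ContinuousLinearEquiv.equivOfInverse
      ((ContinuousLinearMap.fst ℝ _ _).prod
        (ContinuousLinearMap.snd ℝ _ _ - L.comp (ContinuousLinearMap.fst ℝ _ _)))
      ((ContinuousLinearMap.fst ℝ _ _).prod
        (ContinuousLinearMap.snd ℝ _ _ + L.comp (ContinuousLinearMap.fst ℝ _ _)))
      (fun p => by simp) (fun p => by simp)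
  have hΨ' : HasFDerivAt Ψ (Ψ' : _ →L[ℝ] _) p₀ := by
    have h1 : HasFDerivAt (fun p : (ℝ × E) × C(I, E) => primitive E (V₁.comp p.2))
        (fderiv ℝ (fun p : (ℝ × E) × C(I, E) => primitive E (V₁.comp p.2)) p₀) p₀ :=
      (((primitive E).contDiff.comp ((contDiff_postcomp V₁ hV).comp
        contDiff_snd)).differentiable (by simp) p₀).hasFDerivAt
    have h2 : HasFDerivAt (fun p : (ℝ × E) × C(I, E) => p.1.1)
        ((ContinuousLinearMap.fst ℝ ℝ E).comp (ContinuousLinearMap.fst ℝ _ _)) p₀ :=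
      ((ContinuousLinearMap.fst ℝ ℝ E).comp
        (ContinuousLinearMap.fst ℝ (ℝ × E) C(I, E))).hasFDerivAt
    have h3 : HasFDerivAt (fun p : (ℝ × E) × C(I, E) => const p.1.2)
        (const.comp ((ContinuousLinearMap.snd ℝ ℝ E).comp (ContinuousLinearMap.fst ℝ _ _))) p₀ :=
      (const.comp ((ContinuousLinearMap.snd ℝ ℝ E).comp
        (ContinuousLinearMap.fst ℝ (ℝ × E) C(I, E)))).hasFDerivAt
    have h4 := (hasFDerivAt_fst (𝕜 := ℝ) (p := p₀)).prodMk
      ((hasFDerivAt_snd.sub h3).sub (h2.smul h1))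
    refine h4.congr_fderiv ?_
    ext1
    · ext p <;> simp [Ψ', L, p₀, sub_sub]
    · ext p <;> simp [Ψ', L, p₀]
  obtain ⟨e, he, heΨ, -, hes⟩ := exists_smooth_localDiffeo Ψ'
    (Filter.Eventually.of_forall fun p => hΨ.contDiffAt) hΨ'
  have hΨ₀ : Ψ p₀ = ((0, z₀), 0) := by simp [Ψ, eq, p₀]
  let φ : ℝ × E → E := fun p => ContinuousMap.evalCLM ℝ (1 : I) (e.symm (p, 0)).2
  obtain ⟨ε, hε, a, r, _, _, hr, hpl⟩ :=
    IsPicardLindelof.of_contDiffAt_one (hV.of_le (by simp) : ContDiff ℝ 1 V).contDiffAt (x₀ := z₀)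
  obtain ⟨α, hα, hαc⟩ := (hpl 0).exists_forall_mem_closedBall_eq_hasDerivWithinAt_continuousOn
  simp only [zero_sub, zero_add] at hα hαc
  have hr' : (0 : ℝ) < r := hr
  have hαd : ∀ z ∈ Metric.closedBall z₀ (r : ℝ), ∀ s ∈ Set.Ioo (-ε) ε,
      HasDerivAt (fun s => α (z, s)) (V (α (z, s))) s := fun z hz s hs =>
    ((hα z hz).2 s ⟨hs.1.le, hs.2.le⟩).hasDerivAt (Icc_mem_nhds hs.1 hs.2)
  have key : ∀ᶠ p in 𝓝 ((0, z₀) : ℝ × E), φ p = α (p.2, p.1) := by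
    obtain ⟨δ, hδ, hball⟩ := Metric.isOpen_iff.1 e.open_source p₀ he
    have hα₀ : ContinuousAt α (z₀, 0) := hαc.continuousAt
      (prod_mem_nhds (Metric.closedBall_mem_nhds _ hr') (Icc_mem_nhds (by linarith) hε))
    obtain ⟨δ', hδ', hb'⟩ := Metric.continuousAt_iff.1 hα₀ (δ / 2) (by positivity)
    rw [(hα z₀ (Metric.mem_closedBall_self hr'.le)).1] at hb'
    filter_upwards [Metric.ball_mem_nhds ((0, z₀) : ℝ × E)
      (show 0 < min (min ε r) (min δ δ') by positivity)] with p hp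
    obtain ⟨s, z⟩ := p
    simp only [Metric.mem_ball, Prod.dist_eq, max_lt_iff, lt_min_iff, dist_zero_right,
      Real.norm_eq_abs] at hp
    obtain ⟨⟨⟨hs1, -⟩, -, hz1⟩, ⟨hs2, hz2⟩, hs3, hz3⟩ := hp
    have hz : z ∈ Metric.closedBall z₀ (r : ℝ) := hz1.le
    have hsτ : ∀ τ ∈ Set.Icc (0 : ℝ) 1, |s * τ| ≤ |s| := fun τ hτ => by
      rw [abs_mul, abs_of_nonneg hτ.1]
      exact mul_le_of_le_one_right (abs_nonneg _) hτ.2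
    have hcd : ∀ τ ∈ Set.Icc (0 : ℝ) 1, HasDerivAt (fun τ => α (z, s * τ))
        (s • V (α (z, s * τ))) τ := fun τ hτ => by
      have h1 := hαd z hz (s * τ) (abs_lt.1 ((hsτ τ hτ).trans_lt hs1))
      have h2 : HasDerivAt (fun τ => s * τ) s τ := by simpa using (hasDerivAt_id τ).const_mul s
      exact h1.scomp τ h2
    have hcc : ContinuousOn (fun τ => α (z, s * τ)) (Set.Icc 0 1) := fun τ hτ =>
      (hcd τ hτ).continuousAt.continuousWithinAt
    -- The rescaled integral curve `c` is close to the constant curve, hence lies in the domain of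
    -- the chart `e`, where the solution of the equation is unique.
    let c : C(I, E) := ⟨fun τ => α (z, s * τ), continuousOn_iff_continuous_domRestrict.1 hcc⟩
    have hcs : ((s, z), c) ∈ e.source := by
      apply hball
      have hcn : dist c (const z₀) ≤ δ / 2 := by
        rw [ContinuousMap.dist_le (by positivity)]
        intro τ
        refine (hb' (x := (z, s * (τ : ℝ))) ?_).le
        rw [Prod.dist_eq]
        refine max_lt hz3 ?_
        rw [dist_zero_right, Real.norm_eq_abs]
        exact (hsτ τ τ.2).trans_lt hs3
      simp only [Metric.mem_ball, Prod.dist_eq, p₀, max_lt_iff, dist_zero_right, Real.norm_eq_abs]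
      exact ⟨⟨hs2, hz2⟩, hcn.trans_lt (by linarith)⟩
    have hc0 : Ψ ((s, z), c) = ((s, z), 0) := by
      simp only [Ψ, Prod.mk.injEq, true_and]
      ext τ
      have hsub : Set.uIcc 0 (τ : ℝ) ⊆ Set.Icc 0 1 := by
        rw [Set.uIcc_of_le τ.2.1]
        exact Set.Icc_subset_Icc_right τ.2.2
      have hint := intervalIntegral.integral_eq_sub_of_hasDerivAt
        (fun σ hσ => hcd σ (hsub hσ))
        (((hV.continuous.comp_continuousOn (hcc.mono hsub)).const_smul s).intervalIntegrable)
      have hcg : (∫ σ in (0 : ℝ)..τ, V (c (Set.projIcc 0 1 zero_le_one σ))) =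
          ∫ σ in (0 : ℝ)..τ, V (α (z, s * σ)) := by
        refine intervalIntegral.integral_congr fun σ hσ => ?_
        simp only [Set.projIcc_of_mem _ (hsub hσ)]
        rfl
      have hc' : eq ((s, z), c) τ =
          c τ - z - s • ∫ σ in (0 : ℝ)..τ, V (c (Set.projIcc 0 1 zero_le_one σ)) := rfl
      rw [hc', hcg, ← intervalIntegral.integral_smul, hint]
      have hcτ : c τ = α (z, s * τ) := rfl
      simp [hcτ, (hα z hz).1]
    have hsym : e.symm ((s, z), 0) = ((s, z), c) := by
      rw [← hc0, ← heΨ]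
      exact e.left_inv hcs
    have hc1 : c 1 = α (z, s * 1) := rfl
    simp [φ, hsym, hc1]
  have hcont : Continuous fun p : ℝ × E => (p, (0 : C(I, E))) := by fun_prop
  refine ⟨φ, ?_, ?_, ?_⟩
  · have ht : ((0, z₀), 0) ∈ e.target := by rw [← hΨ₀, ← heΨ]; exact e.map_source he
    filter_upwards [hcont.continuousAt.eventually_mem (e.open_target.mem_nhds ht)] with p hp
    exact (ContinuousMap.evalCLM ℝ (1 : I)).contDiff.contDiffAt.comp p
      (contDiffAt_snd.comp p
        ((hes _ hp).comp p (contDiffAt_id.prodMk contDiffAt_const)))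
  · have h0 : Filter.Tendsto (fun z : E => ((0 : ℝ), z)) (𝓝 z₀) (𝓝 (0, z₀)) :=
      (Continuous.prodMk_right 0).continuousAt
    filter_upwards [h0.eventually key, Metric.closedBall_mem_nhds z₀ hr'] with z hz hz'
    rw [hz, (hα z hz').1]
  · have hm : ∀ᶠ p in 𝓝 ((0, z₀) : ℝ × E),
        p ∈ Set.Ioo (-ε) ε ×ˢ Metric.closedBall z₀ (r : ℝ) :=
      prod_mem_nhds (Ioo_mem_nhds (by linarith) hε) (Metric.closedBall_mem_nhds _ hr')
    filter_upwards [key.eventually_nhds, hm] with p hp hp'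
    rw [hp.self_of_nhds]
    refine (hαd p.2 hp'.2 p.1 hp'.1).congr_of_eventuallyEq ?_
    have h0 : Filter.Tendsto (fun s : ℝ => (s, p.2)) (𝓝 p.1) (𝓝 p) :=
      (Continuous.prodMk_left p.2).continuousAt
    exact h0.eventually hp

/-- Local flows of smooth vector fields are smooth. -/
theorem exists_smooth_flow [FiniteDimensional ℝ E] {V : E → E} {z₀ : E}
    (hV : ∀ᶠ z in 𝓝 z₀, ContDiffAt ℝ ∞ V z) :
    ∃ φ : ℝ × E → E, (∀ᶠ p in 𝓝 ((0, z₀) : ℝ × E), ContDiffAt ℝ ∞ φ p) ∧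
      (∀ᶠ z in 𝓝 z₀, φ (0, z) = z) ∧
      ∀ᶠ p in 𝓝 ((0, z₀) : ℝ × E), HasDerivAt (fun s => φ (s, p.2)) (V (φ p)) p.1 := by
  have : CompleteSpace E := FiniteDimensional.complete ℝ E
  obtain ⟨R, hR, hball⟩ := Metric.eventually_nhds_iff_ball.1 hV
  -- A cut-off makes `V` globally smooth without changing it near `z₀`.
  let χ : ContDiffBump z₀ := ⟨R / 3, R / 2, by positivity, by linarith⟩
  have hχV : ContDiff ℝ ∞ fun z => χ z • V z := by
    rw [contDiff_iff_contDiffAt]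
    intro z
    by_cases hz : z ∈ Metric.ball z₀ R
    · exact χ.contDiffAt.smul (hball z hz)
    · have h0 : (fun z => χ z • V z) =ᶠ[𝓝 z] fun _ => 0 := by
        have : z ∈ (tsupport χ)ᶜ := by
          rw [χ.tsupport_eq]
          intro h
          apply hz
          have : dist z z₀ ≤ R / 2 := h
          rw [Metric.mem_ball]
          linarith
        filter_upwards [(isClosed_tsupport χ).isOpen_compl.mem_nhds this] with w hw
        rw [image_eq_zero_of_notMem_tsupport hw, zero_smul]
      exact contDiffAt_const.congr_of_eventuallyEq h0
  obtain ⟨φ, h1, h2, h3⟩ := exists_smooth_flow_of_contDiff hχV z₀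
  refine ⟨φ, h1, h2, ?_⟩
  have hφ : ContinuousAt φ (0, z₀) := h1.self_of_nhds.continuousAt
  have hφ0 : φ (0, z₀) = z₀ := h2.self_of_nhds
  have hχ1 : ∀ᶠ p in 𝓝 ((0, z₀) : ℝ × E), χ (φ p) = 1 := by
    have hφt : Filter.Tendsto φ (𝓝 (0, z₀)) (𝓝 z₀) := by
      simpa only [ContinuousAt, hφ0] using hφ
    exact hφt.eventually χ.eventuallyEq_one
  filter_upwards [h3, hχ1] with p hp hp'
  simpa [hp'] using hp

end Flow

/-! ### Integral surfaces of pairs of commuting vector fields -/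

section Frobenius

variable {E₁ E F : Type*} [NormedAddCommGroup E₁] [NormedSpace ℝ E₁]
  [NormedAddCommGroup E] [NormedSpace ℝ E] [NormedAddCommGroup F] [NormedSpace ℝ F]

theorem contDiffAt_fderiv_apply {f : E → F} {p : E} (hf : ContDiffAt ℝ ∞ f p) (v : E) :
    ContDiffAt ℝ ∞ (fun p => fderiv ℝ f p v) p :=
  (hf.fderiv_right (m := ∞) (by simp)).clm_apply contDiffAt_const

theorem eventually_differentiableAt {f : E → F} {p : E} (hf : ContDiffAt ℝ ∞ f p) :
    ∀ᶠ p' in 𝓝 p, DifferentiableAt ℝ f p' :=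
  ((hf.of_le (m := 1) (mod_cast le_top)).eventually (by decide)).mono
    fun _ h => h.differentiableAt (by simp)

theorem fderiv_fderiv_comm {f : E → F} {p : E} (hf : ContDiffAt ℝ ∞ f p) (v w : E) :
    fderiv ℝ (fun p => fderiv ℝ f p v) p w = fderiv ℝ (fun p => fderiv ℝ f p w) p v := by
  have hd : DifferentiableAt ℝ (fderiv ℝ f) p :=
    (hf.fderiv_right (m := ∞) (by simp)).differentiableAt (by simp)
  have h (v : E) : fderiv ℝ (fun p => fderiv ℝ f p v) p =
      (ContinuousLinearMap.apply ℝ F v).comp (fderiv ℝ (fderiv ℝ f) p) :=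
    ((ContinuousLinearMap.apply ℝ F v).hasFDerivAt.comp p hd.hasFDerivAt).fderiv
  have hsymm : IsSymmSndFDerivAt ℝ f p := hf.isSymmSndFDerivAt (by
    rw [minSmoothness_of_isRCLikeNormedField]
    exact WithTop.coe_le_coe.2 (le_top : (2 : ℕ∞) ≤ ⊤))
  simpa [h] using hsymm.eq w v

/-- A multi-dimensional Grönwall argument: integrate along segments from `q₀`. -/
theorem eq_zero_of_norm_fderiv_le {s : Set E₁} (hs : Convex ℝ s) {g : E₁ → E}
    {g' : E₁ → E₁ →L[ℝ] E} (hg : ∀ q ∈ s, HasFDerivAt g (g' q) q) {K : ℝ}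
    (hK : ∀ q ∈ s, ∀ v, ‖g' q v‖ ≤ K * ‖v‖ * ‖g q‖) {q₀ : E₁} (hq₀ : q₀ ∈ s) (h0 : g q₀ = 0) :
    ∀ q ∈ s, g q = 0 := by
  intro q hq
  have hmem : ∀ τ ∈ Set.Icc (0 : ℝ) 1, q₀ + τ • (q - q₀) ∈ s := fun τ hτ =>
    hs.add_smul_sub_mem hq₀ hq hτ
  have hd : ∀ τ ∈ Set.Icc (0 : ℝ) 1, HasDerivAt (fun τ : ℝ => g (q₀ + τ • (q - q₀)))
      (g' (q₀ + τ • (q - q₀)) (q - q₀)) τ := fun τ hτ => by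
    have h1 : HasDerivAt (fun τ : ℝ => q₀ + τ • (q - q₀)) (q - q₀) τ := by
      simpa using ((hasDerivAt_id τ).smul_const (q - q₀)).const_add q₀
    exact (hg _ (hmem τ hτ)).comp_hasDerivAt τ h1
  have := eq_zero_of_abs_deriv_le_mul_abs_self_of_eq_zero_right
    (f := fun τ : ℝ => g (q₀ + τ • (q - q₀))) (K := K * ‖q - q₀‖)
    (fun τ hτ => (hd τ hτ).continuousAt.continuousWithinAt)
    (fun τ hτ => (hd τ ⟨hτ.1, hτ.2.le⟩).hasDerivWithinAt) (by simpa using h0)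
    (fun τ hτ => hK _ (hmem τ ⟨hτ.1, hτ.2.le⟩) _) 1 (by simp)
  simpa using this

/-- At `q`, the map `y` of two variables satisfies `∂y/∂q₁ = T(y)` and `∂y/∂q₂ = X(y)`. -/
def IsIntegralSurfaceAt (T X : E → E) (y : ℝ × ℝ → E) (q : ℝ × ℝ) : Prop :=
  HasFDerivAt y ((ContinuousLinearMap.fst ℝ ℝ ℝ).smulRight (T (y q)) +
    (ContinuousLinearMap.snd ℝ ℝ ℝ).smulRight (X (y q))) q

theorem eqOn_of_isIntegralSurfaceAt {T X : E → E} {U : Set E} {K : NNReal}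
    (hT : LipschitzOnWith K T U) (hX : LipschitzOnWith K X U) {s : Set (ℝ × ℝ)}
    (hs : Convex ℝ s) {y y' : ℝ × ℝ → E}
    (hy : ∀ q ∈ s, IsIntegralSurfaceAt T X y q ∧ y q ∈ U)
    (hy' : ∀ q ∈ s, IsIntegralSurfaceAt T X y' q ∧ y' q ∈ U)
    {q₀ : ℝ × ℝ} (hq₀ : q₀ ∈ s) (h0 : y q₀ = y' q₀) : ∀ q ∈ s, y q = y' q := by
  intro q hq
  refine sub_eq_zero.1 (eq_zero_of_norm_fderiv_le hs (g := fun q => y q - y' q)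
    (fun q hq => (hy q hq).1.sub (hy' q hq).1) (K := 2 * K) ?_ hq₀ (sub_eq_zero.2 h0) q hq)
  intro q hq v
  have h1 := hT.norm_sub_le (hy q hq).2 (hy' q hq).2
  have h2 := hX.norm_sub_le (hy q hq).2 (hy' q hq).2
  have hv1 : ‖v.1‖ ≤ ‖v‖ := norm_fst_le v
  have hv2 : ‖v.2‖ ≤ ‖v‖ := norm_snd_le v
  have : v.1 • T (y q) + v.2 • X (y q) - (v.1 • T (y' q) + v.2 • X (y' q)) =
      v.1 • (T (y q) - T (y' q)) + v.2 • (X (y q) - X (y' q)) := by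
    simp only [smul_sub]; abel
  simp only [sub_apply, add_apply,
    ContinuousLinearMap.smulRight_apply, ContinuousLinearMap.coe_fst', ContinuousLinearMap.coe_snd']
  rw [this]
  calc _ ≤ ‖v.1‖ * ‖T (y q) - T (y' q)‖ + ‖v.2‖ * ‖X (y q) - X (y' q)‖ := by
        rw [← norm_smul, ← norm_smul]; exact norm_add_le _ _
    _ ≤ ‖v‖ * (K * ‖y q - y' q‖) + ‖v‖ * (K * ‖y q - y' q‖) := by gcongr
    _ = 2 * K * ‖v‖ * ‖y q - y' q‖ := by ring

/-- Commuting vector fields have local integral surfaces through all points, which depend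
smoothly on the initial point. The surface is obtained by following the flow of `T` and then
that of `X`; the defect `R = ∂Y/∂a - T(Y)` satisfies the linear equation
`∂R/∂b = DX(Y) R` because the fields commute, and vanishes for `b = 0`. -/
theorem exists_integral_surfaces {E : Type} [NormedAddCommGroup E] [NormedSpace ℝ E]
    [FiniteDimensional ℝ E] {T X : E → E} {z₀ : E}
    (hT : ∀ᶠ z in 𝓝 z₀, ContDiffAt ℝ ∞ T z) (hX : ∀ᶠ z in 𝓝 z₀, ContDiffAt ℝ ∞ X z)
    (hTX : ∀ᶠ z in 𝓝 z₀, fderiv ℝ X z (T z) = fderiv ℝ T z (X z)) :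
    ∃ Y : ℝ × ℝ × E → E, (∀ᶠ p in 𝓝 ((0, 0, z₀) : ℝ × ℝ × E), ContDiffAt ℝ ∞ Y p) ∧
      (∀ᶠ z in 𝓝 z₀, Y (0, 0, z) = z) ∧
      ∀ᶠ p in 𝓝 ((0, 0, z₀) : ℝ × ℝ × E),
        IsIntegralSurfaceAt T X (fun q => Y (q.1, q.2, p.2.2)) (p.1, p.2.1) := by
  obtain ⟨φ, hφ, hφ0, hφd⟩ := exists_smooth_flow hT
  obtain ⟨ψ, hψ, hψ0, hψd⟩ := exists_smooth_flow hX
  let Y : ℝ × ℝ × E → E := fun p => ψ (p.2.1, φ (p.1, p.2.2))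
  have hφz : φ (0, z₀) = z₀ := hφ0.self_of_nhds
  have hψz : ψ (0, z₀) = z₀ := hψ0.self_of_nhds
  have t1 : Filter.Tendsto (fun p : ℝ × ℝ × E => (p.1, p.2.2)) (𝓝 (0, 0, z₀)) (𝓝 (0, z₀)) :=
    (by fun_prop : Continuous fun p : ℝ × ℝ × E => (p.1, p.2.2)).continuousAt
  have t2 : Filter.Tendsto (fun p : ℝ × ℝ × E => φ (p.1, p.2.2)) (𝓝 (0, 0, z₀)) (𝓝 z₀) := by
    have : Filter.Tendsto φ (𝓝 (0, z₀)) (𝓝 z₀) := by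
      simpa only [ContinuousAt, hφz] using hφ.self_of_nhds.continuousAt
    exact this.comp t1
  have t3 : Filter.Tendsto (fun p : ℝ × ℝ × E => (p.2.1, φ (p.1, p.2.2)))
      (𝓝 (0, 0, z₀)) (𝓝 (0, z₀)) :=
    (continuous_snd.fst.continuousAt (x := ((0, 0, z₀) : ℝ × ℝ × E))).prodMk_nhds t2
  have t4 : Filter.Tendsto Y (𝓝 (0, 0, z₀)) (𝓝 z₀) := by
    have : Filter.Tendsto ψ (𝓝 (0, z₀)) (𝓝 z₀) := by
      simpa only [ContinuousAt, hψz] using hψ.self_of_nhds.continuousAt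
    exact this.comp t3
  have t5 : Filter.Tendsto (fun p : ℝ × ℝ × E => (p.1, (0 : ℝ), p.2.2)) (𝓝 (0, 0, z₀))
      (𝓝 (0, 0, z₀)) :=
    (by fun_prop : Continuous fun p : ℝ × ℝ × E => (p.1, (0 : ℝ), p.2.2)).continuousAt
  have hY : ∀ᶠ p in 𝓝 ((0, 0, z₀) : ℝ × ℝ × E), ContDiffAt ℝ ∞ Y p := by
    filter_upwards [t1.eventually hφ, t3.eventually hψ] with p h1 h2
    have h3 : ContDiffAt ℝ ∞ (fun p : ℝ × ℝ × E => φ (p.1, p.2.2)) p :=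
      h1.comp p (contDiffAt_fst.prodMk (contDiffAt_snd.snd))
    exact h2.comp p ((contDiffAt_snd.fst).prodMk h3)
  have hYb : ∀ᶠ p in 𝓝 ((0, 0, z₀) : ℝ × ℝ × E), fderiv ℝ Y p (0, 1, 0) = X (Y p) := by
    filter_upwards [hY, t3.eventually hψd] with p h1 h2
    have h3 : HasDerivAt (fun s : ℝ => (p.1, s, p.2.2)) (0, 1, 0) p.2.1 :=
      (hasDerivAt_const _ _).prodMk ((hasDerivAt_id _).prodMk (hasDerivAt_const _ _))
    have h4 := (h1.differentiableAt (by simp)).hasFDerivAt.comp_hasDerivAt p.2.1 h3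
    exact h4.unique (show HasDerivAt (Y ∘ fun s => (p.1, s, p.2.2)) (X (Y p)) p.2.1 from h2)
  have hYa0 : ∀ᶠ p in 𝓝 ((0, 0, z₀) : ℝ × ℝ × E),
      fderiv ℝ Y (p.1, 0, p.2.2) (1, 0, 0) = T (Y (p.1, 0, p.2.2)) := by
    filter_upwards [t5.eventually hY, t1.eventually hφd, (t2.eventually hψ0).eventually_nhds]
      with p h1 h2 h3
    have h4 : HasDerivAt (fun s : ℝ => (s, (0 : ℝ), p.2.2)) (1, 0, 0) p.1 :=
      (hasDerivAt_id _).prodMk ((hasDerivAt_const _ _).prodMk (hasDerivAt_const _ _))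
    have h5 := (h1.differentiableAt (by simp)).hasFDerivAt.comp_hasDerivAt p.1 h4
    have h6 : Filter.Tendsto (fun s : ℝ => (s, p.2.1, p.2.2)) (𝓝 p.1) (𝓝 p) :=
      (by fun_prop : Continuous fun s : ℝ => (s, p.2.1, p.2.2)).continuousAt
    have h7 : Y (p.1, 0, p.2.2) = φ (p.1, p.2.2) := h3.self_of_nhds
    rw [h7]
    exact h5.unique (h2.congr_of_eventuallyEq (h6.eventually h3))
  have hXK : ∀ᶠ z in 𝓝 z₀, ‖fderiv ℝ X z‖ ≤ ‖fderiv ℝ X z₀‖ + 1 := by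
    have : ContinuousAt (fun z => ‖fderiv ℝ X z‖) z₀ :=
      (hX.self_of_nhds.fderiv_right (m := 0) (by simp)).continuousAt.norm
    exact (this.eventually_lt_const (lt_add_one _)).mono fun _ h => h.le
  obtain ⟨δ, hδ, hball⟩ := Metric.eventually_nhds_iff_ball.1
    (hY.and (hYb.eventually_nhds.and (hYa0.and (t4.eventually
      (hT.and (hX.and (hTX.and hXK)))))))
  refine ⟨Y, hY, ?_, ?_⟩
  · filter_upwards [hψ0, hφ0] with z h1 h2
    simp only [Y, h2, h1]
  filter_upwards [Metric.ball_mem_nhds ((0, 0, z₀) : ℝ × ℝ × E) hδ] with p hp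
  obtain ⟨a, b, z⟩ := p
  have hab : ∀ σ ∈ Metric.ball (0 : ℝ) δ, (a, σ, z) ∈ Metric.ball ((0, 0, z₀) : ℝ × ℝ × E) δ := by
    intro σ hσ
    simp only [Metric.mem_ball, Prod.dist_eq, max_lt_iff] at hp hσ ⊢
    exact ⟨hp.1, hσ, hp.2.2⟩
  have hbm : b ∈ Metric.ball (0 : ℝ) δ := by
    simp only [Metric.mem_ball, Prod.dist_eq, max_lt_iff] at hp ⊢
    exact hp.2.1
  have hline : ∀ σ : ℝ, HasFDerivAt (fun σ : ℝ => (a, σ, z))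
      ((0 : ℝ →L[ℝ] ℝ).prod ((ContinuousLinearMap.id ℝ ℝ).prod 0)) σ := fun σ =>
    (hasFDerivAt_const _ _).prodMk ((hasFDerivAt_id _).prodMk (hasFDerivAt_const _ _))
  let R : ℝ × ℝ × E → E := fun p => fderiv ℝ Y p (1, 0, 0) - T (Y p)
  have hR : ∀ p ∈ Metric.ball ((0, 0, z₀) : ℝ × ℝ × E) δ,
      DifferentiableAt ℝ R p ∧ fderiv ℝ R p (0, 1, 0) = fderiv ℝ X (Y p) (R p) := by
    intro p hp
    obtain ⟨h1, h2, -, h3, h4, h5, -⟩ := hball p hp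
    have d1 := (contDiffAt_fderiv_apply h1 (1, 0, 0)).differentiableAt (by simp)
    have d2 := (h1.differentiableAt (by simp)).hasFDerivAt
    have d3 := (h3.differentiableAt (by simp)).hasFDerivAt.comp p d2
    have d4 := (h4.differentiableAt (by simp)).hasFDerivAt.comp p d2
    refine ⟨d1.sub d3.differentiableAt, ?_⟩
    have e1 : fderiv ℝ R p = fderiv ℝ (fun p => fderiv ℝ Y p (1, 0, 0)) p -
        (fderiv ℝ T (Y p)).comp (fderiv ℝ Y p) := (d1.hasFDerivAt.sub d3).fderiv
    have e2 : fderiv ℝ (fun p => fderiv ℝ Y p (0, 1, 0)) p =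
        (fderiv ℝ X (Y p)).comp (fderiv ℝ Y p) := by
      rw [Filter.EventuallyEq.fderiv_eq h2]
      exact d4.fderiv
    rw [e1, sub_apply, fderiv_fderiv_comm h1, e2,
      ContinuousLinearMap.comp_apply, ContinuousLinearMap.comp_apply, h2.self_of_nhds, ← h5,
      ← map_sub]
  have hzero : R (a, b, z) = 0 := by
    refine eq_zero_of_norm_fderiv_le (convex_ball (0 : ℝ) δ) (g := fun σ => R (a, σ, z))
      (g' := fun σ => (fderiv ℝ R (a, σ, z)).comp ((0 : ℝ →L[ℝ] ℝ).prod
        ((ContinuousLinearMap.id ℝ ℝ).prod 0)))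
      (fun σ hσ => HasFDerivAt.comp (g := R) σ (hR _ (hab σ hσ)).1.hasFDerivAt (hline σ))
      (K := ‖fderiv ℝ X z₀‖ + 1) ?_ (Metric.mem_ball_self hδ) ?_ b hbm
    · intro σ hσ v
      have hv : (v : ℝ) = v • (1 : ℝ) := by simp
      rw [hv, map_smul, norm_smul]
      have : ((fderiv ℝ R (a, σ, z)).comp ((0 : ℝ →L[ℝ] ℝ).prod
          ((ContinuousLinearMap.id ℝ ℝ).prod 0))) 1 = fderiv ℝ R (a, σ, z) (0, 1, 0) := by simp
      rw [this, (hR _ (hab σ hσ)).2]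
      calc _ ≤ ‖v‖ * ((‖fderiv ℝ X z₀‖ + 1) * ‖R (a, σ, z)‖) := by
            gcongr
            refine (ContinuousLinearMap.le_opNorm _ _).trans ?_
            gcongr
            exact (hball _ (hab σ hσ)).2.2.2.2.2.2
        _ = _ := by simp; ring
    · exact sub_eq_zero.2 (hball _ hp).2.2.1
  obtain ⟨h1, h2, -⟩ := hball _ hp
  have hplane : HasFDerivAt (fun q : ℝ × ℝ => (q.1, q.2, z))
      ((ContinuousLinearMap.fst ℝ ℝ ℝ).prod ((ContinuousLinearMap.snd ℝ ℝ ℝ).prod 0)) (a, b) :=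
    hasFDerivAt_fst.prodMk (hasFDerivAt_snd.prodMk (hasFDerivAt_const _ _))
  refine (((h1.differentiableAt (by simp)).hasFDerivAt).comp (a, b) hplane).congr_fderiv ?_
  have ha : fderiv ℝ Y (a, b, z) (1, 0, 0) = T (Y (a, b, z)) := sub_eq_zero.1 hzero
  have hb := h2.self_of_nhds
  ext
  · simpa using ha
  · simpa using hb

end Frobenius

/-! ### Partial derivatives of functions of `t` and `x` -/

section PartialDerivatives

/-- The partial derivative `∂g/∂x`. -/
def dX (g : ℝ × ℝ → ℝ) (q : ℝ × ℝ) : ℝ := deriv (fun y => g (q.1, y)) q.2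

/-- The partial derivative `∂g/∂t`. -/
def dT (g : ℝ × ℝ → ℝ) (q : ℝ × ℝ) : ℝ := deriv (fun s => g (s, q.2)) q.1

theorem xDeriv_zero (u : ℝ × ℝ → ℝ) : xDeriv 0 u = u := by
  funext q
  simp [xDeriv]

theorem xDeriv_succ (k : ℕ) (u : ℝ × ℝ → ℝ) : xDeriv (k + 1) u = dX (xDeriv k u) := by
  funext q
  simp only [xDeriv, dX, iteratedDeriv_succ]

theorem tendsto_xSlice (q : ℝ × ℝ) :
    Filter.Tendsto (fun y : ℝ => (q.1, y)) (𝓝 q.2) (𝓝 q) :=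
  (Continuous.prodMk_right q.1).continuousAt

theorem tendsto_tSlice (q : ℝ × ℝ) :
    Filter.Tendsto (fun s : ℝ => (s, q.2)) (𝓝 q.1) (𝓝 q) :=
  (Continuous.prodMk_left q.2).continuousAt

theorem hasDerivAt_xSlice {F : Type*} [NormedAddCommGroup F] [NormedSpace ℝ F] {g : ℝ × ℝ → F}
    {g' : ℝ × ℝ →L[ℝ] F} {q : ℝ × ℝ} (hg : HasFDerivAt g g' q) :
    HasDerivAt (fun y => g (q.1, y)) (g' (0, 1)) q.2 :=
  hg.comp_hasDerivAt q.2 ((hasDerivAt_const _ _).prodMk (hasDerivAt_id _))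

theorem hasDerivAt_tSlice {F : Type*} [NormedAddCommGroup F] [NormedSpace ℝ F] {g : ℝ × ℝ → F}
    {g' : ℝ × ℝ →L[ℝ] F} {q : ℝ × ℝ} (hg : HasFDerivAt g g' q) :
    HasDerivAt (fun s => g (s, q.2)) (g' (1, 0)) q.1 :=
  hg.comp_hasDerivAt q.1 ((hasDerivAt_id _).prodMk (hasDerivAt_const _ _))

theorem dX_congr {g g' : ℝ × ℝ → ℝ} {q : ℝ × ℝ} (h : g =ᶠ[𝓝 q] g') : dX g q = dX g' q :=
  Filter.EventuallyEq.deriv_eq ((tendsto_xSlice q).eventually h)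

theorem dT_congr {g g' : ℝ × ℝ → ℝ} {q : ℝ × ℝ} (h : g =ᶠ[𝓝 q] g') : dT g q = dT g' q :=
  Filter.EventuallyEq.deriv_eq ((tendsto_tSlice q).eventually h)

theorem xDeriv_congr {g g' : ℝ × ℝ → ℝ} {q : ℝ × ℝ} (h : g =ᶠ[𝓝 q] g') (k : ℕ) :
    xDeriv k g =ᶠ[𝓝 q] xDeriv k g' := by
  induction k with
  | zero => simpa only [xDeriv_zero] using h
  | succ k ih =>
    filter_upwards [ih.eventually_nhds] with q' hq'
    rw [xDeriv_succ, xDeriv_succ, dX_congr hq']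

theorem dX_eventuallyEq {g : ℝ × ℝ → ℝ} {q : ℝ × ℝ} (hg : ContDiffAt ℝ ∞ g q) :
    dX g =ᶠ[𝓝 q] fun q => fderiv ℝ g q (0, 1) := by
  filter_upwards [eventually_differentiableAt hg] with q' hq'
  exact (hasDerivAt_xSlice hq'.hasFDerivAt).deriv

theorem dT_eventuallyEq {g : ℝ × ℝ → ℝ} {q : ℝ × ℝ} (hg : ContDiffAt ℝ ∞ g q) :
    dT g =ᶠ[𝓝 q] fun q => fderiv ℝ g q (1, 0) := by
  filter_upwards [eventually_differentiableAt hg] with q' hq'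
  exact (hasDerivAt_tSlice hq'.hasFDerivAt).deriv

theorem contDiffAt_xDeriv {u : ℝ × ℝ → ℝ} {q : ℝ × ℝ} (hu : ContDiffAt ℝ ∞ u q) (k : ℕ) :
    ContDiffAt ℝ ∞ (xDeriv k u) q := by
  induction k with
  | zero => rwa [xDeriv_zero]
  | succ k ih =>
    rw [xDeriv_succ]
    exact (contDiffAt_fderiv_apply ih _).congr_of_eventuallyEq (dX_eventuallyEq ih)

theorem contDiffAt_xJet {u : ℝ × ℝ → ℝ} {q : ℝ × ℝ} (hu : ContDiffAt ℝ ∞ u q) (m : ℕ) :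
    ContDiffAt ℝ ∞ (xJet m u) q :=
  contDiffAt_fst.prodMk (contDiffAt_snd.prodMk
    (contDiffAt_pi.2 fun k => contDiffAt_xDeriv hu k))

theorem dT_dX {g : ℝ × ℝ → ℝ} {q : ℝ × ℝ} (hg : ContDiffAt ℝ ∞ g q) :
    dT (dX g) q = dX (dT g) q := by
  rw [dT_congr (dX_eventuallyEq hg), dX_congr (dT_eventuallyEq hg),
    (dT_eventuallyEq (contDiffAt_fderiv_apply hg _)).self_of_nhds,
    (dX_eventuallyEq (contDiffAt_fderiv_apply hg _)).self_of_nhds]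
  exact fderiv_fderiv_comm hg _ _

theorem dT_xDeriv {u : ℝ × ℝ → ℝ} {q : ℝ × ℝ} (hu : ∀ᶠ q' in 𝓝 q, ContDiffAt ℝ ∞ u q') (k : ℕ) :
    dT (xDeriv k u) =ᶠ[𝓝 q] xDeriv k (dT u) := by
  induction k with
  | zero => simp only [xDeriv_zero]; exact Filter.EventuallyEq.rfl
  | succ k ih =>
    filter_upwards [ih.eventually_nhds, hu] with q' hq' hu'
    rw [xDeriv_succ, xDeriv_succ, dT_dX (contDiffAt_xDeriv hu' k), dX_congr hq']

theorem hasDerivAt_xDeriv_x {u : ℝ × ℝ → ℝ} {q : ℝ × ℝ} (hu : ContDiffAt ℝ ∞ u q) (k : ℕ) :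
    HasDerivAt (fun y => xDeriv k u (q.1, y)) (xDeriv (k + 1) u q) q.2 := by
  rw [xDeriv_succ]
  exact (hasDerivAt_xSlice ((contDiffAt_xDeriv hu k).differentiableAt
    (by simp)).hasFDerivAt).differentiableAt.hasDerivAt

theorem hasDerivAt_xDeriv_t {u : ℝ × ℝ → ℝ} {q : ℝ × ℝ} (hu : ContDiffAt ℝ ∞ u q) (k : ℕ) :
    HasDerivAt (fun s => xDeriv k u (s, q.2)) (dT (xDeriv k u) q) q.1 :=
  (hasDerivAt_tSlice ((contDiffAt_xDeriv hu k).differentiableAt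
    (by simp)).hasFDerivAt).differentiableAt.hasDerivAt

end PartialDerivatives

/-! ### The equation restricted to the invariance surface -/

section Reduction

variable {r ρ : ℕ}

/-- The operator `D_x` restricted by `u_ρ = η`: the vector field
`∂_x + u₁ ∂_{u₀} + ⋯ + u_{ρ-1} ∂_{u_{ρ-2}} + η ∂_{u_{ρ-1}}`. -/
def xField (η : Pt ρ → ℝ) (z : Pt ρ) : Pt ρ :=
  (0, 1, fun i => if h : (i : ℕ) + 1 < ρ then z.2.2 ⟨i + 1, h⟩ else η z)

/-- The derivative of `g` along `xField η`. -/
def redDx (η g : Pt ρ → ℝ) (z : Pt ρ) : ℝ := fderiv ℝ g z (xField η z)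

/-- The derivative `u_k` as a function of `(t, x, u₀, …, u_{ρ-1})` in virtue of `u_ρ = η`. -/
def redCoord (η : Pt ρ → ℝ) (k : ℕ) (z : Pt ρ) : ℝ :=
  if h : k < ρ then z.2.2 ⟨k, h⟩ else (redDx η)^[k - ρ] η z

/-- The point `(t, x, u₀, …, u_{m-1})` as a function of `(t, x, u₀, …, u_{ρ-1})` in virtue of
`u_ρ = η`. -/
def redJet (η : Pt ρ → ℝ) (m : ℕ) (z : Pt ρ) : Pt m := (z.1, z.2.1, fun k => redCoord η k z)

/-- The right-hand side `H` restricted by `u_ρ = η`. -/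
def redH (H : Pt (r + 1) → ℝ) (η : Pt ρ → ℝ) (z : Pt ρ) : ℝ := H (redJet η (r + 1) z)

/-- The operator `D_t` restricted by `u_t = H` and `u_ρ = η`. -/
def tField (H : Pt (r + 1) → ℝ) (η : Pt ρ → ℝ) (z : Pt ρ) : Pt ρ :=
  (1, 0, fun i => (redDx η)^[i] (redH H η) z)

theorem redCoord_self (η : Pt ρ → ℝ) : redCoord η ρ = η := by
  funext z
  simp [redCoord]

theorem redCoord_of_lt (η : Pt ρ → ℝ) (z : Pt ρ) (k : Fin ρ) : redCoord η k z = z.2.2 k := by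
  simp [redCoord]

theorem redJet_self (η : Pt ρ → ℝ) (z : Pt ρ) : redJet η ρ z = z := by
  simp [redJet, redCoord_of_lt]

theorem xField_eq (η : Pt ρ → ℝ) (z : Pt ρ) :
    xField η z = (0, 1, fun i : Fin ρ => redCoord η (i + 1) z) := by
  simp only [xField, Prod.mk.injEq, true_and]
  funext i
  by_cases h : (i : ℕ) + 1 < ρ
  · simp [h, redCoord]
  · have : (i : ℕ) + 1 = ρ := by omega
    simp [this, redCoord]

/-- The coordinate `u_k`, as a continuous linear map. -/
def coordCLM (k : Fin ρ) : Pt ρ →L[ℝ] ℝ :=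
  (ContinuousLinearMap.proj k).comp
    ((ContinuousLinearMap.snd ℝ ℝ _).comp (ContinuousLinearMap.snd ℝ ℝ _))

theorem redDx_redCoord (η : Pt ρ → ℝ) (k : ℕ) : redDx η (redCoord η k) = redCoord η (k + 1) := by
  funext z
  by_cases h : k < ρ
  · have : redCoord η k = coordCLM (⟨k, h⟩ : Fin ρ) := by
      funext z
      exact redCoord_of_lt η z ⟨k, h⟩
    rw [redDx, this, ContinuousLinearMap.fderiv, xField_eq]
    rfl
  · have h1 : redCoord η k = (redDx η)^[k - ρ] η := by
      funext z
      simp [redCoord, h]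
    have h2 : redCoord η (k + 1) = (redDx η)^[k - ρ + 1] η := by
      funext z
      have : ¬ k + 1 < ρ := by omega
      simp only [redCoord, this, dite_false, Nat.succ_sub (not_lt.1 h)]
    rw [h1, h2, Function.iterate_succ_apply']

theorem contDiffAt_xField {η : Pt ρ → ℝ} {z : Pt ρ} (hη : ContDiffAt ℝ ∞ η z) :
    ContDiffAt ℝ ∞ (xField η) z := by
  refine contDiffAt_const.prodMk (contDiffAt_const.prodMk (contDiffAt_pi.2 fun i => ?_))
  by_cases h : (i : ℕ) + 1 < ρ
  · simp only [h, dite_true]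
    exact (coordCLM (⟨i + 1, h⟩ : Fin ρ)).contDiff.contDiffAt
  · simpa only [h, dite_false] using hη

theorem contDiffAt_redDx {η g : Pt ρ → ℝ} {z : Pt ρ} (hη : ContDiffAt ℝ ∞ η z)
    (hg : ContDiffAt ℝ ∞ g z) : ContDiffAt ℝ ∞ (redDx η g) z :=
  (hg.fderiv_right (m := ∞) (by simp)).clm_apply (contDiffAt_xField hη)

theorem contDiffAt_redDx_iterate {η g : Pt ρ → ℝ} {z : Pt ρ} (hη : ContDiffAt ℝ ∞ η z)
    (hg : ContDiffAt ℝ ∞ g z) (k : ℕ) : ContDiffAt ℝ ∞ ((redDx η)^[k] g) z := by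
  induction k with
  | zero => exact hg
  | succ k ih =>
    rw [Function.iterate_succ_apply']
    exact contDiffAt_redDx hη ih

theorem contDiffAt_redCoord {η : Pt ρ → ℝ} {z : Pt ρ} (hη : ContDiffAt ℝ ∞ η z) (k : ℕ) :
    ContDiffAt ℝ ∞ (redCoord η k) z := by
  induction k with
  | zero =>
    by_cases h : 0 < ρ
    · have : redCoord η 0 = coordCLM (⟨0, h⟩ : Fin ρ) := by
        funext z
        exact redCoord_of_lt η z ⟨0, h⟩
      rw [this]
      exact (coordCLM _).contDiff.contDiffAt
    · obtain rfl : ρ = 0 := by omega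
      rwa [redCoord_self]
  | succ k ih =>
    rw [← redDx_redCoord]
    exact contDiffAt_redDx hη ih

theorem contDiffAt_redJet {η : Pt ρ → ℝ} {z : Pt ρ} (hη : ContDiffAt ℝ ∞ η z) (m : ℕ) :
    ContDiffAt ℝ ∞ (redJet η m) z :=
  contDiffAt_fst.prodMk (contDiffAt_snd.fst.prodMk
    (contDiffAt_pi.2 fun k => contDiffAt_redCoord hη k))

variable {H : Pt (r + 1) → ℝ} {D : Set (Pt (r + 1))}

theorem contDiffAt_redH (hD : IsOpen D) (hH : ContDiffOn ℝ ∞ H D) {η : Pt ρ → ℝ} {z : Pt ρ}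
    (hη : ContDiffAt ℝ ∞ η z) (hz : redJet η (r + 1) z ∈ D) : ContDiffAt ℝ ∞ (redH H η) z :=
  (hH.contDiffAt (hD.mem_nhds hz)).comp z (contDiffAt_redJet hη _)

theorem contDiffAt_tField (hD : IsOpen D) (hH : ContDiffOn ℝ ∞ H D) {η : Pt ρ → ℝ} {z : Pt ρ}
    (hη : ContDiffAt ℝ ∞ η z) (hz : redJet η (r + 1) z ∈ D) : ContDiffAt ℝ ∞ (tField H η) z :=
  contDiffAt_const.prodMk (contDiffAt_const.prodMk
    (contDiffAt_pi.2 fun i => contDiffAt_redDx_iterate hη (contDiffAt_redH hD hH hη hz) i))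

theorem eventually_redJet_mem (hD : IsOpen D) {η : Pt ρ → ℝ} {z : Pt ρ}
    (hη : ContDiffAt ℝ ∞ η z) (hz : redJet η (r + 1) z ∈ D) :
    ∀ᶠ z' in 𝓝 z, redJet η (r + 1) z' ∈ D :=
  (contDiffAt_redJet hη _).continuousAt.eventually_mem (hD.mem_nhds hz)

/-- Along a map `y` of `(t, x)` with `∂y/∂x = xField η y`, repeated differentiation in `x` is
repeated application of `redDx η`. -/
theorem xDeriv_comp_eq {η G : Pt ρ → ℝ} {y : ℝ × ℝ → Pt ρ} {q : ℝ × ℝ} (hyc : ContinuousAt y q)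
    (hy : ∀ᶠ q' in 𝓝 q, HasDerivAt (fun s => y (q'.1, s)) (xField η (y q')) q'.2)
    (hη : ContDiffAt ℝ ∞ η (y q)) (hG : ContDiffAt ℝ ∞ G (y q)) (k : ℕ) :
    xDeriv k (fun q => G (y q)) =ᶠ[𝓝 q] fun q => (redDx η)^[k] G (y q) := by
  induction k with
  | zero => rw [xDeriv_zero]; exact Filter.EventuallyEq.rfl
  | succ k ih =>
    filter_upwards [ih.eventually_nhds, hy, hyc.eventually
      (eventually_differentiableAt (contDiffAt_redDx_iterate hη hG k))] with q' h1 h2 h3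
    rw [xDeriv_succ, dX_congr h1, Function.iterate_succ_apply']
    exact (h3.hasFDerivAt.comp_hasDerivAt q'.2 h2).deriv

theorem hasDerivAt_xJet_x {η : Pt ρ → ℝ} {u : ℝ × ℝ → ℝ} {q : ℝ × ℝ} (hu : ContDiffAt ℝ ∞ u q)
    (hinv : InvariantAt η u q) :
    HasDerivAt (fun s => xJet ρ u (q.1, s)) (xField η (xJet ρ u q)) q.2 := by
  refine (hasDerivAt_const _ _).prodMk ((hasDerivAt_id _).prodMk (hasDerivAt_pi.2 fun i => ?_))
  convert! hasDerivAt_xDeriv_x hu i using 1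
  by_cases h : (i : ℕ) + 1 < ρ
  · simp [h, xJet]
  · have : (i : ℕ) + 1 = ρ := by omega
    simp only [this, lt_irrefl, dite_false]
    exact hinv.symm

/-- The hypotheses on a `Q`-invariant solution, at all points near `q`. -/
def IsInvariantSolutionNear (H : Pt (r + 1) → ℝ) (D : Set (Pt (r + 1))) (η : Pt ρ → ℝ)
    (u : ℝ × ℝ → ℝ) (q : ℝ × ℝ) : Prop :=
  ∀ᶠ q' in 𝓝 q, ContDiffAt ℝ ∞ u q' ∧ SolvesAt H D u q' ∧ InvariantAt η u q'

/-- The `x`-derivatives of an invariant function are determined by those of orders less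
than `ρ`. -/
theorem xDeriv_eventuallyEq_redCoord {η : Pt ρ → ℝ} {u : ℝ × ℝ → ℝ} {q : ℝ × ℝ}
    (hu : ∀ᶠ q' in 𝓝 q, ContDiffAt ℝ ∞ u q' ∧ InvariantAt η u q')
    (hη : ContDiffAt ℝ ∞ η (xJet ρ u q)) (k : ℕ) :
    xDeriv k u =ᶠ[𝓝 q] fun q => redCoord η k (xJet ρ u q) := by
  have hyc := (contDiffAt_xJet hu.self_of_nhds.1 ρ).continuousAt
  induction k with
  | zero =>
    by_cases h : 0 < ρ
    · exact Filter.Eventually.of_forall fun q => (redCoord_of_lt η (xJet ρ u q) ⟨0, h⟩).symm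
    · obtain rfl : ρ = 0 := by omega
      rw [redCoord_self]
      exact hu.mono fun _ h => h.2
  | succ k ih =>
    filter_upwards [ih.eventually_nhds, hu, hyc.eventually
      (eventually_differentiableAt (contDiffAt_redCoord hη k))] with q' h1 h2 h3
    rw [xDeriv_succ, dX_congr h1, ← redDx_redCoord]
    exact (h3.hasFDerivAt.comp_hasDerivAt q'.2 (hasDerivAt_xJet_x h2.1 h2.2)).deriv

theorem xJet_eventuallyEq_redJet {η : Pt ρ → ℝ} {u : ℝ × ℝ → ℝ} {q : ℝ × ℝ}
    (hu : ∀ᶠ q' in 𝓝 q, ContDiffAt ℝ ∞ u q' ∧ InvariantAt η u q')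
    (hη : ContDiffAt ℝ ∞ η (xJet ρ u q)) (m : ℕ) :
    xJet m u =ᶠ[𝓝 q] fun q => redJet η m (xJet ρ u q) := by
  have : ∀ᶠ q' in 𝓝 q, ∀ k : Fin m, xDeriv k u q' = redCoord η k (xJet ρ u q') :=
    Filter.eventually_all.2 fun k => xDeriv_eventuallyEq_redCoord hu hη k
  filter_upwards [this] with q' hq'
  simp only [xJet, redJet, Prod.mk.injEq, true_and] at hq' ⊢
  exact funext hq'

theorem redJet_xJet_mem {η : Pt ρ → ℝ}
    {u : ℝ × ℝ → ℝ} {q : ℝ × ℝ} (hu : IsInvariantSolutionNear H D η u q)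
    (hη : ContDiffAt ℝ ∞ η (xJet ρ u q)) : redJet η (r + 1) (xJet ρ u q) ∈ D := by
  have h := (xJet_eventuallyEq_redJet (hu.mono fun _ h => ⟨h.1, h.2.2⟩) hη (r + 1)).self_of_nhds
  simp only at h
  rw [← h]
  exact hu.self_of_nhds.2.1.1

theorem dT_xDeriv_eventuallyEq (hD : IsOpen D) (hH : ContDiffOn ℝ ∞ H D) {η : Pt ρ → ℝ}
    {u : ℝ × ℝ → ℝ} {q : ℝ × ℝ} (hu : IsInvariantSolutionNear H D η u q)
    (hη : ContDiffAt ℝ ∞ η (xJet ρ u q)) (k : ℕ) :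
    dT (xDeriv k u) =ᶠ[𝓝 q] fun q => (redDx η)^[k] (redH H η) (xJet ρ u q) := by
  have hu' : ∀ᶠ q' in 𝓝 q, ContDiffAt ℝ ∞ u q' ∧ InvariantAt η u q' :=
    hu.mono fun _ h => ⟨h.1, h.2.2⟩
  have hjet := xJet_eventuallyEq_redJet hu' hη (r + 1)
  have hq := redJet_xJet_mem hu hη
  have h0 : dT u =ᶠ[𝓝 q] fun q => redH H η (xJet ρ u q) := by
    filter_upwards [hu, hjet] with q' h1 h2
    rw [redH, ← h2]
    exact h1.2.1.2
  exact (dT_xDeriv (hu.mono fun _ h => h.1) k).trans ((xDeriv_congr h0 k).trans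
    (xDeriv_comp_eq (contDiffAt_xJet hu.self_of_nhds.1 ρ).continuousAt
      (hu.mono fun _ h => hasDerivAt_xJet_x h.1 h.2.2) hη (contDiffAt_redH hD hH hη hq) k))

theorem hasDerivAt_xJet_t (hD : IsOpen D) (hH : ContDiffOn ℝ ∞ H D) {η : Pt ρ → ℝ}
    {u : ℝ × ℝ → ℝ} {q : ℝ × ℝ} (hu : IsInvariantSolutionNear H D η u q)
    (hη : ContDiffAt ℝ ∞ η (xJet ρ u q)) :
    HasDerivAt (fun s => xJet ρ u (s, q.2)) (tField H η (xJet ρ u q)) q.1 := by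
  refine (hasDerivAt_id _).prodMk ((hasDerivAt_const _ _).prodMk (hasDerivAt_pi.2 fun i => ?_))
  convert! hasDerivAt_xDeriv_t hu.self_of_nhds.1 i using 1
  exact (dT_xDeriv_eventuallyEq hD hH hu hη i).self_of_nhds.symm

/-- The jet of an invariant solution is an integral surface of the restricted total
derivatives. -/
theorem isIntegralSurfaceAt_xJet (hD : IsOpen D) (hH : ContDiffOn ℝ ∞ H D) {η : Pt ρ → ℝ}
    {u : ℝ × ℝ → ℝ} {q : ℝ × ℝ} (hu : IsInvariantSolutionNear H D η u q)
    (hη : ContDiffAt ℝ ∞ η (xJet ρ u q)) :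
    IsIntegralSurfaceAt (tField H η) (xField η) (xJet ρ u) q := by
  have hd := ((contDiffAt_xJet hu.self_of_nhds.1 ρ).differentiableAt (by simp)).hasFDerivAt
  have ht := (hasDerivAt_tSlice hd).unique (hasDerivAt_xJet_t hD hH hu hη)
  have hx := (hasDerivAt_xSlice hd).unique
    (hasDerivAt_xJet_x hu.self_of_nhds.1 hu.self_of_nhds.2.2)
  refine hd.congr_fderiv (ContinuousLinearMap.ext fun v => ?_)
  have hv : v = v.1 • ((1, 0) : ℝ × ℝ) + v.2 • ((0, 1) : ℝ × ℝ) := by ext <;> simp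
  conv_lhs => rw [hv]
  rw [map_add, map_smul, map_smul, ht, hx]
  rfl

/-- Cross-differentiation of `u_ρ = η` and `u_t = H` along an invariant solution. -/
theorem redDx_iterate_redH_eq (hD : IsOpen D) (hH : ContDiffOn ℝ ∞ H D) {η : Pt ρ → ℝ}
    {u : ℝ × ℝ → ℝ} {q : ℝ × ℝ} (hu : IsInvariantSolutionNear H D η u q)
    (hη : ContDiffAt ℝ ∞ η (xJet ρ u q)) :
    (redDx η)^[ρ] (redH H η) (xJet ρ u q) =
      fderiv ℝ η (xJet ρ u q) (tField H η (xJet ρ u q)) := by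
  have h1 := (dT_xDeriv_eventuallyEq hD hH hu hη ρ).self_of_nhds
  simp only at h1
  rw [← h1, dT_congr (hu.mono fun _ h => h.2.2 :
    xDeriv ρ u =ᶠ[𝓝 q] fun q => η (xJet ρ u q))]
  exact ((hη.differentiableAt (by simp)).hasFDerivAt.comp_hasDerivAt q.1
    (hasDerivAt_xJet_t hD hH hu hη)).deriv

end Reduction

/-! ### Differential functions of finite order -/

section DifferentialFunctions

/-- `F` is on `U` a smooth function of `t`, `x` and finitely many jet coordinates. -/
def IsDiffFun (U : Set Jet) (F : Jet → ℝ) : Prop :=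
  ∃ (ι : Type) (_ : Fintype ι) (c : ι → ℕ × ℕ) (G : ℝ × ℝ × (ι → ℝ) → ℝ), ∀ j ∈ U,
    ContDiffAt ℝ ∞ G (j.1, j.2.1, fun i => j.2.2 (c i)) ∧
      F j = G (j.1, j.2.1, fun i => j.2.2 (c i))

/-- The curve `γ` in the jet space has coordinatewise velocity `v` at `s`. -/
def HasVelocityAt (γ : ℝ → Jet) (v : Jet) (s : ℝ) : Prop :=
  HasDerivAt (fun s => (γ s).1) v.1 s ∧ HasDerivAt (fun s => (γ s).2.1) v.2.1 s ∧
    ∀ α, HasDerivAt (fun s => (γ s).2.2 α) (v.2.2 α) s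

theorem HasVelocityAt.continuousAt {γ : ℝ → Jet} {v : Jet} {s : ℝ} (h : HasVelocityAt γ v s) :
    ContinuousAt γ s :=
  h.1.continuousAt.prodMk (h.2.1.continuousAt.prodMk
    (continuousAt_pi.2 fun α => (h.2.2 α).continuousAt))

/-- The velocity vector `(0, 1, (u_{(α₀, α₁+1)})_α)` of `D_x`. -/
def shiftX (j : Jet) : Jet := (0, 1, fun α => j.2.2 (α.1, α.2 + 1))

/-- The velocity vector `(1, 0, (u_{(α₀+1, α₁)})_α)` of `D_t`. -/
def shiftT (j : Jet) : Jet := (1, 0, fun α => j.2.2 (α.1 + 1, α.2))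

/-- The curve along which `totalDx` differentiates. -/
def lineX (j : Jet) (s : ℝ) : Jet :=
  (j.1, j.2.1 + s, fun α => j.2.2 α + s * j.2.2 (α.1, α.2 + 1))

/-- The curve along which `totalDt` differentiates. -/
def lineT (j : Jet) (s : ℝ) : Jet :=
  (j.1 + s, j.2.1, fun α => j.2.2 α + s * j.2.2 (α.1 + 1, α.2))

theorem lineX_zero (j : Jet) : lineX j 0 = j := by simp [lineX]

theorem lineT_zero (j : Jet) : lineT j 0 = j := by simp [lineT]

theorem hasVelocityAt_lineX (j : Jet) : HasVelocityAt (lineX j) (shiftX j) 0 :=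
  ⟨hasDerivAt_const _ _, (hasDerivAt_id _).const_add _, fun α => by
    simpa [lineX, shiftX] using
      ((hasDerivAt_id (0 : ℝ)).mul_const (j.2.2 (α.1, α.2 + 1))).const_add (j.2.2 α)⟩

theorem hasVelocityAt_lineT (j : Jet) : HasVelocityAt (lineT j) (shiftT j) 0 :=
  ⟨(hasDerivAt_id _).const_add _, hasDerivAt_const _ _, fun α => by
    simpa [lineT, shiftT] using
      ((hasDerivAt_id (0 : ℝ)).mul_const (j.2.2 (α.1 + 1, α.2))).const_add (j.2.2 α)⟩

variable {U : Set Jet} {F : Jet → ℝ}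

theorem hasDerivAt_comp_of_hasVelocityAt (hU : IsOpen U) {ι : Type} [Fintype ι]
    {c : ι → ℕ × ℕ} {G : ℝ × ℝ × (ι → ℝ) → ℝ}
    (hG : ∀ j ∈ U, ContDiffAt ℝ ∞ G (j.1, j.2.1, fun i => j.2.2 (c i)) ∧
      F j = G (j.1, j.2.1, fun i => j.2.2 (c i)))
    (γ : ℝ → Jet) (v : Jet) (s : ℝ) (hs : γ s ∈ U) (hγ : HasVelocityAt γ v s) :
    HasDerivAt (fun s => F (γ s)) (fderiv ℝ G
      ((γ s).1, (γ s).2.1, fun i => (γ s).2.2 (c i)) (v.1, v.2.1, fun i => v.2.2 (c i))) s := by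
  have h1 : HasDerivAt (fun s => ((γ s).1, (γ s).2.1, fun i => (γ s).2.2 (c i)))
      (v.1, v.2.1, fun i => v.2.2 (c i)) s :=
    hγ.1.prodMk (hγ.2.1.prodMk (hasDerivAt_pi.2 fun i => hγ.2.2 (c i)))
  have h2 : HasFDerivAt G (fderiv ℝ G ((γ s).1, (γ s).2.1, fun i => (γ s).2.2 (c i)))
      ((γ s).1, (γ s).2.1, fun i => (γ s).2.2 (c i)) :=
    ((hG _ hs).1.differentiableAt (by simp)).hasFDerivAt
  have h3 : (fun s => F (γ s)) =ᶠ[𝓝 s]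
      fun s => G ((γ s).1, (γ s).2.1, fun i => (γ s).2.2 (c i)) := by
    filter_upwards [hγ.continuousAt.eventually_mem (hU.mem_nhds hs)] with s' hs'
    exact (hG _ hs').2
  have h4 := HasFDerivAt.comp_hasDerivAt (l := G) s h2 h1
  exact h4.congr_of_eventuallyEq h3

theorem IsDiffFun.hasDerivAt_totalDx (hU : IsOpen U) (hF : IsDiffFun U F) {γ : ℝ → Jet} {s : ℝ}
    (hs : γ s ∈ U) (hγ : HasVelocityAt γ (shiftX (γ s)) s) :
    HasDerivAt (fun s => F (γ s)) (totalDx F (γ s)) s := by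
  obtain ⟨ι, _, c, G, hG⟩ := hF
  have h := hasDerivAt_comp_of_hasVelocityAt hU hG
  have h1 := h (lineX (γ s)) _ 0 (by rwa [lineX_zero]) (hasVelocityAt_lineX (γ s))
  rw [lineX_zero] at h1
  rw [show totalDx F (γ s) = _ from h1.deriv]
  exact h γ _ s hs hγ

theorem IsDiffFun.hasDerivAt_totalDt (hU : IsOpen U) (hF : IsDiffFun U F) {γ : ℝ → Jet} {s : ℝ}
    (hs : γ s ∈ U) (hγ : HasVelocityAt γ (shiftT (γ s)) s) :
    HasDerivAt (fun s => F (γ s)) (totalDt F (γ s)) s := by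
  obtain ⟨ι, _, c, G, hG⟩ := hF
  have h := hasDerivAt_comp_of_hasVelocityAt hU hG
  have h1 := h (lineT (γ s)) _ 0 (by rwa [lineT_zero]) (hasVelocityAt_lineT (γ s))
  rw [lineT_zero] at h1
  rw [show totalDt F (γ s) = _ from h1.deriv]
  exact h γ _ s hs hγ

/-- The derivative of a differential function in a direction whose components are jet
coordinates is a differential function. -/
theorem isDiffFun_of_fderiv {ι : Type} [Fintype ι] (c c' : ι → ℕ × ℕ) (v : ℝ × ℝ)
    {G : ℝ × ℝ × (ι → ℝ) → ℝ}
    (hG : ∀ j ∈ U, ContDiffAt ℝ ∞ G (j.1, j.2.1, fun i => j.2.2 (c i)))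
    (hF : ∀ j ∈ U, F j = fderiv ℝ G (j.1, j.2.1, fun i => j.2.2 (c i))
      (v.1, v.2, fun i => j.2.2 (c' i))) : IsDiffFun U F := by
  refine ⟨ι ⊕ ι, inferInstance, Sum.elim c c', fun p =>
    fderiv ℝ G (p.1, p.2.1, fun i => p.2.2 (Sum.inl i)) (v.1, v.2, fun i => p.2.2 (Sum.inr i)),
    fun j hj => ⟨?_, hF j hj⟩⟩
  refine ContDiffAt.clm_apply ?_ (by fun_prop)
  exact ((hG j hj).fderiv_right (m := ∞) (by simp)).comp
    (g := fderiv ℝ G)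
    (f := fun p : ℝ × ℝ × (ι ⊕ ι → ℝ) => (p.1, p.2.1, fun i => p.2.2 (Sum.inl i)))
    (j.1, j.2.1, fun i => j.2.2 (Sum.elim c c' i)) (by fun_prop)

theorem IsDiffFun.totalDx (hU : IsOpen U) (hF : IsDiffFun U F) : IsDiffFun U (totalDx F) := by
  obtain ⟨ι, _, c, G, hG⟩ := hF
  have h := hasDerivAt_comp_of_hasVelocityAt hU hG
  refine isDiffFun_of_fderiv c (fun i => ((c i).1, (c i).2 + 1)) (0, 1)
    (fun j hj => (hG j hj).1) fun j hj => ?_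
  have h1 := h (lineX j) _ 0 (by rwa [lineX_zero]) (hasVelocityAt_lineX j)
  rw [lineX_zero] at h1
  exact h1.deriv

theorem IsDiffFun.totalDt (hU : IsOpen U) (hF : IsDiffFun U F) : IsDiffFun U (totalDt F) := by
  obtain ⟨ι, _, c, G, hG⟩ := hF
  have h := hasDerivAt_comp_of_hasVelocityAt hU hG
  refine isDiffFun_of_fderiv c (fun i => ((c i).1 + 1, (c i).2)) (1, 0)
    (fun j hj => (hG j hj).1) fun j hj => ?_
  have h1 := h (lineT j) _ 0 (by rwa [lineT_zero]) (hasVelocityAt_lineT j)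
  rw [lineT_zero] at h1
  exact h1.deriv

theorem IsDiffFun.totalDx_iterate (hU : IsOpen U) (hF : IsDiffFun U F) (k : ℕ) :
    IsDiffFun U (EvolEq.totalDx^[k] F) := by
  induction k with
  | zero => exact hF
  | succ k ih =>
    rw [Function.iterate_succ_apply']
    exact ih.totalDx hU

theorem IsDiffFun.totalDt_iterate (hU : IsOpen U) (hF : IsDiffFun U F) (k : ℕ) :
    IsDiffFun U (EvolEq.totalDt^[k] F) := by
  induction k with
  | zero => exact hF
  | succ k ih =>
    rw [Function.iterate_succ_apply']
    exact ih.totalDt hU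

theorem totalDx_coord_sub (hU : IsOpen U) (hF : IsDiffFun U F) {F' : Jet → ℝ} {α : ℕ × ℕ}
    (h : ∀ j ∈ U, F' j = j.2.2 α - F j) :
    ∀ j ∈ U, totalDx F' j = j.2.2 (α.1, α.2 + 1) - totalDx F j := by
  intro j hj
  have hv := hasVelocityAt_lineX j
  have h1 : HasDerivAt (fun s => F (lineX j s)) (totalDx F j) 0 := by
    simpa only [lineX_zero] using hF.hasDerivAt_totalDx hU (γ := lineX j) (s := 0)
      (by rwa [lineX_zero]) (by rwa [lineX_zero])
  refine (((hv.2.2 α).sub h1).congr_of_eventuallyEq ?_).deriv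
  filter_upwards [hv.continuousAt.eventually_mem
    (hU.mem_nhds (by rwa [lineX_zero] : lineX j 0 ∈ U))] with s hs
  exact h _ hs

theorem totalDt_coord_sub (hU : IsOpen U) (hF : IsDiffFun U F) {F' : Jet → ℝ} {α : ℕ × ℕ}
    (h : ∀ j ∈ U, F' j = j.2.2 α - F j) :
    ∀ j ∈ U, totalDt F' j = j.2.2 (α.1 + 1, α.2) - totalDt F j := by
  intro j hj
  have hv := hasVelocityAt_lineT j
  have h1 : HasDerivAt (fun s => F (lineT j s)) (totalDt F j) 0 := by
    simpa only [lineT_zero] using hF.hasDerivAt_totalDt hU (γ := lineT j) (s := 0)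
      (by rwa [lineT_zero]) (by rwa [lineT_zero])
  refine (((hv.2.2 α).sub h1).congr_of_eventuallyEq ?_).deriv
  filter_upwards [hv.continuousAt.eventually_mem
    (hU.mem_nhds (by rwa [lineT_zero] : lineT j 0 ∈ U))] with s hs
  exact h _ hs

theorem totalDx_iterate_coord_sub (hU : IsOpen U) (hF : IsDiffFun U F) {F' : Jet → ℝ} {α : ℕ × ℕ}
    (h : ∀ j ∈ U, F' j = j.2.2 α - F j) (k : ℕ) :
    ∀ j ∈ U, totalDx^[k] F' j = j.2.2 (α.1, α.2 + k) - totalDx^[k] F j := by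
  induction k with
  | zero => exact h
  | succ k ih =>
    simp only [Function.iterate_succ_apply']
    exact totalDx_coord_sub hU (hF.totalDx_iterate hU k) ih

theorem totalDt_iterate_coord_sub (hU : IsOpen U) (hF : IsDiffFun U F) {F' : Jet → ℝ} {α : ℕ × ℕ}
    (h : ∀ j ∈ U, F' j = j.2.2 α - F j) (k : ℕ) :
    ∀ j ∈ U, totalDt^[k] F' j = j.2.2 (α.1 + k, α.2) - totalDt^[k] F j := by
  induction k with
  | zero => exact h
  | succ k ih =>
    simp only [Function.iterate_succ_apply']
    exact totalDt_coord_sub hU (hF.totalDt_iterate hU k) ih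

/-- `F` depends on `t`, `x` and the jet coordinates with index in `S` only. -/
def DependsOnly (S : Set (ℕ × ℕ)) (F : Jet → ℝ) : Prop :=
  ∀ j j' : Jet, j.1 = j'.1 → j.2.1 = j'.2.1 → (∀ α ∈ S, j.2.2 α = j'.2.2 α) → F j = F j'

theorem DependsOnly.totalDx {S S' : Set (ℕ × ℕ)} (hF : DependsOnly S F) (hS : S ⊆ S')
    (hS' : ∀ α ∈ S, (α.1, α.2 + 1) ∈ S') : DependsOnly S' (totalDx F) := by
  intro j j' h1 h2 h3
  unfold EvolEq.totalDx
  congr 1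
  funext s
  refine hF _ _ h1 (by simp [h2]) fun α hα => ?_
  simp only [h3 α (hS hα), h3 _ (hS' α hα)]

theorem DependsOnly.totalDt {S S' : Set (ℕ × ℕ)} (hF : DependsOnly S F) (hS : S ⊆ S')
    (hS' : ∀ α ∈ S, (α.1 + 1, α.2) ∈ S') : DependsOnly S' (totalDt F) := by
  intro j j' h1 h2 h3
  unfold EvolEq.totalDt
  congr 1
  funext s
  refine hF _ _ (by simp [h1]) h2 fun α hα => ?_
  simp only [h3 α (hS hα), h3 _ (hS' α hα)]

end DifferentialFunctions

/-! ### Jets over the invariance surface -/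

section Section

variable {r ρ : ℕ} {η : Pt ρ → ℝ} {z : Pt ρ}

/-- The jet over `z` whose pure `x`-derivatives are prescribed by `u_ρ = η`; the coordinates
involving `t`-derivatives are set to zero. -/
def secJet (η : Pt ρ → ℝ) (z : Pt ρ) : Jet :=
  (z.1, z.2.1, fun α => if α.1 = 0 then redCoord η α.2 z else 0)

theorem xPart_secJet (m : ℕ) : (secJet η z).xPart m = redJet η m z := by
  simp [Jet.xPart, secJet, redJet]

theorem secJet_xCoord (k : ℕ) (z : Pt ρ) : (secJet η z).2.2 (0, k) = redCoord η k z := by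
  simp [secJet]

theorem contDiffAt_secJet_coord (hη : ContDiffAt ℝ ∞ η z) (α : ℕ × ℕ) :
    ContDiffAt ℝ ∞ (fun z => (secJet η z).2.2 α) z := by
  by_cases h : α.1 = 0
  · simpa only [secJet, h, if_true] using contDiffAt_redCoord hη α.2
  · simpa only [secJet, h, if_false] using contDiffAt_const

theorem continuousAt_secJet (hη : ContDiffAt ℝ ∞ η z) : ContinuousAt (secJet η) z :=
  continuousAt_fst.prodMk (continuous_snd.fst.continuousAt.prodMk
    (continuousAt_pi.2 fun α => (contDiffAt_secJet_coord hη α).continuousAt))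

theorem contDiffAt_comp_secJet {U : Set Jet} {F : Jet → ℝ} (hU : IsOpen U) (hF : IsDiffFun U F)
    (hη : ContDiffAt ℝ ∞ η z) (hz : secJet η z ∈ U) :
    ContDiffAt ℝ ∞ (fun z => F (secJet η z)) z := by
  obtain ⟨ι, _, c, G, hG⟩ := hF
  have h1 : ContDiffAt ℝ ∞
      (fun z => ((secJet η z).1, (secJet η z).2.1, fun i => (secJet η z).2.2 (c i))) z :=
    contDiffAt_fst.prodMk (contDiffAt_snd.fst.prodMk
      (contDiffAt_pi.2 fun i => contDiffAt_secJet_coord hη (c i)))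
  refine ((hG _ hz).1.comp z h1).congr_of_eventuallyEq ?_
  filter_upwards [(continuousAt_secJet hη).eventually_mem (hU.mem_nhds hz)] with z' hz'
  exact (hG _ hz').2

theorem hasVelocityAt_secJet (hη : ContDiffAt ℝ ∞ η z) :
    HasVelocityAt (fun s : ℝ => secJet η (z + s • xField η z)) (shiftX (secJet η z)) 0 := by
  have hl : HasDerivAt (fun s : ℝ => z + s • xField η z) (xField η z) 0 := by
    simpa using ((hasDerivAt_id (0 : ℝ)).smul_const (xField η z)).const_add z
  refine ⟨?_, ?_, fun α => ?_⟩
  · exact (hasFDerivAt_fst.comp_hasDerivAt 0 hl :)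
  · exact ((ContinuousLinearMap.fst ℝ ℝ (Fin ρ → ℝ)).hasFDerivAt.comp_hasDerivAt 0
      (hasFDerivAt_snd.comp_hasDerivAt 0 hl) :)
  · by_cases h : α.1 = 0
    · simp only [secJet, shiftX, h, if_true]
      have h1 : HasFDerivAt (redCoord η α.2) (fderiv ℝ (redCoord η α.2) z)
          (z + (0 : ℝ) • xField η z) := by
        simpa using ((contDiffAt_redCoord hη α.2).differentiableAt (by simp)).hasFDerivAt
      rw [← redDx_redCoord]
      exact h1.comp_hasDerivAt 0 hl
    · simp only [secJet, shiftX, h, if_false]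
      exact hasDerivAt_const _ _

/-- On the section `secJet η`, the total derivative `D_x` is the derivative along
`xField η`. -/
theorem redDx_comp_secJet {U : Set Jet} {F : Jet → ℝ} (hU : IsOpen U) (hF : IsDiffFun U F)
    (hη : ContDiffAt ℝ ∞ η z) (hz : secJet η z ∈ U) :
    redDx η (fun z => F (secJet η z)) z = totalDx F (secJet η z) := by
  have hl : HasDerivAt (fun s : ℝ => z + s • xField η z) (xField η z) 0 := by
    simpa using ((hasDerivAt_id (0 : ℝ)).smul_const (xField η z)).const_add z
  have h1 : HasFDerivAt (fun z => F (secJet η z)) (fderiv ℝ (fun z => F (secJet η z)) z)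
      (z + (0 : ℝ) • xField η z) := by
    simpa using ((contDiffAt_comp_secJet hU hF hη hz).differentiableAt (by simp)).hasFDerivAt
  have h2 := hF.hasDerivAt_totalDx hU (γ := fun s : ℝ => secJet η (z + s • xField η z)) (s := 0)
    (by simpa using hz) (by simpa using hasVelocityAt_secJet hη)
  have h3 := HasDerivAt.unique
    (HasFDerivAt.comp_hasDerivAt (l := fun z => F (secJet η z)) 0 h1 hl) h2
  simpa [redDx] using h3

theorem redDx_iterate_comp_secJet {U : Set Jet} {F : Jet → ℝ} (hU : IsOpen U)
    (hF : IsDiffFun U F) (hη : ∀ᶠ z in 𝓝 z, ContDiffAt ℝ ∞ η z) (hz : secJet η z ∈ U) (k : ℕ) :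
    (redDx η)^[k] (fun z => F (secJet η z)) =ᶠ[𝓝 z] fun z => totalDx^[k] F (secJet η z) := by
  induction k with
  | zero => exact Filter.EventuallyEq.rfl
  | succ k ih =>
    filter_upwards [ih.eventually_nhds, hη, (continuousAt_secJet hη.self_of_nhds).eventually_mem
      (hU.mem_nhds hz)] with z' h1 h2 h3
    rw [Function.iterate_succ_apply', Function.iterate_succ_apply',
      ← redDx_comp_secJet hU (hF.totalDx_iterate hU k) h2 h3, redDx, redDx,
      Filter.EventuallyEq.fderiv_eq h1]

theorem continuous_xPart (m : ℕ) : Continuous (Jet.xPart m) := by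
  unfold Jet.xPart
  fun_prop

theorem isDiffFun_comp_xPart {m : ℕ} {G : Pt m → ℝ} {O : Set (Pt m)}
    (hG : ∀ z ∈ O, ContDiffAt ℝ ∞ G z) :
    IsDiffFun (Jet.xPart m ⁻¹' O) (fun j => G (j.xPart m)) :=
  ⟨Fin m, inferInstance, fun k => (0, (k : ℕ)), G, fun _ hj => ⟨hG _ hj, rfl⟩⟩

theorem dependsOnly_comp_xPart {m : ℕ} (G : Pt m → ℝ) (b : ℕ) :
    DependsOnly {α | α.1 = 0 ∧ α.2 < m + b} (totalDx^[b] fun j => G (j.xPart m)) := by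
  induction b with
  | zero =>
    intro j j' h1 h2 h3
    have : j.xPart m = j'.xPart m := by
      simp only [Jet.xPart, h1, h2, Prod.mk.injEq, true_and]
      exact funext fun k => h3 (0, (k : ℕ)) ⟨rfl, k.2⟩
    simp only [Function.iterate_zero, id, this]
  | succ b ih =>
    rw [Function.iterate_succ_apply']
    refine ih.totalDx (fun α hα => ⟨hα.1, ?_⟩) (fun α hα => ⟨hα.1, ?_⟩)
    · have := hα.2; omega
    · have := hα.2; simp only; omega

theorem dependsOnly_totalDt_iterate {F : Jet → ℝ} (hF : DependsOnly {α | α.1 = 0} F) (a : ℕ) :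
    DependsOnly {α | α.1 ≤ a} (totalDt^[a] F) := by
  induction a with
  | zero => simpa using hF
  | succ a ih =>
    rw [Function.iterate_succ_apply']
    refine ih.totalDt (fun α hα => ?_) (fun α hα => ?_) <;>
    · have : α.1 ≤ a := hα
      simp only [Set.mem_ofPred_eq]
      omega

variable {H : Pt (r + 1) → ℝ} {D : Set (Pt (r + 1))}

theorem totalDx_iterate_canonicalChar (hη : ∀ᶠ z in 𝓝 z, ContDiffAt ℝ ∞ η z) {j : Jet}
    (hj : j.xPart ρ = z) (k : ℕ) :
    totalDx^[k] (canonicalChar η) j =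
      j.2.2 (0, ρ + k) - totalDx^[k] (fun j => η (j.xPart ρ)) j := by
  obtain ⟨O, hO, hOo, hzO⟩ := eventually_nhds_iff.1 hη
  exact totalDx_iterate_coord_sub (hOo.preimage (continuous_xPart ρ)) (isDiffFun_comp_xPart hO)
    (α := (0, ρ)) (fun _ _ => rfl) k j (by simpa [hj] using hzO)

theorem totalDx_iterate_eta_secJet (hη : ∀ᶠ z in 𝓝 z, ContDiffAt ℝ ∞ η z) (k : ℕ) :
    totalDx^[k] (fun j => η (j.xPart ρ)) (secJet η z) = redCoord η (ρ + k) z := by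
  obtain ⟨O, hO, hOo, hzO⟩ := eventually_nhds_iff.1 hη
  have h := (redDx_iterate_comp_secJet (hOo.preimage (continuous_xPart ρ))
    (isDiffFun_comp_xPart hO) hη (by simpa [xPart_secJet, redJet_self] using hzO) k).self_of_nhds
  simp only [xPart_secJet, redJet_self] at h
  rw [← h]
  simp [redCoord]

/-- The differential consequences of `u_ρ = η` determine the `x`-derivatives. -/
theorem forall_totalDx_canonicalChar_iff (hη : ∀ᶠ z in 𝓝 z, ContDiffAt ℝ ∞ η z) {j : Jet}
    (hj : j.xPart ρ = z) :
    (∀ k, totalDx^[k] (canonicalChar η) j = 0) ↔ ∀ i, j.2.2 (0, i) = redCoord η i z := by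
  have hz : j.1 = z.1 ∧ j.2.1 = z.2.1 ∧ ∀ i : Fin ρ, j.2.2 (0, (i : ℕ)) = z.2.2 i := by
    subst hj
    exact ⟨rfl, rfl, fun _ => rfl⟩
  have key : ∀ k, (∀ i < ρ + k, j.2.2 (0, i) = redCoord η i z) →
      totalDx^[k] (canonicalChar η) j = j.2.2 (0, ρ + k) - redCoord η (ρ + k) z := by
    intro k hk
    rw [totalDx_iterate_canonicalChar hη hj, ← totalDx_iterate_eta_secJet hη]
    congr 1
    refine dependsOnly_comp_xPart η k _ _ hz.1 hz.2.1 fun α hα => ?_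
    obtain ⟨a, b⟩ := α
    obtain ⟨rfl, hb⟩ : a = 0 ∧ b < ρ + k := hα
    exact (hk b hb).trans (secJet_xCoord b z).symm
  constructor
  · intro h i
    induction i using Nat.strong_induction_on with
    | _ i ih =>
      by_cases hi : i < ρ
      · rw [hz.2.2 ⟨i, hi⟩]
        exact (redCoord_of_lt η z ⟨i, hi⟩).symm
      · obtain ⟨k, rfl⟩ := Nat.exists_eq_add_of_le (not_lt.1 hi)
        have := key k ih
        rw [h k] at this
        linarith
  · intro h k
    rw [key k fun i _ => h i, h, sub_self]

theorem xPart_eq_redJet {j : Jet} (hj : j.xPart ρ = z) (h : ∀ i, j.2.2 (0, i) = redCoord η i z)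
    (m : ℕ) : j.xPart m = redJet η m z := by
  subst hj
  exact Prod.ext rfl (Prod.ext rfl (funext fun k => h k))

theorem totalDt_iterate_evolE (hD : IsOpen D) (hH : ContDiffOn ℝ ∞ H D) {j : Jet}
    (hj : j.xPart (r + 1) ∈ D) (a b : ℕ) :
    totalDt^[a] (totalDx^[b] (evolE H)) j =
      j.2.2 (a + 1, b) - totalDt^[a] (totalDx^[b] fun j => H (j.xPart (r + 1))) j := by
  have hU := hD.preimage (continuous_xPart (r + 1))
  have hd := isDiffFun_comp_xPart (fun z hz => hH.contDiffAt (hD.mem_nhds hz))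
  have h1 := totalDx_iterate_coord_sub hU hd (α := (1, 0)) (F' := evolE H) (fun _ _ => rfl) b
  have h2 := totalDt_iterate_coord_sub hU (hd.totalDx_iterate hU b) h1 a j hj
  rw [h2]
  simp only [zero_add, add_comm 1 a]

theorem totalDx_iterate_H_eq (hD : IsOpen D) (hH : ContDiffOn ℝ ∞ H D)
    (hη : ∀ᶠ z in 𝓝 z, ContDiffAt ℝ ∞ η z) (hz : redJet η (r + 1) z ∈ D) {j : Jet}
    (hj : j.xPart ρ = z) (h : ∀ i, j.2.2 (0, i) = redCoord η i z) (b : ℕ) :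
    totalDx^[b] (fun j => H (j.xPart (r + 1))) j = (redDx η)^[b] (redH H η) z := by
  have h1 := (redDx_iterate_comp_secJet (hD.preimage (continuous_xPart (r + 1)))
    (isDiffFun_comp_xPart (fun z hz => hH.contDiffAt (hD.mem_nhds hz))) hη
    (by simpa [xPart_secJet] using hz) b).self_of_nhds
  simp only [xPart_secJet] at h1
  refine Eq.trans ?_ h1.symm
  subst hj
  refine dependsOnly_comp_xPart H b _ _ rfl rfl fun α hα => ?_
  obtain ⟨a, i⟩ := α
  obtain ⟨rfl, -⟩ : a = 0 ∧ i < r + 1 + b := hα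
  exact (h i).trans (secJet_xCoord i _).symm

/-- Every point `z` at which `H` is defined on the invariance surface lies under a jet satisfying
all differential consequences: the coordinates with `a + 1` differentiations in `t` are
determined by those with at most `a`. -/
theorem exists_mem_consequences (hD : IsOpen D) (hH : ContDiffOn ℝ ∞ H D)
    (hη : ∀ᶠ z in 𝓝 z, ContDiffAt ℝ ∞ η z) (hz : redJet η (r + 1) z ∈ D) :
    ∃ j ∈ consequences (evolE H) (canonicalChar η), j.xPart ρ = z ∧ j.xPart (r + 1) ∈ D := by
  let K : Jet → ℝ := fun j => H (j.xPart (r + 1))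
  let J : ℕ → Jet := fun a => Nat.rec (secJet η z) (fun a j => (j.1, j.2.1, fun α =>
    if α.1 = a + 1 then totalDt^[a] (totalDx^[α.2] K) j else j.2.2 α)) a
  have hJ : ∀ a α, (J (a + 1)).2.2 α =
    if α.1 = a + 1 then totalDt^[a] (totalDx^[α.2] K) (J a) else (J a).2.2 α := fun _ _ => rfl
  have hJ1 : ∀ a, (J a).1 = z.1 ∧ (J a).2.1 = z.2.1 := by
    intro a
    induction a with
    | zero => exact ⟨rfl, rfl⟩
    | succ a ih => exact ih
  let j : Jet := (z.1, z.2.1, fun α => (J α.1).2.2 α)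
  have hstab : ∀ a α, α.1 ≤ a → (J a).2.2 α = j.2.2 α := by
    intro a α hα
    induction a, hα using Nat.le_induction with
    | base => rfl
    | succ a ha ih => rw [hJ, if_neg (by omega), ih]
  have hx : ∀ i, j.2.2 (0, i) = redCoord η i z := fun i => by
    have : j.2.2 (0, i) = (secJet η z).2.2 (0, i) := rfl
    simpa [secJet] using this
  have hjz : j.xPart ρ = z := by
    simp only [Jet.xPart, hx, redCoord_of_lt]
    rfl
  have hjD : j.xPart (r + 1) ∈ D := by rwa [xPart_eq_redJet hjz hx]
  refine ⟨j, ⟨fun a b => ?_, (forall_totalDx_canonicalChar_iff hη hjz).2 hx⟩, hjz, hjD⟩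
  rw [totalDt_iterate_evolE hD hH hjD, sub_eq_zero]
  have h1 : j.2.2 (a + 1, b) = totalDt^[a] (totalDx^[b] K) (J a) := by
    rw [← hstab (a + 1) (a + 1, b) le_rfl, hJ, if_pos rfl]
  have hdep : DependsOnly {α | α.1 = 0} (totalDx^[b] K) := fun j j' e1 e2 e3 =>
    dependsOnly_comp_xPart H b j j' e1 e2 fun α hα => e3 α hα.1
  rw [h1]
  exact dependsOnly_totalDt_iterate hdep a _ _ (hJ1 a).1 (hJ1 a).2 fun α hα => hstab a α hα

/-- Only the term with `∂_{u_t}` contributes to `Q_{(r)} E` where all `D_x^k (u_ρ - η)` vanish,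
since `u_t` is the only coordinate with differentiations in `t` on which `E` depends. -/
theorem prolong_eq_totalDt (hr : 1 ≤ r) {j : Jet}
    (hj : ∀ k, totalDx^[k] (canonicalChar η) j = 0) :
    prolong r (canonicalChar η) (evolE H) j = totalDt (canonicalChar η) j := by
  have hxp : ∀ (α : ℕ × ℕ) (s : ℝ), α.1 ≠ 0 →
      Jet.xPart (r + 1) (j.1, j.2.1, Function.update j.2.2 α s) = j.xPart (r + 1) := by
    intro α s hα
    simp only [Jet.xPart, Prod.mk.injEq, true_and]
    funext k
    rw [Function.update_of_ne]
    rintro rfl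
    exact hα rfl
  unfold prolong
  rw [Finset.sum_eq_single (1, 0)]
  · have : partialU (1, 0) (evolE H) j = 1 := by
      have h1 : (fun s : ℝ => evolE H (j.1, j.2.1, Function.update j.2.2 (1, 0) s)) =
          fun s => s - H (j.xPart (r + 1)) := by
        funext s
        simp only [evolE, hxp (1, 0) s one_ne_zero, Function.update_self]
      rw [partialU, h1]
      simp
    simp [this]
  · rintro ⟨a, b⟩ - hab
    by_cases ha : a = 0
    · subst ha
      simp [hj b]
    · have : partialU (a, b) (evolE H) j = 0 := by
        have h1 : (fun s : ℝ => evolE H (j.1, j.2.1, Function.update j.2.2 (a, b) s)) =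
            fun _ => evolE H j := by
          funext s
          simp only [evolE, hxp (a, b) s ha, Function.update_of_ne (Ne.symm hab)]
        rw [partialU, h1, deriv_const]
      rw [this, mul_zero]
  · intro h
    exact absurd (by simp; omega) h

theorem totalDt_canonicalChar (hη : DifferentiableAt ℝ η z) {j : Jet} (hj : j.xPart ρ = z) :
    totalDt (canonicalChar η) j =
      j.2.2 (1, ρ) - fderiv ℝ η z (1, 0, fun i => j.2.2 (1, (i : ℕ))) := by
  have hv := hasVelocityAt_lineT j
  have h1 : HasDerivAt (fun s => (lineT j s).xPart ρ) (1, 0, fun i => j.2.2 (1, (i : ℕ))) 0 :=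
    hv.1.prodMk (hv.2.1.prodMk (hasDerivAt_pi.2 fun i => hv.2.2 (0, (i : ℕ))))
  have h2 : HasFDerivAt η (fderiv ℝ η z) ((lineT j 0).xPart ρ) := by
    rw [lineT_zero, hj]
    exact hη.hasFDerivAt
  exact ((hv.2.2 (0, ρ)).sub (h2.comp_hasDerivAt 0 h1)).deriv

/-- On the jets satisfying all differential consequences, `Q_{(r)} E` is the difference between
the two expressions for `u_{tρ}` obtained from `u_t = H` and `u_ρ = η`. -/
theorem prolong_of_mem_consequences (hr : 1 ≤ r) (hD : IsOpen D) (hH : ContDiffOn ℝ ∞ H D)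
    (hη : ∀ᶠ z in 𝓝 z, ContDiffAt ℝ ∞ η z) {j : Jet}
    (hj : j ∈ consequences (evolE H) (canonicalChar η)) (hjz : j.xPart ρ = z)
    (hjD : j.xPart (r + 1) ∈ D) :
    prolong r (canonicalChar η) (evolE H) j =
      (redDx η)^[ρ] (redH H η) z - fderiv ℝ η z (tField H η z) := by
  have hx := (forall_totalDx_canonicalChar_iff hη hjz).1 hj.2
  have ht : ∀ b, j.2.2 (1, b) = (redDx η)^[b] (redH H η) z := by
    intro b
    have h1 := hj.1 0 b
    rw [totalDt_iterate_evolE hD hH hjD, sub_eq_zero] at h1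
    rw [h1]
    exact totalDx_iterate_H_eq hD hH hη (by rwa [← xPart_eq_redJet hjz hx]) hjz hx b
  rw [prolong_eq_totalDt hr hj.2, totalDt_canonicalChar
    (hη.self_of_nhds.differentiableAt (by simp)) hjz]
  simp only [ht]
  rfl

/-- Conditional symmetry is the compatibility of `u_ρ = η` and `u_t = H`, expressed through the
restricted total derivatives. -/
theorem isCondSymmetryAt_iff (hr : 1 ≤ r) (hD : IsOpen D) (hH : ContDiffOn ℝ ∞ H D)
    {z₀ : Pt ρ} : IsCondSymmetryAt H D η z₀ ↔
      (∀ᶠ z in 𝓝 z₀, ContDiffAt ℝ ∞ η z) ∧ redJet η (r + 1) z₀ ∈ D ∧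
        ∀ᶠ z in 𝓝 z₀, (redDx η)^[ρ] (redH H η) z = fderiv ℝ η z (tField H η z) := by
  constructor
  · rintro ⟨h1, ⟨j, hj, hjz, hjD⟩, h3⟩
    have hz : redJet η (r + 1) z₀ ∈ D := by
      rwa [← xPart_eq_redJet hjz ((forall_totalDx_canonicalChar_iff h1 hjz).1 hj.2)]
    refine ⟨h1, hz, ?_⟩
    filter_upwards [h1.eventually_nhds, eventually_redJet_mem hD h1.self_of_nhds hz, h3]
      with z e1 e2 e3
    obtain ⟨j, hj, hjz, hjD⟩ := exists_mem_consequences hD hH e1 e2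
    rw [← sub_eq_zero, ← prolong_of_mem_consequences hr hD hH e1 hj hjz hjD]
    exact e3 j hj hjz hjD
  · rintro ⟨h1, h2, h3⟩
    refine ⟨h1, exists_mem_consequences hD hH h1 h2, ?_⟩
    filter_upwards [h1.eventually_nhds, h3] with z e1 e3 j hj hjz hjD
    rw [prolong_of_mem_consequences hr hD hH e1 hj hjz hjD, e3, sub_self]

end Section

/-! ### Families of invariant solutions -/

section Families

variable {r ρ m : ℕ}

/-- `∂^k f / ∂x^k` as a function of `(t, x, ϰ)`. -/
def famX (f : Pt ρ → ℝ) (k : ℕ) (z : Pt ρ) : ℝ := xDeriv k (member f z.2.2) (z.1, z.2.1)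

/-- `(t, x, f, f_x, …, ∂^{m-1}f/∂x^{m-1})` as a function of `(t, x, ϰ)`. -/
def famJet (m : ℕ) (f : Pt ρ → ℝ) (z : Pt ρ) : Pt m := xJet m (member f z.2.2) (z.1, z.2.1)

theorem tendsto_member (z : Pt ρ) :
    Filter.Tendsto (fun q : ℝ × ℝ => ((q.1, q.2, z.2.2) : Pt ρ)) (𝓝 (z.1, z.2.1)) (𝓝 z) :=
  (by fun_prop : Continuous fun q : ℝ × ℝ => ((q.1, q.2, z.2.2) : Pt ρ)).continuousAt

theorem contDiffAt_member {f : Pt ρ → ℝ} {z : Pt ρ} (hf : ContDiffAt ℝ ∞ f z) :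
    ContDiffAt ℝ ∞ (member f z.2.2) (z.1, z.2.1) :=
  ContDiffAt.comp (g := f) (f := fun q : ℝ × ℝ => ((q.1, q.2, z.2.2) : Pt ρ)) (z.1, z.2.1) hf
    (contDiffAt_fst.prodMk (contDiffAt_snd.prodMk contDiffAt_const))

theorem contDiffAt_famX {f : Pt ρ → ℝ} {z : Pt ρ} (hf : ContDiffAt ℝ ∞ f z) (k : ℕ) :
    ContDiffAt ℝ ∞ (famX f k) z := by
  induction k with
  | zero =>
    have : famX f 0 = f := by
      funext z
      simp [famX, xDeriv_zero, member]
    rwa [this]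
  | succ k ih =>
    refine (contDiffAt_fderiv_apply ih (0, 1, 0)).congr_of_eventuallyEq ?_
    filter_upwards [eventually_differentiableAt ih] with z hz
    have h1 : HasDerivAt (fun y : ℝ => ((z.1, y, z.2.2) : Pt ρ)) (0, 1, 0) z.2.1 :=
      (hasDerivAt_const _ _).prodMk ((hasDerivAt_id _).prodMk (hasDerivAt_const _ _))
    rw [famX, xDeriv_succ]
    exact (hz.hasFDerivAt.comp_hasDerivAt z.2.1 h1).deriv

theorem contDiffAt_famJet {f : Pt ρ → ℝ} {z : Pt ρ} (hf : ContDiffAt ℝ ∞ f z) (m : ℕ) :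
    ContDiffAt ℝ ∞ (famJet m f) z :=
  contDiffAt_fst.prodMk (contDiffAt_snd.fst.prodMk
    (contDiffAt_pi.2 fun k => contDiffAt_famX hf k))

theorem fderiv_famJet {f : Pt ρ → ℝ} {z : Pt ρ} (hf : ContDiffAt ℝ ∞ f z) (m : ℕ) (v : Pt ρ) :
    fderiv ℝ (famJet m f) z v = (v.1, v.2.1, fun k : Fin m => fderiv ℝ (famX f k) z v) := by
  have h : HasFDerivAt (famJet m f) _ z := hasFDerivAt_fst.prodMk
    (((ContinuousLinearMap.fst ℝ ℝ (Fin ρ → ℝ)).comp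
      (ContinuousLinearMap.snd ℝ ℝ (ℝ × (Fin ρ → ℝ)))).hasFDerivAt.prodMk
    (hasFDerivAt_pi.2 fun k : Fin m =>
      ((contDiffAt_famX hf k).differentiableAt (by simp)).hasFDerivAt))
  rw [h.fderiv]
  rfl

theorem paramJacobian_mulVec {f : Pt ρ → ℝ} {z : Pt ρ} (hf : ContDiffAt ℝ ∞ f z)
    (w : Fin ρ → ℝ) :
    (paramJacobian f z).mulVec w = fun a : Fin ρ => fderiv ℝ (famX f a) z (0, 0, w) := by
  funext a
  have h1 : ∀ b, paramJacobian f z a b = fderiv ℝ (famX f a) z (0, 0, Pi.single b 1) := by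
    intro b
    have h2 : HasDerivAt (fun s : ℝ => ((z.1, z.2.1, Function.update z.2.2 b s) : Pt ρ))
        (0, 0, Pi.single b 1) (z.2.2 b) :=
      (hasDerivAt_const _ _).prodMk ((hasDerivAt_const _ _).prodMk (hasDerivAt_update _ _ _))
    have h3 : HasFDerivAt (famX f a) (fderiv ℝ (famX f a) z)
        (z.1, z.2.1, Function.update z.2.2 b (z.2.2 b)) := by
      rw [Function.update_eq_self]
      exact ((contDiffAt_famX hf a).differentiableAt (by simp)).hasFDerivAt
    exact (HasFDerivAt.comp_hasDerivAt (z.2.2 b) h3 h2).deriv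
  have h4 : (0, 0, w) = ∑ b, w b • ((0, 0, Pi.single b 1) : Pt ρ) := by
    refine Prod.ext ?_ (Prod.ext ?_ ?_)
    · simp [Prod.fst_sum]
    · simp [Prod.fst_sum, Prod.snd_sum]
    · simp only [Prod.snd_sum, Prod.smul_snd]
      funext i
      simp [Finset.sum_apply, Pi.single_apply]
  rw [h4, map_sum]
  simp only [Matrix.mulVec, dotProduct, h1, map_smul, smul_eq_mul, mul_comm]

variable {H : Pt (r + 1) → ℝ} {D : Set (Pt (r + 1))}

/-- `f` is at `z = (t, x, ϰ)` a smooth family of `Q`-invariant solutions. -/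
def IsInvariantFamilyAt (H : Pt (r + 1) → ℝ) (D : Set (Pt (r + 1))) (η : Pt m → ℝ)
    (f : Pt ρ → ℝ) (z : Pt ρ) : Prop :=
  ContDiffAt ℝ ∞ f z ∧ SolvesAt H D (member f z.2.2) (z.1, z.2.1) ∧
    InvariantAt η (member f z.2.2) (z.1, z.2.1)

theorem isInvariantSolutionNear_member {η : Pt m → ℝ} {f : Pt ρ → ℝ} {z : Pt ρ}
    (h : ∀ᶠ z in 𝓝 z, IsInvariantFamilyAt H D η f z) :
    IsInvariantSolutionNear H D η (member f z.2.2) (z.1, z.2.1) := by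
  filter_upwards [(tendsto_member z).eventually h] with q hq
  exact ⟨contDiffAt_member hq.1, hq.2⟩

/-- Two families of invariant solutions, with parameters related so that the members have the same
derivatives of orders `0, …, m-1` at `(t₀, x₀)`, agree near the base point: the jets of the members
are integral surfaces of the same fields. -/
theorem eventually_member_eq (hD : IsOpen D) (hH : ContDiffOn ℝ ∞ H D) {ρ' : ℕ} {η : Pt m → ℝ}
    {f : Pt ρ → ℝ} {f' : Pt ρ' → ℝ} {σ : (Fin ρ → ℝ) → (Fin ρ' → ℝ)} {t₀ x₀ : ℝ}
    {ϰ₀ : Fin ρ → ℝ} (hf : ∀ᶠ z in 𝓝 ((t₀, x₀, ϰ₀) : Pt ρ), IsInvariantFamilyAt H D η f z)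
    (hf' : ∀ᶠ z in 𝓝 ((t₀, x₀, σ ϰ₀) : Pt ρ'), IsInvariantFamilyAt H D η f' z)
    (hη : ∀ᶠ z in 𝓝 (famJet m f (t₀, x₀, ϰ₀)), ContDiffAt ℝ ∞ η z)
    (hσ : ContinuousAt σ ϰ₀)
    (hσf : ∀ᶠ ϰ in 𝓝 ϰ₀, famJet m f (t₀, x₀, ϰ) = famJet m f' (t₀, x₀, σ ϰ)) :
    ∀ᶠ z : Pt ρ in 𝓝 (t₀, x₀, ϰ₀), f z = f' (z.1, z.2.1, σ z.2.2) := by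
  set z₀ := famJet m f (t₀, x₀, ϰ₀) with hz₀
  have hz₀' : z₀ = famJet m f' (t₀, x₀, σ ϰ₀) := hσf.self_of_nhds
  have hη₀ := hη.self_of_nhds
  have hzD : redJet η (r + 1) z₀ ∈ D := redJet_xJet_mem (isInvariantSolutionNear_member hf) hη₀
  obtain ⟨K₁, U₁, hU₁, hK₁⟩ := ((contDiffAt_tField hD hH hη₀ hzD).of_le
    (by simp : (1 : WithTop ℕ∞) ≤ ∞)).exists_lipschitzOnWith
  obtain ⟨K₂, U₂, hU₂, hK₂⟩ := ((contDiffAt_xField hη₀).of_le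
    (by simp : (1 : WithTop ℕ∞) ≤ ∞)).exists_lipschitzOnWith
  have hT := (hK₁.mono (Set.inter_subset_left (t := U₂))).weaken (le_max_left K₁ K₂)
  have hX := (hK₂.mono (Set.inter_subset_right (s := U₁))).weaken (le_max_right K₁ K₂)
  have hU := Filter.inter_mem hU₁ hU₂
  have key : ∀ {ρ : ℕ} {f : Pt ρ → ℝ} {ϰ₀ : Fin ρ → ℝ},
      (∀ᶠ z in 𝓝 ((t₀, x₀, ϰ₀) : Pt ρ), IsInvariantFamilyAt H D η f z) →
      z₀ = famJet m f (t₀, x₀, ϰ₀) →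
      ∀ᶠ z in 𝓝 ((t₀, x₀, ϰ₀) : Pt ρ),
        (IsIntegralSurfaceAt (tField H η) (xField η) (xJet m (member f z.2.2)) (z.1, z.2.1) ∧
          famJet m f z ∈ U₁ ∩ U₂) ∧ f z = redCoord η 0 (famJet m f z) := by
    intro ρ f ϰ₀ hf hz
    have hc : Filter.Tendsto (famJet m f) (𝓝 (t₀, x₀, ϰ₀)) (𝓝 z₀) := by
      rw [hz]
      exact (contDiffAt_famJet hf.self_of_nhds.1 m).continuousAt
    filter_upwards [hf.eventually_nhds, hc.eventually hη, hc.eventually_mem hU] with z h1 h2 h3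
    have h4 := isInvariantSolutionNear_member h1
    refine ⟨⟨isIntegralSurfaceAt_xJet hD hH h4 h2, h3⟩, ?_⟩
    have h5 := (xDeriv_eventuallyEq_redCoord (h4.mono fun _ h => ⟨h.1, h.2.2⟩) h2 0).self_of_nhds
    rw [xDeriv_zero] at h5
    exact h5
  have hlim : Filter.Tendsto (fun z : Pt ρ => ((z.1, z.2.1, σ z.2.2) : Pt ρ'))
      (𝓝 (t₀, x₀, ϰ₀)) (𝓝 (t₀, x₀, σ ϰ₀)) := by
    have : ContinuousAt (fun z : Pt ρ => σ z.2.2) (t₀, x₀, ϰ₀) :=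
      ContinuousAt.comp' (g := σ) hσ (by fun_prop)
    exact continuousAt_fst.prodMk (continuous_snd.fst.continuousAt.prodMk this)
  have hlim' : Filter.Tendsto (fun z : Pt ρ => z.2.2) (𝓝 (t₀, x₀, ϰ₀)) (𝓝 ϰ₀) :=
    (by fun_prop : Continuous fun z : Pt ρ => z.2.2).continuousAt
  obtain ⟨δ, hδ, hball⟩ := Metric.eventually_nhds_iff_ball.1
    ((key hf hz₀).and ((hlim.eventually (key hf' hz₀')).and (hlim'.eventually hσf)))
  filter_upwards [Metric.ball_mem_nhds ((t₀, x₀, ϰ₀) : Pt ρ) hδ] with z hz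
  have hmem : ∀ q ∈ Metric.ball (t₀, x₀) δ,
      ((q.1, q.2, z.2.2) : Pt ρ) ∈ Metric.ball ((t₀, x₀, ϰ₀) : Pt ρ) δ := by
    intro q hq
    simp only [Metric.mem_ball, Prod.dist_eq, max_lt_iff] at hz hq ⊢
    exact ⟨hq.1, hq.2, hz.2.2⟩
  have hzq : (z.1, z.2.1) ∈ Metric.ball (t₀, x₀) δ := by
    simp only [Metric.mem_ball, Prod.dist_eq, max_lt_iff] at hz ⊢
    exact ⟨hz.1, hz.2.1⟩
  have heq := eqOn_of_isIntegralSurfaceAt hT hX (convex_ball (t₀, x₀) δ)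
    (y := xJet m (member f z.2.2)) (y' := xJet m (member f' (σ z.2.2)))
    (fun q hq => (hball _ (hmem q hq)).1.1) (fun q hq => (hball _ (hmem q hq)).2.1.1)
    (Metric.mem_ball_self hδ) (hball _ (hmem _ (Metric.mem_ball_self hδ))).2.2 _ hzq
  rw [(hball _ hz).1.2, (hball _ hz).2.1.2]
  exact congrArg _ heq

/-- Local uniqueness of invariant solutions. -/
theorem eventuallyEq_of_xJet_eq (hD : IsOpen D) (hH : ContDiffOn ℝ ∞ H D) {η : Pt m → ℝ}
    {u u' : ℝ × ℝ → ℝ} {q : ℝ × ℝ} (hu : IsInvariantSolutionNear H D η u q)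
    (hu' : IsInvariantSolutionNear H D η u' q) (h : xJet m u q = xJet m u' q)
    (hη : ∀ᶠ z in 𝓝 (xJet m u q), ContDiffAt ℝ ∞ η z) : u =ᶠ[𝓝 q] u' := by
  -- A single solution is a family without parameters.
  have hfam : ∀ {u : ℝ × ℝ → ℝ}, IsInvariantSolutionNear H D η u q →
      ∀ᶠ z in 𝓝 ((q.1, q.2, 0) : Pt 0),
        IsInvariantFamilyAt H D η (fun z : Pt 0 => u (z.1, z.2.1)) z := by
    intro u hu
    have hc : Filter.Tendsto (fun z : Pt 0 => (z.1, z.2.1)) (𝓝 (q.1, q.2, 0)) (𝓝 q) :=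
      (by fun_prop : Continuous fun z : Pt 0 => (z.1, z.2.1)).continuousAt
    filter_upwards [hc.eventually hu] with z hz
    exact ⟨hz.1.comp z (contDiffAt_fst.prodMk contDiffAt_snd.fst), hz.2⟩
  have h1 := eventually_member_eq hD hH (σ := id) (hfam hu) (hfam hu') hη continuousAt_id
    (Filter.Eventually.of_forall fun ϰ => h)
  have hc : Filter.Tendsto (fun q : ℝ × ℝ => ((q.1, q.2, 0) : Pt 0)) (𝓝 q) (𝓝 (q.1, q.2, 0)) :=
    (by fun_prop : Continuous fun q : ℝ × ℝ => ((q.1, q.2, 0) : Pt 0)).continuousAt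
  exact hc.eventually h1

end Families

/-! ### The conditional symmetry of a family of solutions -/

namespace SolutionFamily

variable {r ρ : ℕ} {H : Pt (r + 1) → ℝ} {D : Set (Pt (r + 1))} {z₀ : Pt ρ}

/-- The base point `(t₀, x₀, ϰ₀)`. -/
def base (F : SolutionFamily H D z₀) : Pt ρ := (z₀.1, z₀.2.1, F.ϰ₀)

theorem eventually_solution (F : SolutionFamily H D z₀) : ∀ᶠ z in 𝓝 F.base,
    ContDiffAt ℝ ∞ F.f z ∧ SolvesAt H D (member F.f z.2.2) (z.1, z.2.1) := by
  obtain ⟨W, hW, h⟩ := F.isFamily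
  exact Filter.mem_of_superset hW h

theorem famJet_base (F : SolutionFamily H D z₀) : famJet ρ F.f F.base = z₀ := F.through

theorem eq_zero_of_fderiv_famX (F : SolutionFamily H D z₀) {w : Fin ρ → ℝ}
    (hw : ∀ a : Fin ρ, fderiv ℝ (famX F.f a) F.base (0, 0, w) = 0) : w = 0 :=
  Matrix.eq_zero_of_mulVec_eq_zero F.regular (by
    change (paramJacobian F.f F.base).mulVec w = 0
    rw [paramJacobian_mulVec F.eventually_solution.self_of_nhds.1]
    exact funext hw)

/-- The map `(t, x, ϰ) ↦ (t, x, f₀, …, f_{ρ-1})` is a local diffeomorphism. -/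
theorem exists_chart (F : SolutionFamily H D z₀) : ∃ e : OpenPartialHomeomorph (Pt ρ) (Pt ρ),
    F.base ∈ e.source ∧ ⇑e = famJet ρ F.f ∧ (∀ z ∈ e.source, ContDiffAt ℝ ∞ (famJet ρ F.f) z) ∧
      ∀ w ∈ e.target, ContDiffAt ℝ ∞ e.symm w := by
  have hs := F.eventually_solution
  have h0 := hs.self_of_nhds.1
  have hinj : Function.Injective (fderiv ℝ (famJet ρ F.f) F.base).toLinearMap := by
    rw [← LinearMap.ker_eq_bot, LinearMap.ker_eq_bot']
    rintro ⟨a, b, w⟩ h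
    rw [ContinuousLinearMap.coe_coe, fderiv_famJet h0] at h
    simp only [Prod.mk_eq_zero] at h
    obtain ⟨rfl, rfl, h⟩ := h
    rw [F.eq_zero_of_fderiv_famX fun a => congrFun h a]
    rfl
  refine exists_smooth_localDiffeo
    (LinearEquiv.ofInjectiveEndo _ hinj).toContinuousLinearEquiv
    (hs.mono fun z hz => contDiffAt_famJet hz.1 ρ) ?_
  exact ((contDiffAt_famJet h0 ρ).differentiableAt (by simp)).hasFDerivAt.congr_fderiv
    (ContinuousLinearMap.ext fun _ => rfl)

/-- The local coordinates `(t, x, f₀, …, f_{ρ-1})` on the space of `(t, x, ϰ)`. -/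
def chart (F : SolutionFamily H D z₀) : OpenPartialHomeomorph (Pt ρ) (Pt ρ) := F.exists_chart.choose

theorem base_mem_source (F : SolutionFamily H D z₀) : F.base ∈ F.chart.source :=
  F.exists_chart.choose_spec.1

theorem coe_chart (F : SolutionFamily H D z₀) : ⇑F.chart = famJet ρ F.f :=
  F.exists_chart.choose_spec.2.1

theorem contDiffAt_chart_symm (F : SolutionFamily H D z₀) {w : Pt ρ} (hw : w ∈ F.chart.target) :
    ContDiffAt ℝ ∞ F.chart.symm w :=
  F.exists_chart.choose_spec.2.2.2 w hw

theorem chart_base (F : SolutionFamily H D z₀) : F.chart F.base = z₀ := by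
  rw [coe_chart, famJet_base]

theorem mem_target (F : SolutionFamily H D z₀) : z₀ ∈ F.chart.target := by
  have := F.chart.map_source F.base_mem_source
  rwa [chart_base] at this

theorem tendsto_chart (F : SolutionFamily H D z₀) :
    Filter.Tendsto (famJet ρ F.f) (𝓝 F.base) (𝓝 z₀) := by
  have := F.chart.continuousAt F.base_mem_source
  rwa [ContinuousAt, chart_base, coe_chart] at this

theorem tendsto_chart_symm (F : SolutionFamily H D z₀) :
    Filter.Tendsto F.chart.symm (𝓝 z₀) (𝓝 F.base) := by
  have := F.chart.continuousAt_symm F.mem_target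
  have h : F.chart.symm z₀ = F.base := by
    have := F.chart.left_inv F.base_mem_source
    rwa [chart_base] at this
  rwa [ContinuousAt, h] at this

theorem eventually_famJet_symm (F : SolutionFamily H D z₀) :
    ∀ᶠ z in 𝓝 z₀, famJet ρ F.f (F.chart.symm z) = z := by
  filter_upwards [F.chart.open_target.mem_nhds F.mem_target] with z hz
  rw [← coe_chart, F.chart.right_inv hz]

/-- The function `η` expressing `f_ρ` by `(t, x, f₀, …, f_{ρ-1})`. -/
def eta (F : SolutionFamily H D z₀) (z : Pt ρ) : ℝ := famX F.f ρ (F.chart.symm z)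

theorem eventually_contDiffAt_eta (F : SolutionFamily H D z₀) :
    ∀ᶠ z in 𝓝 z₀, ContDiffAt ℝ ∞ F.eta z := by
  filter_upwards [F.chart.open_target.mem_nhds F.mem_target,
    F.tendsto_chart_symm.eventually F.eventually_solution] with z h1 h2
  exact (contDiffAt_famX h2.1 ρ).comp z (F.contDiffAt_chart_symm h1)

/-- The members of `F` are invariant with respect to `(u_ρ - η) ∂_u` exactly if `η` has the germ
of `F.eta`. -/
theorem invariant_iff (F : SolutionFamily H D z₀) {η : Pt ρ → ℝ} :
    (∀ᶠ z in 𝓝 F.base, InvariantAt η (member F.f z.2.2) (z.1, z.2.1)) ↔ F.eta =ᶠ[𝓝 z₀] η := by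
  constructor
  · intro h
    filter_upwards [F.tendsto_chart_symm.eventually h, F.eventually_famJet_symm] with z h1 h2
    have h3 : famX F.f ρ (F.chart.symm z) = η (famJet ρ F.f (F.chart.symm z)) := h1
    rw [eta, h3, h2]
  · intro h
    filter_upwards [F.tendsto_chart.eventually h,
      F.chart.open_source.mem_nhds F.base_mem_source] with z h1 h2
    have h3 : famX F.f ρ z = η (famJet ρ F.f z) := by
      rw [← h1, eta, ← coe_chart, F.chart.left_inv h2]
    exact h3

theorem eventually_isInvariantFamilyAt (F : SolutionFamily H D z₀) {η : Pt ρ → ℝ}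
    (h : F.eta =ᶠ[𝓝 z₀] η) : ∀ᶠ z in 𝓝 F.base, IsInvariantFamilyAt H D η F.f z := by
  filter_upwards [F.eventually_solution, F.invariant_iff.2 h] with z h1 h2
  exact ⟨h1.1, h1.2, h2⟩

theorem isCondSymmetryAt_eta (hr : 1 ≤ r) (hD : IsOpen D) (hH : ContDiffOn ℝ ∞ H D)
    (F : SolutionFamily H D z₀) : IsCondSymmetryAt H D F.eta z₀ := by
  have hη := F.eventually_contDiffAt_eta
  have hinv := F.eventually_isInvariantFamilyAt (Filter.EventuallyEq.refl _ _)
  refine (isCondSymmetryAt_iff hr hD hH).2 ⟨hη, ?_, ?_⟩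
  · have h := redJet_xJet_mem (isInvariantSolutionNear_member hinv)
      (by rw [show xJet ρ _ _ = z₀ from F.famJet_base]; exact hη.self_of_nhds)
    rwa [show xJet ρ _ _ = z₀ from F.famJet_base] at h
  · filter_upwards [F.tendsto_chart_symm.eventually hinv.eventually_nhds,
      F.eventually_famJet_symm, hη] with z h1 h2 h3
    have h4 := redDx_iterate_redH_eq hD hH (isInvariantSolutionNear_member h1)
      (by rw [show xJet ρ _ _ = z from h2]; exact h3)
    rwa [show xJet ρ _ _ = z from h2] at h4

/-- Completeness of the family comes for free: an invariant solution near `z₀` has the same jet at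
one point as the member with parameter given by the chart, and local uniqueness applies. -/
theorem isFamilyOfInvariantSolutions_iff (hD : IsOpen D) (hH : ContDiffOn ℝ ∞ H D)
    (F : SolutionFamily H D z₀) {η : Pt ρ → ℝ} :
    IsFamilyOfInvariantSolutions η F ↔ F.eta =ᶠ[𝓝 z₀] η := by
  refine ⟨fun h => F.invariant_iff.1 h.invariant, fun h => ⟨F.invariant_iff.2 h, ?_⟩⟩
  have hη : ∀ᶠ z in 𝓝 z₀, ContDiffAt ℝ ∞ η z := by
    filter_upwards [F.eventually_contDiffAt_eta, h.eventually_nhds] with z h1 h2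
    exact h1.congr_of_eventuallyEq (Filter.EventuallyEq.symm h2)
  -- Inside a product neighbourhood of the base point, the chart is injective.
  obtain ⟨V, hV, W₀, hW₀, hVW⟩ : ∃ V ∈ 𝓝 (z₀.1, z₀.2.1), ∃ W₀ ∈ 𝓝 F.ϰ₀,
      ∀ q ∈ V, ∀ ϰ ∈ W₀, ((q.1, q.2, ϰ) : Pt ρ) ∈ F.chart.source := by
    have hc : Filter.Tendsto (fun p : (ℝ × ℝ) × (Fin ρ → ℝ) => ((p.1.1, p.1.2, p.2) : Pt ρ))
        (𝓝 ((z₀.1, z₀.2.1), F.ϰ₀)) (𝓝 F.base) :=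
      (by fun_prop : Continuous fun p : (ℝ × ℝ) × (Fin ρ → ℝ) =>
        ((p.1.1, p.1.2, p.2) : Pt ρ)).continuousAt
    have := hc.eventually_mem (F.chart.open_source.mem_nhds F.base_mem_source)
    rw [nhds_prod_eq, Filter.eventually_prod_iff] at this
    obtain ⟨p, hp, p', hp', h⟩ := this
    exact ⟨{q | p q}, hp, {ϰ | p' ϰ}, hp', fun q hq ϰ hϰ => h hq hϰ⟩
  refine ⟨W₀, hW₀, fun W hW hWW₀ => ?_⟩
  have hq : Filter.Tendsto (fun z : Pt ρ => (z.1, z.2.1)) (𝓝 z₀) (𝓝 (z₀.1, z₀.2.1)) :=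
    (by fun_prop : Continuous fun z : Pt ρ => (z.1, z.2.1)).continuousAt
  have hϰ : Filter.Tendsto (fun z : Pt ρ => (F.chart.symm z).2.2) (𝓝 z₀) (𝓝 F.ϰ₀) :=
    ((by fun_prop : Continuous fun z : Pt ρ => z.2.2).tendsto F.base).comp F.tendsto_chart_symm
  filter_upwards [hq.eventually_mem hV, hϰ.eventually_mem hW, F.eventually_famJet_symm,
    hη.eventually_nhds, F.tendsto_chart_symm.eventually
      (F.eventually_isInvariantFamilyAt h).eventually_nhds] with z h1 h2 h3 h4 h5 u hu hus
  have hsymm : F.chart.symm z = (z.1, z.2.1, (F.chart.symm z).2.2) := by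
    have e1 : (famJet ρ F.f (F.chart.symm z)).1 = z.1 := by rw [h3]
    have e2 : (famJet ρ F.f (F.chart.symm z)).2.1 = z.2.1 := by rw [h3]
    exact Prod.ext e1 (Prod.ext e2 rfl)
  have hjet : xJet ρ (member F.f (F.chart.symm z).2.2) (z.1, z.2.1) = z := by
    rw [hsymm] at h3
    exact h3
  have hmem := isInvariantSolutionNear_member h5
  rw [hsymm] at hmem
  refine ⟨(F.chart.symm z).2.2, ⟨h2, ?_⟩, ?_⟩
  · exact eventuallyEq_of_xJet_eq hD hH hus hmem (hu.trans hjet.symm) (by rwa [hu])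
  · rintro ϰ ⟨hϰW, hϰu⟩
    have e1 : famJet ρ F.f (z.1, z.2.1, ϰ) = z := by
      have : xJet ρ (member F.f ϰ) (z.1, z.2.1) = xJet ρ u (z.1, z.2.1) := by
        simp only [xJet, Prod.mk.injEq, true_and]
        funext k
        exact (xDeriv_congr hϰu.symm k).self_of_nhds
      exact this.trans hu
    have e2 := F.chart.left_inv (hVW _ h1 ϰ (hWW₀ hϰW))
    rw [coe_chart, e1] at e2
    rw [e2]

/-- The values of `f₀, …, f_{ρ-1}` at `(t₀, x₀)` are local coordinates on the parameter space. -/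
theorem exists_paramChart (F : SolutionFamily H D z₀) :
    ∃ e : OpenPartialHomeomorph (Fin ρ → ℝ) (Fin ρ → ℝ), F.ϰ₀ ∈ e.source ∧
      (⇑e = fun ϰ => (famJet ρ F.f (z₀.1, z₀.2.1, ϰ)).2.2) ∧
      (∀ ϰ ∈ e.source, ContDiffAt ℝ ∞ e ϰ) ∧ ∀ p ∈ e.target, ContDiffAt ℝ ∞ e.symm p := by
  let L : (Fin ρ → ℝ) →L[ℝ] Pt ρ := (0 : (Fin ρ → ℝ) →L[ℝ] ℝ).prod
    ((0 : (Fin ρ → ℝ) →L[ℝ] ℝ).prod (ContinuousLinearMap.id ℝ (Fin ρ → ℝ)))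
  let π : Pt ρ →L[ℝ] (Fin ρ → ℝ) :=
    (ContinuousLinearMap.snd ℝ ℝ _).comp (ContinuousLinearMap.snd ℝ ℝ _)
  have hL : ∀ ϰ, HasFDerivAt (fun ϰ : Fin ρ → ℝ => ((z₀.1, z₀.2.1, ϰ) : Pt ρ)) L ϰ := fun ϰ =>
    (hasFDerivAt_const _ _).prodMk ((hasFDerivAt_const _ _).prodMk (hasFDerivAt_id _))
  have hc : Filter.Tendsto (fun ϰ : Fin ρ → ℝ => ((z₀.1, z₀.2.1, ϰ) : Pt ρ)) (𝓝 F.ϰ₀)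
      (𝓝 F.base) := (hL _).continuousAt
  have hs := F.eventually_solution
  have h0 := hs.self_of_nhds.1
  let A : (Fin ρ → ℝ) →L[ℝ] (Fin ρ → ℝ) := π.comp ((fderiv ℝ (famJet ρ F.f) F.base).comp L)
  have hA : ∀ w, A w = fun a : Fin ρ => fderiv ℝ (famX F.f a) F.base (0, 0, w) := fun w => by
    have := fderiv_famJet h0 ρ (0, 0, w)
    exact congrArg (fun z : Pt ρ => z.2.2) this
  have hinj : Function.Injective A.toLinearMap := by
    rw [← LinearMap.ker_eq_bot, LinearMap.ker_eq_bot']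
    intro w h
    rw [ContinuousLinearMap.coe_coe, hA] at h
    exact F.eq_zero_of_fderiv_famX fun a => congrFun h a
  obtain ⟨e, h1, h2, h3, h4⟩ := exists_smooth_localDiffeo
    (f := fun ϰ => (famJet ρ F.f (z₀.1, z₀.2.1, ϰ)).2.2) (a := F.ϰ₀)
    (LinearEquiv.ofInjectiveEndo _ hinj).toContinuousLinearEquiv
    ((hc.eventually hs).mono fun ϰ hϰ => by
      have : ContDiffAt ℝ ∞ (fun ϰ : Fin ρ → ℝ => ((z₀.1, z₀.2.1, ϰ) : Pt ρ)) ϰ :=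
        contDiffAt_const.prodMk (contDiffAt_const.prodMk contDiffAt_id)
      exact π.contDiff.contDiffAt.comp ϰ ((contDiffAt_famJet hϰ.1 ρ).comp ϰ this))
    (by
      have e1 : HasFDerivAt (famJet ρ F.f) (fderiv ℝ (famJet ρ F.f) F.base)
          (z₀.1, z₀.2.1, F.ϰ₀) :=
        ((contDiffAt_famJet h0 ρ).differentiableAt (by simp)).hasFDerivAt
      exact (π.hasFDerivAt.comp F.ϰ₀ (e1.comp F.ϰ₀ (hL _))).congr_fderiv
        (ContinuousLinearMap.ext fun _ => rfl))
  exact ⟨e, h1, h2, by rwa [h2], h4⟩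

/-- Families with the same conditional symmetry are re-parametrization equivalent: a local
diffeomorphism `ζ` of the parameters matches the derivatives of the members at `(t₀, x₀)`, and
local uniqueness identifies the members. -/
theorem reparam_iff (hD : IsOpen D) (hH : ContDiffOn ℝ ∞ H D) (F F' : SolutionFamily H D z₀) :
    Reparam F F' ↔ F.eta =ᶠ[𝓝 z₀] F'.eta := by
  constructor
  · rintro ⟨ζ, hs, h0, -, -, hζ⟩
    rw [← F.invariant_iff]
    have hc : Filter.Tendsto (fun z : Pt ρ => ((z.1, z.2.1, ζ z.2.2) : Pt ρ))
        (𝓝 F.base) (𝓝 F'.base) := by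
      have : ContinuousAt (fun z : Pt ρ => ζ z.2.2) F.base :=
        ContinuousAt.comp' (g := ζ) (ζ.continuousAt hs) (by fun_prop)
      have h := (continuousAt_fst (p := F.base)).prodMk
        (continuous_snd.fst.continuousAt.prodMk this)
      rw [ContinuousAt] at h
      rwa [show ((F.base.1, F.base.2.1, ζ F.base.2.2) : Pt ρ) = F'.base from
        Prod.ext rfl (Prod.ext rfl h0)] at h
    filter_upwards [hc.eventually (F'.invariant_iff.2 (Filter.EventuallyEq.refl _ _)),
      Filter.Eventually.eventually_nhds hζ] with z h1 h2
    have h3 : member F.f z.2.2 =ᶠ[𝓝 (z.1, z.2.1)] member F'.f (ζ z.2.2) := by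
      filter_upwards [(tendsto_member z).eventually h2] with q hq
      exact hq.symm
    have h4 := (xDeriv_congr h3 ρ).self_of_nhds
    have h5 : xJet ρ (member F.f z.2.2) (z.1, z.2.1) =
        xJet ρ (member F'.f (ζ z.2.2)) (z.1, z.2.1) := by
      simp only [xJet, Prod.mk.injEq, true_and]
      funext k
      exact (xDeriv_congr h3 k).self_of_nhds
    rw [InvariantAt, h4, h5]
    exact h1
  · intro h
    obtain ⟨e, he0, hec, hes, het⟩ := F.exists_paramChart
    obtain ⟨e', he0', hec', hes', het'⟩ := F'.exists_paramChart
    have hv : e F.ϰ₀ = e' F'.ϰ₀ := by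
      rw [hec, hec']
      exact congrArg (fun z : Pt ρ => z.2.2) (F.famJet_base.trans F'.famJet_base.symm)
    let ζ := e.trans e'.symm
    have hζs : F.ϰ₀ ∈ ζ.source := by
      simp only [ζ, OpenPartialHomeomorph.trans_source, OpenPartialHomeomorph.symm_source,
        Set.mem_inter_iff, Set.mem_preimage]
      exact ⟨he0, hv ▸ e'.map_source he0'⟩
    have hζ0 : ζ F.ϰ₀ = F'.ϰ₀ := by
      simp only [ζ, OpenPartialHomeomorph.coe_trans, Function.comp_apply, hv, e'.left_inv he0']
    refine ⟨ζ, hζs, hζ0, ?_, ?_, ?_⟩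
    · intro ϰ hϰ
      simp only [ζ, OpenPartialHomeomorph.trans_source, OpenPartialHomeomorph.symm_source,
        Set.mem_inter_iff, Set.mem_preimage] at hϰ
      exact ((het' _ hϰ.2).comp ϰ (hes _ hϰ.1)).contDiffWithinAt
    · intro ϰ hϰ
      simp only [ζ, OpenPartialHomeomorph.trans_target, OpenPartialHomeomorph.symm_target,
        OpenPartialHomeomorph.symm_symm, Set.mem_inter_iff, Set.mem_preimage] at hϰ
      exact ((het _ hϰ.2).comp ϰ (hes' _ hϰ.1)).contDiffWithinAt
    · have hη : ∀ᶠ z in 𝓝 (famJet ρ F.f (z₀.1, z₀.2.1, F.ϰ₀)), ContDiffAt ℝ ∞ F'.eta z := by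
        rw [show famJet ρ F.f (z₀.1, z₀.2.1, F.ϰ₀) = z₀ from F.famJet_base]
        exact F'.eventually_contDiffAt_eta
      have key := eventually_member_eq hD hH (σ := ζ) (F.eventually_isInvariantFamilyAt h)
        (by rw [hζ0]; exact F'.eventually_isInvariantFamilyAt (Filter.EventuallyEq.refl _ _)) hη
        (ζ.continuousAt hζs) (by
          filter_upwards [ζ.open_source.mem_nhds hζs] with ϰ hϰ
          simp only [ζ, OpenPartialHomeomorph.trans_source, OpenPartialHomeomorph.symm_source,
            Set.mem_inter_iff, Set.mem_preimage] at hϰ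
          have h1 : e' (ζ ϰ) = e ϰ := e'.right_inv hϰ.2
          rw [hec, hec'] at h1
          exact Prod.ext rfl (Prod.ext rfl h1.symm))
      exact key.mono fun z hz => hz.symm

end SolutionFamily

/-! ### The family of invariant solutions of a conditional symmetry -/

section Existence

variable {r ρ : ℕ} {H : Pt (r + 1) → ℝ} {D : Set (Pt (r + 1))} {η : Pt ρ → ℝ}

/-- The restricted total derivatives commute where `u_ρ = η` and `u_t = H` are compatible. -/
theorem fderiv_xField_tField (hD : IsOpen D) (hH : ContDiffOn ℝ ∞ H D) {z : Pt ρ}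
    (hη : ContDiffAt ℝ ∞ η z) (hz : redJet η (r + 1) z ∈ D)
    (hc : (redDx η)^[ρ] (redH H η) z = fderiv ℝ η z (tField H η z)) :
    fderiv ℝ (xField η) z (tField H η z) = fderiv ℝ (tField H η) z (xField η z) := by
  have h1 : HasFDerivAt (xField η) ((0 : Pt ρ →L[ℝ] ℝ).prod ((0 : Pt ρ →L[ℝ] ℝ).prod
      (ContinuousLinearMap.pi fun i : Fin ρ => fderiv ℝ (redCoord η (i + 1)) z))) z := by
    rw [show xField η = fun z => (0, 1, fun i : Fin ρ => redCoord η (i + 1) z) from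
      funext (xField_eq η)]
    exact (hasFDerivAt_const _ _).prodMk ((hasFDerivAt_const _ _).prodMk
      (hasFDerivAt_pi.2 fun i : Fin ρ =>
        ((contDiffAt_redCoord hη (i + 1)).differentiableAt (by simp)).hasFDerivAt))
  have h2 : HasFDerivAt (tField H η) ((0 : Pt ρ →L[ℝ] ℝ).prod ((0 : Pt ρ →L[ℝ] ℝ).prod
      (ContinuousLinearMap.pi fun i : Fin ρ => fderiv ℝ ((redDx η)^[i] (redH H η)) z))) z :=
    (hasFDerivAt_const _ _).prodMk ((hasFDerivAt_const _ _).prodMk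
      (hasFDerivAt_pi.2 fun i : Fin ρ => ((contDiffAt_redDx_iterate hη
        (contDiffAt_redH hD hH hη hz) i).differentiableAt (by simp)).hasFDerivAt))
  rw [h1.fderiv, h2.fderiv]
  refine Prod.ext rfl (Prod.ext rfl (funext fun i => ?_))
  change fderiv ℝ (redCoord η (i + 1)) z (tField H η z) = redDx η ((redDx η)^[i] (redH H η)) z
  rw [← Function.iterate_succ_apply' (redDx η)]
  by_cases h : (i : ℕ) + 1 < ρ
  · have : redCoord η (i + 1) = coordCLM (⟨i + 1, h⟩ : Fin ρ) := by
      funext z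
      exact redCoord_of_lt η z ⟨i + 1, h⟩
    rw [this, ContinuousLinearMap.fderiv]
    rfl
  · have h' : (i : ℕ) + 1 = ρ := by omega
    rw [Nat.succ_eq_add_one, h', redCoord_self, hc]

/-- Integral surfaces of the restricted total derivatives, parametrized by `(t, x)` and by the
coordinates `ϰ` of the point over `(t₀, x₀)`. -/
theorem exists_adapted_surfaces (hD : IsOpen D) (hH : ContDiffOn ℝ ∞ H D) {z₀ : Pt ρ}
    (hη : ∀ᶠ z in 𝓝 z₀, ContDiffAt ℝ ∞ η z) (hz₀ : redJet η (r + 1) z₀ ∈ D)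
    (hc : ∀ᶠ z in 𝓝 z₀, (redDx η)^[ρ] (redH H η) z = fderiv ℝ η z (tField H η z)) :
    ∃ y : Pt ρ → Pt ρ, (∀ᶠ z in 𝓝 z₀, ContDiffAt ℝ ∞ y z ∧
      IsIntegralSurfaceAt (tField H η) (xField η) (fun q => y (q.1, q.2, z.2.2)) (z.1, z.2.1) ∧
      (y z).1 = z.1 ∧ (y z).2.1 = z.2.1) ∧
      ∀ᶠ ϰ in 𝓝 z₀.2.2, y (z₀.1, z₀.2.1, ϰ) = (z₀.1, z₀.2.1, ϰ) := by
  have hD' := eventually_redJet_mem hD hη.self_of_nhds hz₀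
  obtain ⟨Y, hY, hY0, hYi⟩ := exists_integral_surfaces (T := tField H η) (X := xField η) (z₀ := z₀)
    (by filter_upwards [hη, hD'] with z h1 h2 using contDiffAt_tField hD hH h1 h2)
    (hη.mono fun z h => contDiffAt_xField h)
    (by filter_upwards [hη, hD', hc] with z h1 h2 h3 using fderiv_xField_tField hD hH h1 h2 h3)
  let τ : Pt ρ → ℝ × ℝ × Pt ρ := fun z => (z.1 - z₀.1, z.2.1 - z₀.2.1, (z₀.1, z₀.2.1, z.2.2))
  have hτs : ContDiff ℝ ∞ τ := by
    refine (contDiff_fst.sub contDiff_const).prodMk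
      ((contDiff_snd.fst.sub contDiff_const).prodMk ?_)
    exact contDiff_const.prodMk (contDiff_const.prodMk contDiff_snd.snd)
  have hτ : Filter.Tendsto τ (𝓝 z₀) (𝓝 (0, 0, z₀)) := by
    have := hτs.continuous.tendsto z₀
    simpa [τ] using this
  have hinc : Filter.Tendsto (fun ϰ : Fin ρ → ℝ => ((z₀.1, z₀.2.1, ϰ) : Pt ρ)) (𝓝 z₀.2.2)
      (𝓝 z₀) :=
    (by fun_prop : Continuous fun ϰ : Fin ρ → ℝ => ((z₀.1, z₀.2.1, ϰ) : Pt ρ)).continuousAt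
  let y : Pt ρ → Pt ρ := fun z => Y (τ z)
  have hy0 : ∀ᶠ ϰ in 𝓝 z₀.2.2, y (z₀.1, z₀.2.1, ϰ) = (z₀.1, z₀.2.1, ϰ) := by
    filter_upwards [hinc.eventually hY0] with ϰ hϰ
    simpa [y, τ] using hϰ
  have hyi : ∀ᶠ z in 𝓝 z₀, IsIntegralSurfaceAt (tField H η) (xField η)
      (fun q => y (q.1, q.2, z.2.2)) (z.1, z.2.1) := by
    filter_upwards [hτ.eventually hYi] with z hz
    have h1 : HasFDerivAt (fun q : ℝ × ℝ => (q.1 - z₀.1, q.2 - z₀.2.1))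
        (ContinuousLinearMap.id ℝ (ℝ × ℝ)) (z.1, z.2.1) :=
      (hasFDerivAt_id (𝕜 := ℝ) ((z.1, z.2.1) : ℝ × ℝ)).sub_const (z₀.1, z₀.2.1)
    rw [IsIntegralSurfaceAt] at hz ⊢
    have h2 := HasFDerivAt.comp (g := fun q : ℝ × ℝ => Y (q.1, q.2, (z₀.1, z₀.2.1, z.2.2)))
      (f := fun q : ℝ × ℝ => (q.1 - z₀.1, q.2 - z₀.2.1)) (z.1, z.2.1) hz h1
    rw [ContinuousLinearMap.comp_id] at h2
    exact h2
  have hproj : ∀ᶠ z in 𝓝 z₀, (y z).1 = z.1 ∧ (y z).2.1 = z.2.1 := by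
    have hsnd : Filter.Tendsto (fun z : Pt ρ => z.2.2) (𝓝 z₀) (𝓝 z₀.2.2) :=
      (by fun_prop : Continuous fun z : Pt ρ => z.2.2).continuousAt
    obtain ⟨δ, hδ, hball⟩ := Metric.eventually_nhds_iff_ball.1 (hyi.and (hsnd.eventually hy0))
    filter_upwards [Metric.ball_mem_nhds z₀ hδ] with z hz
    have hmem : ∀ q ∈ Metric.ball (z₀.1, z₀.2.1) δ,
        ((q.1, q.2, z.2.2) : Pt ρ) ∈ Metric.ball z₀ δ := by
      intro q hq
      simp only [Metric.mem_ball, Prod.dist_eq, max_lt_iff] at hz hq ⊢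
      exact ⟨hq.1, hq.2, hz.2.2⟩
    have hzq : (z.1, z.2.1) ∈ Metric.ball (z₀.1, z₀.2.1) δ := by
      simp only [Metric.mem_ball, Prod.dist_eq, max_lt_iff] at hz ⊢
      exact ⟨hz.1, hz.2.1⟩
    let π : Pt ρ →L[ℝ] ℝ × ℝ := (ContinuousLinearMap.fst ℝ ℝ _).prod
      ((ContinuousLinearMap.fst ℝ ℝ _).comp (ContinuousLinearMap.snd ℝ ℝ _))
    -- The first two components of the fields are constant, so that `(y₁, y₂) - (t, x)` is.
    have h0 := eq_zero_of_norm_fderiv_le (convex_ball (z₀.1, z₀.2.1) δ)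
      (g := fun q => π (y (q.1, q.2, z.2.2)) - q) (g' := fun _ => 0) (K := 0)
      (fun q hq => by
        have h1 := (π.hasFDerivAt.comp q (hball _ (hmem q hq)).1).sub (hasFDerivAt_id q)
        refine h1.congr_fderiv ?_
        ext <;> simp [π, tField, xField])
      (fun q _ v => by simp) (Metric.mem_ball_self hδ)
      (by
        have := (hball _ (hmem _ (Metric.mem_ball_self hδ))).2
        simp only at this
        rw [this]
        simp [π]) _ hzq
    have h1 : ((y z).1, (y z).2.1) = (z.1, z.2.1) := sub_eq_zero.1 h0
    exact Prod.mk.inj h1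
  refine ⟨y, ?_, hy0⟩
  filter_upwards [hτ.eventually hY, hyi, hproj] with z h1 h2 h3
  exact ⟨h1.comp z hτs.contDiffAt, h2, h3⟩

theorem redDx_iterate_redCoord_zero (η : Pt ρ → ℝ) (k : ℕ) :
    (redDx η)^[k] (redCoord η 0) = redCoord η k := by
  induction k with
  | zero => rfl
  | succ k ih => rw [Function.iterate_succ_apply', ih, redDx_redCoord]

/-- Along integral surfaces of the restricted total derivatives, the `x`-derivatives of the
coordinate `u₀` are the restrictions of the coordinates `u_k`. -/
theorem famJet_redCoord_zero {y : Pt ρ → Pt ρ} {z : Pt ρ}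
    (hy : ∀ᶠ z in 𝓝 z, IsIntegralSurfaceAt (tField H η) (xField η)
      (fun q => y (q.1, q.2, z.2.2)) (z.1, z.2.1) ∧ (y z).1 = z.1 ∧ (y z).2.1 = z.2.1)
    (hη : ContDiffAt ℝ ∞ η (y z)) :
    (∀ k, famX (fun z => redCoord η 0 (y z)) k z = redCoord η k (y z)) ∧
      ∀ m, famJet m (fun z => redCoord η 0 (y z)) z = redJet η m (y z) := by
  have h3 : ∀ k, famX (fun z => redCoord η 0 (y z)) k z = redCoord η k (y z) := by
    intro k
    have h4 := (xDeriv_comp_eq (G := redCoord η 0) (y := fun q => y (q.1, q.2, z.2.2))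
      (q := (z.1, z.2.1)) hy.self_of_nhds.1.continuousAt (by
        filter_upwards [(tendsto_member z).eventually hy] with q hq
        simpa using hasDerivAt_xSlice hq.1) hη (contDiffAt_redCoord hη 0) k).self_of_nhds
    rw [redDx_iterate_redCoord_zero] at h4
    exact h4
  refine ⟨h3, fun m => ?_⟩
  refine Prod.ext hy.self_of_nhds.2.1.symm (Prod.ext hy.self_of_nhds.2.2.symm ?_)
  exact funext fun k => h3 k

/-- A family whose parameters are the derivatives of its members at `(t₀, x₀)` is regular. -/
theorem paramJacobian_eq_one {f : Pt ρ → ℝ} {z₀ : Pt ρ}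
    (h : ∀ᶠ ϰ in 𝓝 z₀.2.2, famJet ρ f (z₀.1, z₀.2.1, ϰ) = (z₀.1, z₀.2.1, ϰ)) :
    paramJacobian f z₀ = 1 := by
  ext a b
  have h1 : Filter.Tendsto (fun s : ℝ => Function.update z₀.2.2 b s) (𝓝 (z₀.2.2 b)) (𝓝 z₀.2.2) := by
    have := (continuous_const.update b continuous_id :
      Continuous fun s : ℝ => Function.update z₀.2.2 b s).tendsto (z₀.2.2 b)
    simpa using this
  have h2 : (fun s : ℝ => xDeriv a (member f (Function.update z₀.2.2 b s)) (z₀.1, z₀.2.1))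
      =ᶠ[𝓝 (z₀.2.2 b)] fun s => Function.update z₀.2.2 b s a := by
    filter_upwards [h1.eventually h] with s hs
    have h3 := congrFun (Prod.mk.inj (Prod.mk.inj hs).2).2 a
    exact h3
  have h3 : HasDerivAt (fun s : ℝ => Function.update z₀.2.2 b s a)
      ((Pi.single b (1 : ℝ) : Fin ρ → ℝ) a) (z₀.2.2 b) :=
    hasDerivAt_pi.1 (hasDerivAt_update z₀.2.2 b (z₀.2.2 b)) a
  rw [paramJacobian, Matrix.of_apply, h2.deriv_eq, h3.deriv, Matrix.one_apply, Pi.single_apply]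

/-- The coordinate `u₀` along an integral surface of the restricted total derivatives solves the
equation. -/
theorem solvesAt_redCoord_zero (hρ : 1 ≤ ρ) {y : Pt ρ → Pt ρ} {z : Pt ρ}
    (hy : IsIntegralSurfaceAt (tField H η) (xField η) (fun q => y (q.1, q.2, z.2.2)) (z.1, z.2.1))
    (hjet : famJet (r + 1) (fun z => redCoord η 0 (y z)) z = redJet η (r + 1) (y z))
    (hD : redJet η (r + 1) (y z) ∈ D) :
    SolvesAt H D (member (fun z => redCoord η 0 (y z)) z.2.2) (z.1, z.2.1) := by
  have h4 : xJet (r + 1) (member (fun z => redCoord η 0 (y z)) z.2.2) (z.1, z.2.1) =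
      redJet η (r + 1) (y z) := hjet
  refine ⟨by rwa [h4], ?_⟩
  rw [h4]
  have h5 : redCoord η 0 = coordCLM (⟨0, hρ⟩ : Fin ρ) := by
    funext z
    exact redCoord_of_lt η z ⟨0, hρ⟩
  have h7 := (coordCLM (⟨0, hρ⟩ : Fin ρ)).hasFDerivAt.comp_hasDerivAt z.1 (hasDerivAt_tSlice hy)
  simp only [h5]
  refine h7.deriv.trans ?_
  simp [coordCLM, tField, redH]

/-- The invariant solutions of a conditional symmetry form a `ρ`-parametric family. -/
theorem exists_solutionFamily (hr : 1 ≤ r) (hρ : 1 ≤ ρ) (hD : IsOpen D) (hH : ContDiffOn ℝ ∞ H D)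
    {z₀ : Pt ρ} (hsym : IsCondSymmetryAt H D η z₀) :
    ∃ F : SolutionFamily H D z₀, F.eta =ᶠ[𝓝 z₀] η := by
  obtain ⟨hη, hz₀, hc⟩ := (isCondSymmetryAt_iff hr hD hH).1 hsym
  obtain ⟨y, hy, hy0⟩ := exists_adapted_surfaces hD hH hη hz₀ hc
  have hyz : y z₀ = z₀ := hy0.self_of_nhds
  have hyt : Filter.Tendsto y (𝓝 z₀) (𝓝 z₀) := by
    simpa only [ContinuousAt, hyz] using hy.self_of_nhds.1.continuousAt
  obtain ⟨f, hf⟩ : ∃ f : Pt ρ → ℝ, f = fun z => redCoord η 0 (y z) := ⟨_, rfl⟩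
  have hjet : ∀ᶠ z in 𝓝 z₀, (∀ k, famX f k z = redCoord η k (y z)) ∧
      ∀ m, famJet m f z = redJet η m (y z) := by
    filter_upwards [hy.eventually_nhds, hyt.eventually hη] with z h1 h2
    rw [hf]
    exact famJet_redCoord_zero (h1.mono fun z hz => hz.2) h2
  have hinc : Filter.Tendsto (fun ϰ : Fin ρ → ℝ => ((z₀.1, z₀.2.1, ϰ) : Pt ρ)) (𝓝 z₀.2.2)
      (𝓝 z₀) :=
    (by fun_prop : Continuous fun ϰ : Fin ρ → ℝ => ((z₀.1, z₀.2.1, ϰ) : Pt ρ)).continuousAt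
  have hinit : ∀ᶠ ϰ in 𝓝 z₀.2.2, famJet ρ f (z₀.1, z₀.2.1, ϰ) = (z₀.1, z₀.2.1, ϰ) := by
    filter_upwards [hinc.eventually hjet, hy0] with ϰ h1 h2
    rw [h1.2, h2, redJet_self]
  have hsol : ∀ᶠ z in 𝓝 z₀,
      ContDiffAt ℝ ∞ f z ∧ SolvesAt H D (member f z.2.2) (z.1, z.2.1) := by
    filter_upwards [hy, hjet, hyt.eventually (hη.and
      (eventually_redJet_mem hD hη.self_of_nhds hz₀))] with z h1 h2 h3
    rw [hf] at h2 ⊢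
    exact ⟨(contDiffAt_redCoord h3.1 0).comp z h1.1,
      solvesAt_redCoord_zero hρ h1.2.1 (h2.2 (r + 1)) h3.2⟩
  have hreg : (paramJacobian f z₀).det ≠ 0 := by
    rw [paramJacobian_eq_one hinit, Matrix.det_one]
    exact one_ne_zero
  have hthrough : famJet ρ f z₀ = z₀ := hinit.self_of_nhds
  refine ⟨⟨f, z₀.2.2, ⟨_, hsol, fun z hz => hz⟩, hthrough, hreg⟩,
    (SolutionFamily.invariant_iff _).1 ?_⟩
  change ∀ᶠ z in 𝓝 z₀, InvariantAt η (member f z.2.2) (z.1, z.2.1)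
  filter_upwards [hjet] with z hz
  change famX f ρ z = η (famJet ρ f z)
  rw [hz.2, redJet_self, hz.1, redCoord_self]

/-- The correspondence between classes of families and germs of conditional symmetries. -/
theorem exists_equiv_condSymmetryGerm (hr : 1 ≤ r) (hρ : 1 ≤ ρ) (hD : IsOpen D)
    (hH : ContDiffOn ℝ ∞ H D) (z₀ : Pt ρ) :
    ∃ Φ : Quotient (reparamSetoid H D z₀) ≃ CondSymmetryGerm H D z₀,
      ∀ (F : SolutionFamily H D z₀) (η : Pt ρ → ℝ),
        ((Φ (Quotient.mk (reparamSetoid H D z₀) F)).1 = (η : Filter.Germ (𝓝 z₀) ℝ) ↔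
          IsFamilyOfInvariantSolutions η F) := by
  let φ : SolutionFamily H D z₀ → CondSymmetryGerm H D z₀ := fun F =>
    ⟨(F.eta : Filter.Germ (𝓝 z₀) ℝ), F.eta, rfl, F.isCondSymmetryAt_eta hr hD hH⟩
  have hφ : ∀ F F', φ F = φ F' ↔ Reparam F F' := fun F F' => by
    rw [F.reparam_iff hD hH F', Subtype.ext_iff]
    exact Filter.Germ.coe_eq
  let Φ : Quotient (reparamSetoid H D z₀) → CondSymmetryGerm H D z₀ :=
    Quotient.lift φ fun F F' h => (hφ F F').2 h
  have hΦ : Function.Bijective Φ := by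
    constructor
    · rintro ⟨F⟩ ⟨F'⟩ h
      exact Quotient.sound ((hφ F F').1 h)
    · rintro ⟨_, η, rfl, hη⟩
      obtain ⟨F, hF⟩ := exists_solutionFamily hr hρ hD hH hη
      exact ⟨Quotient.mk _ F, Subtype.ext (Filter.Germ.coe_eq.2 hF)⟩
  refine ⟨Equiv.ofBijective Φ hΦ, fun F η => ?_⟩
  rw [F.isFamilyOfInvariantSolutions_iff hD hH]
  exact Filter.Germ.coe_eq

end Existence

/-! ### Essential parameters -/

section Essential

variable {r ρ : ℕ} {H : Pt (r + 1) → ℝ} {D : Set (Pt (r + 1))} {f : Pt ρ → ℝ}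

theorem paramJacobian_det_ne_zero_iff {z : Pt ρ} (hf : ContDiffAt ℝ ∞ f z) :
    (paramJacobian f z).det ≠ 0 ↔
      Function.Surjective fun w (a : Fin ρ) => fderiv ℝ (famX f a) z (0, 0, w) := by
  rw [← isUnit_iff_ne_zero, ← Matrix.isUnit_iff_isUnit_det, ← Matrix.mulVec_surjective_iff_isUnit]
  rw [show (paramJacobian f z).mulVec = _ from funext (paramJacobian_mulVec hf)]

/-- A family that factors through fewer parameters has no regular points. -/
theorem essentialOn_of_regular {W : Set (Pt ρ)} (hW : IsOpen W) {z : Pt ρ} (hz : z ∈ W)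
    (hf : ContDiffAt ℝ ∞ f z) (hreg : (paramJacobian f z).det ≠ 0) : EssentialOn f W := by
  rintro ⟨m, hm, ζ, g, h⟩
  obtain ⟨hζ, hg, -⟩ := h z hz
  have hζ' := (hζ.differentiableAt (by simp)).hasFDerivAt
  have heq : ∀ᶠ z' in 𝓝 z, f z' = g (z'.1, z'.2.1, ζ z'.2.2) :=
    Filter.mem_of_superset (hW.mem_nhds hz) fun z' hz' => (h z' hz').2.2
  have hX : ∀ a, famX f a =ᶠ[𝓝 z] fun z' => famX g a (z'.1, z'.2.1, ζ z'.2.2) := by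
    intro a
    filter_upwards [heq.eventually_nhds] with z' hz'
    have : member f z'.2.2 =ᶠ[𝓝 (z'.1, z'.2.1)] member g (ζ z'.2.2) :=
      (tendsto_member z').eventually hz'
    exact (xDeriv_congr this a).self_of_nhds
  obtain ⟨w, hw, hw0⟩ : ∃ w, fderiv ℝ ζ z.2.2 w = 0 ∧ w ≠ 0 := by
    have := LinearMap.ker_ne_bot_of_finrank_lt (f := (fderiv ℝ ζ z.2.2).toLinearMap) (by simpa)
    obtain ⟨w, hw, hw0⟩ := Submodule.exists_mem_ne_zero_of_ne_bot this
    exact ⟨w, hw, hw0⟩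
  refine hw0 (Matrix.eq_zero_of_mulVec_eq_zero hreg ?_)
  rw [paramJacobian_mulVec hf]
  funext a
  let π : Pt ρ →L[ℝ] (Fin ρ → ℝ) :=
    (ContinuousLinearMap.snd ℝ ℝ _).comp (ContinuousLinearMap.snd ℝ ℝ _)
  have h1 : HasFDerivAt (fun z' : Pt ρ => ((z'.1, z'.2.1, ζ z'.2.2) : Pt m))
      ((ContinuousLinearMap.fst ℝ ℝ (ℝ × (Fin ρ → ℝ))).prod
        (((ContinuousLinearMap.fst ℝ ℝ (Fin ρ → ℝ)).comp
          (ContinuousLinearMap.snd ℝ ℝ (ℝ × (Fin ρ → ℝ)))).prod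
          ((fderiv ℝ ζ z.2.2).comp π))) z :=
    hasFDerivAt_fst.prodMk ((((ContinuousLinearMap.fst ℝ ℝ (Fin ρ → ℝ)).comp
      (ContinuousLinearMap.snd ℝ ℝ (ℝ × (Fin ρ → ℝ)))).hasFDerivAt).prodMk
        (HasFDerivAt.comp z (g := ζ) hζ' π.hasFDerivAt))
  have h2 := HasFDerivAt.comp z (g := famX g a)
    ((contDiffAt_famX hg a).differentiableAt (by simp)).hasFDerivAt h1
  rw [(h2.congr_of_eventuallyEq (hX a)).fderiv]
  simp only [π, ContinuousLinearMap.comp_apply, ContinuousLinearMap.prod_apply,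
    ContinuousLinearMap.coe_fst', ContinuousLinearMap.coe_snd', hw, Pi.zero_apply]
  exact map_zero _

/-- If the derivatives of `f₀, …, f_{s-1}` in the parameters are linearly independent, then
`t, x, f₀, …, f_{s-1}` can be completed to local coordinates on the space of `(t, x, ϰ)`. -/
theorem exists_submersion_chart {s : ℕ} {z₁ : Pt ρ} (hf : ∀ᶠ z in 𝓝 z₁, ContDiffAt ℝ ∞ f z)
    (hs : Function.Surjective fun w (a : Fin s) => fderiv ℝ (famX f a) z₁ (0, 0, w)) :
    ∃ (K : Submodule ℝ (Fin ρ → ℝ)) (e : OpenPartialHomeomorph (Pt ρ) (Pt s × K)),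
      z₁ ∈ e.source ∧ (∀ z, (e z).1 = famJet s f z) ∧ ∀ w ∈ e.target, ContDiffAt ℝ ∞ e.symm w := by
  have h0 := hf.self_of_nhds
  let L : (Fin ρ → ℝ) →L[ℝ] (Fin s → ℝ) := ContinuousLinearMap.pi fun a : Fin s =>
    (fderiv ℝ (famX f a) z₁).comp ((0 : (Fin ρ → ℝ) →L[ℝ] ℝ).prod
      ((0 : (Fin ρ → ℝ) →L[ℝ] ℝ).prod (ContinuousLinearMap.id ℝ (Fin ρ → ℝ))))
  have hL : ∀ w a, L w a = fderiv ℝ (famX f a) z₁ (0, 0, w) := fun w a => rfl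
  have hLs : L.range = ⊤ := LinearMap.range_eq_top.2 hs
  obtain ⟨R, hR⟩ := L.exists_rightInverse_of_surjective hLs
  have hR' : ∀ ξ, L (R ξ) = ξ := fun ξ => congrArg (fun A => A ξ) hR
  let K : Submodule ℝ (Fin ρ → ℝ) := LinearMap.ker L.toLinearMap
  let P : (Fin ρ → ℝ) →L[ℝ] K :=
    (ContinuousLinearMap.id ℝ (Fin ρ → ℝ) - R.comp L).codRestrict K fun w => by
      simp [K, hR']
  have hP : ∀ w, (P w : Fin ρ → ℝ) = w - R (L w) := fun w => rfl
  let π : Pt ρ →L[ℝ] (Fin ρ → ℝ) :=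
    (ContinuousLinearMap.snd ℝ ℝ _).comp (ContinuousLinearMap.snd ℝ ℝ _)
  let A : Pt ρ →L[ℝ] Pt s × K := (fderiv ℝ (famJet s f) z₁).prod (P.comp π)
  have hA : ∀ v, A v = (fderiv ℝ (famJet s f) z₁ v, P v.2.2) := fun v => rfl
  have hbij : Function.Bijective A := by
    constructor
    · rw [injective_iff_map_eq_zero]
      rintro ⟨a, b, w⟩ h
      rw [hA, fderiv_famJet h0] at h
      simp only [Prod.mk_eq_zero] at h
      obtain ⟨⟨rfl, rfl, h⟩, h'⟩ := h
      have h1 : L w = 0 := h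
      have h2 := hP w
      rw [h', h1] at h2
      simp only [map_zero, sub_zero, ZeroMemClass.coe_zero] at h2
      rw [← h2]
      rfl
    · rintro ⟨⟨a, b, ξ⟩, k⟩
      obtain ⟨ξ₀, hξ₀⟩ : ∃ ξ₀ : Fin s → ℝ, ∀ i, ξ₀ i = fderiv ℝ (famX f i) z₁ (a, b, 0) :=
        ⟨_, fun i => rfl⟩
      have hk : L k = 0 := k.2
      have hLw : L (R (ξ - ξ₀) + k) = ξ - ξ₀ := by rw [map_add, hR', hk, add_zero]
      refine ⟨(a, b, R (ξ - ξ₀) + k), ?_⟩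
      rw [hA, fderiv_famJet h0]
      refine Prod.ext (Prod.ext rfl (Prod.ext rfl (funext fun i => ?_))) (Subtype.ext ?_)
      · have h1 : ((a, b, R (ξ - ξ₀) + k) : Pt ρ) = (a, b, 0) + (0, 0, R (ξ - ξ₀) + k) := by
          simp
        change fderiv ℝ (famX f i) z₁ (a, b, R (ξ - ξ₀) + k) = ξ i
        rw [h1, map_add, ← hξ₀, ← hL, hLw]
        simp
      · rw [hP]
        change R (ξ - ξ₀) + k - R (L (R (ξ - ξ₀) + k)) = k
        rw [hLw, add_sub_cancel_left]
  have hsm : ∀ z, ContDiffAt ℝ ∞ f z → ContDiffAt ℝ ∞ (fun z => (famJet s f z, P (π z))) z :=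
    fun z hz => (contDiffAt_famJet hz s).prodMk (P.comp π).contDiff.contDiffAt
  obtain ⟨e, h1, h2, -, h4⟩ := exists_smooth_localDiffeo (a := z₁)
    (LinearEquiv.ofBijective A.toLinearMap hbij).toContinuousLinearEquiv
    (f := fun z => (famJet s f z, P (π z))) (hf.mono hsm)
    ((((contDiffAt_famJet h0 s).differentiableAt (by simp)).hasFDerivAt.prodMk
      (P.comp π).hasFDerivAt).congr_fderiv (ContinuousLinearMap.ext fun _ => rfl))
  exact ⟨K, e, h1, fun z => by rw [h2], h4⟩

/-- If the derivatives of `f₀, …, f_{s-1}` in the parameters are linearly independent at `z₁`, and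
those of `f₀, …, f_s` are linearly dependent everywhere near `z₁`, then `f_s` is a function `η` of
`t, x, f₀, …, f_{s-1}`. The function `S` is a section of `(t, x, f₀, …, f_{s-1})`. -/
theorem exists_functional_dependence {s : ℕ} {z₁ : Pt ρ}
    (hf : ∀ᶠ z in 𝓝 z₁, ContDiffAt ℝ ∞ f z)
    (hs : Function.Surjective fun w (a : Fin s) => fderiv ℝ (famX f a) z₁ (0, 0, w))
    (hs' : ∀ᶠ z in 𝓝 z₁,
      ¬ Function.Surjective fun w (a : Fin (s + 1)) => fderiv ℝ (famX f a) z (0, 0, w)) :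
    ∃ (η : Pt s → ℝ) (S : Pt s → Pt ρ), S (famJet s f z₁) = z₁ ∧
      (∀ᶠ p in 𝓝 (famJet s f z₁),
        ContDiffAt ℝ ∞ η p ∧ ContDiffAt ℝ ∞ S p ∧ famJet s f (S p) = p) ∧
      ∀ᶠ z in 𝓝 z₁, famX f s z = η (famJet s f z) := by
  obtain ⟨K, e, hz₁, he, hes⟩ := exists_submersion_chart hf hs
  have he₁ : famJet s f z₁ = (e z₁).1 := (he z₁).symm
  have ht₁ := e.map_source hz₁
  have hsymm : Filter.Tendsto e.symm (𝓝 (e z₁)) (𝓝 z₁) := by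
    have := e.continuousAt_symm ht₁
    rwa [ContinuousAt, e.left_inv hz₁] at this
  have hsub : Filter.Tendsto (fun p : Pt s => (p, (e z₁).2)) (𝓝 (famJet s f z₁)) (𝓝 (e z₁)) := by
    rw [he₁]
    exact (by fun_prop : Continuous fun p : Pt s => (p, (e z₁).2)).continuousAt
  have hsubs : ∀ p, ContDiffAt ℝ ∞ (fun p : Pt s => (p, (e z₁).2)) p := fun p =>
    contDiffAt_id.prodMk contDiffAt_const
  -- In the coordinates `e`, the derivative of `f_s` along `K` vanishes.
  have hker : ∀ᶠ w in 𝓝 (e z₁), DifferentiableAt ℝ (fun w => famX f s (e.symm w)) w ∧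
      ∀ k : K, fderiv ℝ (fun w => famX f s (e.symm w)) w (0, k) = 0 := by
    filter_upwards [e.open_target.mem_nhds ht₁, hsymm.eventually hf,
      hsymm.eventually hs'] with w h1 h2 h3
    have hd := (hes w h1).differentiableAt (by simp)
    have hX : ∀ a, DifferentiableAt ℝ (famX f a) (e.symm w) := fun a =>
      (contDiffAt_famX h2 a).differentiableAt (by simp)
    have hsec : ∀ v, fderiv ℝ (famJet s f) (e.symm w) (fderiv ℝ e.symm w v) = v.1 := by
      intro v
      have e1 : (fun w => famJet s f (e.symm w)) =ᶠ[𝓝 w] Prod.fst := by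
        filter_upwards [e.open_target.mem_nhds h1] with w' hw'
        rw [← he, e.right_inv hw']
      have e2 := ((contDiffAt_famJet h2 s).differentiableAt (by simp)).hasFDerivAt.comp w
        hd.hasFDerivAt
      have e3 := e2.unique (hasFDerivAt_fst.congr_of_eventuallyEq e1)
      exact congrArg (fun A => A v) e3
    have hsec' : ∀ ξ k, ∃ v, fderiv ℝ e.symm w ((0, 0, ξ), k) = (0, 0, v) ∧
        ∀ a : Fin s, fderiv ℝ (famX f a) (e.symm w) (0, 0, v) = ξ a := by
      intro ξ k
      have e1 := hsec ((0, 0, ξ), k)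
      rw [fderiv_famJet h2] at e1
      obtain ⟨a1, a2⟩ := Prod.mk.inj e1
      obtain ⟨a2, a3⟩ := Prod.mk.inj a2
      have e2 : fderiv ℝ e.symm w ((0, 0, ξ), k) =
          (0, 0, (fderiv ℝ e.symm w ((0, 0, ξ), k)).2.2) := Prod.ext a1 (Prod.ext a2 rfl)
      refine ⟨_, e2, fun a => ?_⟩
      rw [← e2]
      exact congrFun a3 a
    refine ⟨(hX s).comp w hd, fun k => ?_⟩
    have hc : fderiv ℝ (fun w => famX f s (e.symm w)) w (0, k) =
        fderiv ℝ (famX f s) (e.symm w) (fderiv ℝ e.symm w (0, k)) :=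
      congrArg (fun A => A (0, k)) ((hX s).hasFDerivAt.comp w hd.hasFDerivAt).fderiv
    obtain ⟨v, hv, hv'⟩ := hsec' 0 k
    rw [hc, show ((0, k) : Pt s × K) = ((0, 0, 0), k) from rfl, hv]
    by_contra hne
    refine h3 fun ξ => ?_
    obtain ⟨u, -, hu⟩ := hsec' (fun a => ξ a.castSucc) 0
    set c := fderiv ℝ (famX f s) (e.symm w) (0, 0, v) with hcdef
    set d := (ξ (Fin.last s) - fderiv ℝ (famX f s) (e.symm w) (0, 0, u)) / c with hd'
    refine ⟨u + d • v, funext fun a => ?_⟩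
    have e1 : ((0, 0, u + d • v) : Pt ρ) = (0, 0, u) + d • (0, 0, v) := by simp
    simp only [e1, map_add, map_smul, smul_eq_mul]
    refine Fin.lastCases ?_ (fun a => ?_) a
    · rw [Fin.val_last, ← hcdef, hd', div_mul_cancel₀ _ hne]
      ring
    · rw [Fin.val_castSucc, hu, hv']
      simp
  have hconst : ∀ᶠ w in 𝓝 (e z₁), famX f s (e.symm w) = famX f s (e.symm (w.1, (e z₁).2)) := by
    obtain ⟨δ, hδ, hball⟩ := Metric.eventually_nhds_iff_ball.1 hker
    filter_upwards [Metric.ball_mem_nhds (e z₁) hδ] with w hw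
    rw [Metric.mem_ball, Prod.dist_eq, max_lt_iff] at hw
    have hmem : ∀ k ∈ Metric.ball (e z₁).2 δ, (w.1, k) ∈ Metric.ball (e z₁) δ := by
      intro k hk
      rw [Metric.mem_ball, Prod.dist_eq, max_lt_iff]
      exact ⟨hw.1, hk⟩
    refine sub_eq_zero.1 (eq_zero_of_norm_fderiv_le (convex_ball (e z₁).2 δ)
      (g := fun k : K => famX f s (e.symm (w.1, k)) - famX f s (e.symm (w.1, (e z₁).2)))
      (g' := fun _ => 0) (K := 0) (fun k hk => ?_) (fun k _ v => by simp)
      (Metric.mem_ball_self hδ) (sub_self _) w.2 hw.2)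
    obtain ⟨h1, h2⟩ := hball _ (hmem k hk)
    have h3 : HasFDerivAt (fun k : K => (w.1, k))
        ((0 : K →L[ℝ] Pt s).prod (ContinuousLinearMap.id ℝ K)) k :=
      (hasFDerivAt_const _ _).prodMk (hasFDerivAt_id _)
    refine ((h1.hasFDerivAt.comp k h3).sub_const _).congr_fderiv ?_
    exact ContinuousLinearMap.ext fun v => h2 v
  refine ⟨fun p => famX f s (e.symm (p, (e z₁).2)), fun p => e.symm (p, (e z₁).2), ?_, ?_, ?_⟩
  · change e.symm (famJet s f z₁, (e z₁).2) = z₁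
    rw [he₁]
    exact e.left_inv hz₁
  · filter_upwards [hsub.eventually (e.open_target.mem_nhds ht₁),
      (hsymm.comp hsub).eventually hf] with p h1 h2
    have h3 : ContDiffAt ℝ ∞ (fun p => e.symm (p, (e z₁).2)) p := (hes _ h1).comp p (hsubs p)
    refine ⟨(contDiffAt_famX h2 s).comp p h3, h3, ?_⟩
    rw [← he, e.right_inv h1]
  · filter_upwards [(e.continuousAt hz₁).eventually hconst, e.open_source.mem_nhds hz₁] with z h1 h2
    rw [e.left_inv h2, he] at h1
    exact h1

/-- If the derivative of order `s < ρ` of the members of a `ρ`-parameter family of solutions is a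
function of the lower ones, then the members are determined by the `s` values of their derivatives
of lower orders at a point, and the family has non-essential parameters. -/
theorem exists_not_essentialOn_of_dependence (hD : IsOpen D) (hH : ContDiffOn ℝ ∞ H D) {s : ℕ}
    (hsρ : s < ρ) {z₁ : Pt ρ} {η : Pt s → ℝ} {S : Pt s → Pt ρ}
    (hf : ∀ᶠ z in 𝓝 z₁, IsInvariantFamilyAt H D η f z) (hS₁ : S (famJet s f z₁) = z₁)
    (hS : ∀ᶠ p in 𝓝 (famJet s f z₁),
      ContDiffAt ℝ ∞ η p ∧ ContDiffAt ℝ ∞ S p ∧ famJet s f (S p) = p) :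
    ∀ᶠ W in (𝓝 z₁).smallSets, ¬ EssentialOn f W := by
  obtain ⟨t₁, x₁, ϰ₁⟩ := z₁
  -- The parameters `ζ(ϰ)` are the derivatives of the member at `(t₁, x₁)`, and `σ` chooses a member
  -- with given derivatives.
  let ζ : (Fin ρ → ℝ) → (Fin s → ℝ) := fun ϰ => (famJet s f (t₁, x₁, ϰ)).2.2
  let σ : (Fin s → ℝ) → (Fin ρ → ℝ) := fun ξ => (S (t₁, x₁, ξ)).2.2
  have hinc : ∀ n, ∀ y : Fin n → ℝ, ContDiffAt ℝ ∞ (fun y => ((t₁, x₁, y) : Pt n)) y :=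
    fun n y => contDiffAt_const.prodMk (contDiffAt_const.prodMk contDiffAt_id)
  have h₁ : famJet s f (t₁, x₁, ϰ₁) = (t₁, x₁, ζ ϰ₁) := rfl
  rw [h₁] at hS₁ hS
  have hσ₁ : σ (ζ ϰ₁) = ϰ₁ := congrArg (fun z : Pt ρ => z.2.2) hS₁
  have hζs : ∀ᶠ ϰ in 𝓝 ϰ₁, ContDiffAt ℝ ∞ ζ ϰ := by
    filter_upwards [(hinc ρ ϰ₁).continuousAt.eventually hf] with ϰ hϰ
    exact (ContDiffAt.comp (g := famJet s f) (f := fun ϰ => ((t₁, x₁, ϰ) : Pt ρ)) ϰ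
      (contDiffAt_famJet hϰ.1 s) (hinc ρ ϰ)).snd.snd
  have hζc : Filter.Tendsto ζ (𝓝 ϰ₁) (𝓝 (ζ ϰ₁)) := hζs.self_of_nhds.continuousAt
  have hσs : ∀ᶠ ξ in 𝓝 (ζ ϰ₁), ContDiffAt ℝ ∞ σ ξ ∧ famJet s f (t₁, x₁, σ ξ) = (t₁, x₁, ξ) := by
    filter_upwards [(hinc s (ζ ϰ₁)).continuousAt.eventually hS] with ξ hξ
    refine ⟨(ContDiffAt.comp (g := S) (f := fun ξ => ((t₁, x₁, ξ) : Pt s)) ξ hξ.2.1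
      (hinc s ξ)).snd.snd, ?_⟩
    have h1 : S (t₁, x₁, ξ) = (t₁, x₁, σ ξ) := by
      obtain ⟨a1, a2⟩ := Prod.mk.inj hξ.2.2
      exact Prod.ext a1 (Prod.ext (Prod.mk.inj a2).1 rfl)
    rw [← h1]
    exact hξ.2.2
  have hσc : Filter.Tendsto σ (𝓝 (ζ ϰ₁)) (𝓝 ϰ₁) := by
    have := hσs.self_of_nhds.1.continuousAt
    rwa [ContinuousAt, hσ₁] at this
  have key := eventually_member_eq hD hH (σ := fun ϰ => σ (ζ ϰ)) hf
    (by rwa [hσ₁]) (by rw [h₁]; exact hS.mono fun p hp => hp.1)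
    (by rw [ContinuousAt, hσ₁]; exact hσc.comp hζc) (by
      filter_upwards [hζc.eventually hσs] with ϰ hϰ
      rw [hϰ.2]
      rfl)
  have hϰ : Filter.Tendsto (fun z : Pt ρ => z.2.2) (𝓝 (t₁, x₁, ϰ₁)) (𝓝 ϰ₁) :=
    (by fun_prop : Continuous fun z : Pt ρ => z.2.2).continuousAt
  have hg : Filter.Tendsto (fun z : Pt ρ => ((z.1, z.2.1, σ (ζ z.2.2)) : Pt ρ))
      (𝓝 (t₁, x₁, ϰ₁)) (𝓝 (t₁, x₁, ϰ₁)) :=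
    continuousAt_fst.prodMk_nhds (continuous_snd.fst.continuousAt.prodMk_nhds
      (hσc.comp (hζc.comp hϰ)))
  refine Filter.eventually_smallSets_forall.2 ?_ |>.mono fun W hW hess => hess
    ⟨s, hsρ, ζ, fun p => f (p.1, p.2.1, σ p.2.2), hW⟩
  filter_upwards [key, hϰ.eventually hζs, (hζc.comp hϰ).eventually hσs, hg.eventually hf]
    with z h1 h2 h3 h4
  have h5 : ContDiffAt ℝ ∞ (fun p : Pt s => σ p.2.2) (z.1, z.2.1, ζ z.2.2) :=
    ContDiffAt.comp (g := σ) (f := fun p : Pt s => p.2.2) _ h3.1 contDiffAt_snd.snd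
  exact ⟨h2, ContDiffAt.comp (g := f) (f := fun p : Pt s => ((p.1, p.2.1, σ p.2.2) : Pt ρ)) _
    h4.1 (contDiffAt_fst.prodMk (contDiffAt_snd.fst.prodMk h5)), h1⟩

/-- Where all points are singular, the parameters are not essential. -/
theorem exists_not_essentialOn (hD : IsOpen D) (hH : ContDiffOn ℝ ∞ H D) {W : Set (Pt ρ)}
    (hW : IsOpen W) (hne : W.Nonempty) (hf : IsSolutionFamilyOn H D f W)
    (hsing : ∀ z ∈ W, (paramJacobian f z).det = 0) :
    ∃ W' ⊆ W, IsOpen W' ∧ W'.Nonempty ∧ ¬ EssentialOn f W' := by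
  classical
  -- `s` is the maximal rank in `W` of the first derivatives of the sequence `f₀, f₁, …`.
  have hex : ∃ n, ∀ z ∈ W,
      ¬ Function.Surjective fun w (a : Fin n) => fderiv ℝ (famX f a) z (0, 0, w) :=
    ⟨ρ, fun z hz h => (paramJacobian_det_ne_zero_iff (hf z hz).1).2 h (hsing z hz)⟩
  have hmin : Nat.find hex ≤ ρ := Nat.find_min' hex fun z hz h =>
    (paramJacobian_det_ne_zero_iff (hf z hz).1).2 h (hsing z hz)
  have hspec := Nat.find_spec hex
  obtain ⟨s, hs⟩ : ∃ s, Nat.find hex = s + 1 := by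
    refine Nat.exists_eq_succ_of_ne_zero fun h0 => ?_
    rw [h0] at hspec
    obtain ⟨z, hz⟩ := hne
    exact hspec z hz fun ξ => ⟨0, Subsingleton.elim _ _⟩
  have hlow := Nat.find_min hex (m := s) (by omega)
  push Not at hlow
  obtain ⟨z₁, hz₁, hsurj⟩ := hlow
  rw [hs] at hspec hmin
  have hWn := hW.mem_nhds hz₁
  obtain ⟨η, S, hS₁, hS, hη⟩ := exists_functional_dependence
    (Filter.mem_of_superset hWn fun z hz => (hf z hz).1) hsurj
    (Filter.mem_of_superset hWn hspec)
  have hinv : ∀ᶠ z in 𝓝 z₁, IsInvariantFamilyAt H D η f z := by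
    filter_upwards [hWn, hη] with z h1 h2
    exact ⟨(hf z h1).1, (hf z h1).2, h2⟩
  have := exists_not_essentialOn_of_dependence hD hH (by omega) hinv hS₁ hS
  obtain ⟨V, hV, hV'⟩ := Filter.eventually_smallSets.1 this
  obtain ⟨W', hW', hWo, hz⟩ := mem_nhds_iff.1 (Filter.inter_mem hV hWn)
  exact ⟨W', hW'.trans Set.inter_subset_right, hWo, ⟨z₁, hz⟩,
    hV' W' (hW'.trans Set.inter_subset_left)⟩

/-- The parameters are essential on all open subsets if and only if the regular points are dense. -/
theorem essentialOn_iff_regular_dense (hD : IsOpen D) (hH : ContDiffOn ℝ ∞ H D) {W : Set (Pt ρ)}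
    (hW : IsOpen W) (hf : IsSolutionFamilyOn H D f W) :
    (∀ W' ⊆ W, IsOpen W' → W'.Nonempty → EssentialOn f W') ↔
      W ⊆ closure {z ∈ W | (paramJacobian f z).det ≠ 0} := by
  constructor
  · intro h z hz
    rw [mem_closure_iff]
    intro U hU hzU
    by_contra hcon
    obtain ⟨W', hW', ho, hne, hess⟩ := exists_not_essentialOn hD hH (hU.inter hW) ⟨z, hzU, hz⟩
      (fun z hz => hf z hz.2) (fun z hz => by
        by_contra hreg
        exact hcon ⟨z, hz.1, hz.2, hreg⟩)
    exact hess (h W' (hW'.trans Set.inter_subset_right) ho hne)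
  · rintro h W' hW' ho ⟨z, hz⟩
    obtain ⟨z', hz', hz'W, hreg⟩ := mem_closure_iff.1 (h (hW' hz)) W' ho hz
    exact essentialOn_of_regular ho hz' (hf z' hz'W).1 hreg

end Essential

end EvolEq

end

theorem mainTheorem1 (r ρ : ℕ) (hr : 1 ≤ r) (hρ : 1 ≤ ρ)
    (D : Set (EvolEq.Pt (r + 1))) (hD : IsOpen D)
    (H : EvolEq.Pt (r + 1) → ℝ) (hH : ContDiffOn ℝ ∞ H D)
    (hHr : ∀ q ∈ D, deriv (fun s => H (q.1, q.2.1, Function.update q.2.2 (Fin.last r) s))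
      (q.2.2 (Fin.last r)) ≠ 0) :
    (∀ (f : EvolEq.Pt ρ → ℝ) (W : Set (EvolEq.Pt ρ)), IsOpen W →
      EvolEq.IsSolutionFamilyOn H D f W →
      ((∀ W' ⊆ W, IsOpen W' → W'.Nonempty → EvolEq.EssentialOn f W') ↔
        W ⊆ closure {z ∈ W | (EvolEq.paramJacobian f z).det ≠ 0})) ∧
    ∀ z₀ : EvolEq.Pt ρ,
      ∃ Φ : Quotient (EvolEq.reparamSetoid H D z₀) ≃ EvolEq.CondSymmetryGerm H D z₀,
        ∀ (F : EvolEq.SolutionFamily H D z₀) (η : EvolEq.Pt ρ → ℝ),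
          ((Φ (Quotient.mk (EvolEq.reparamSetoid H D z₀) F)).1 = (η : Filter.Germ (𝓝 z₀) ℝ) ↔
            EvolEq.IsFamilyOfInvariantSolutions η F) := by
  refine ⟨fun f W hW hf => EvolEq.essentialOn_iff_regular_dense hD hH hW hf, fun z₀ => ?_⟩
  exact EvolEq.exists_equiv_condSymmetryGerm hr hρ hD hH z₀
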